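/- **Setting.** Sources $1,\dots,C$ ($C\ge 1$) generate packets according to independent Poisson processes of rates $\lambda_1,\dots,\lambda_C>0$; put $\lambda=\sum_{c'}\lambda_{c'}$. A generated packet arrives at once at a single server without waiting room. Policy (non-preemptive, blocking): a packet that arrives while the server is busy is lost; a packet that arrives while the server is idle is served immediately and is received by the sink when its service ends. The service times of the served packets are i.i.d., distributed as a random variable $S\ge 0$ with mean $1/\mu\in(0,\infty)$ and arbitrary distribution, and independent of the packet generation. The system is observed from time $0$; its state at time $0$ (the last packet that entered service, when its service ends or ended, and the earlier time stamps) may be random but is independent of the packet generation and of the service times after time $0$. Write $M_S(s)=\mathbb E[e^{sS}]$ for real $s$. Fix a source $c$. Let $t_{c,i}$ and $t'_{c,i}$ be the generation and reception times of its $i$-th delivered packet, $T_{c,i}=t'_{c,i}-t_{c,i}$, $Y_{c,i}=t'_{c,i+1}-t'_{c,i}$. The packets are numbered $i=0,1,\dots$, where number $0$ may be a packet that entered service before time $0$, so that every packet $i\ge1$ is generated after time $0$. The peak age of information is $A_{c,i}=Y_{c,i-1}+T_{c,i-1}$. The age of information (AoI) at time $t\ge0$ is $\delta_c(t)=t-U_c(t)$,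 where $U_c(t)$ is the generation time of the packet of source $c$ received most recently up to time $t$. **Theorem 3.** Let $D(s)=\lambda-s-(\lambda-\lambda_c)M_S(s)$. 1. (Peak AoI.) For every $i\ge 2$ and real $s$, $\mathbb E[e^{sA_{c,i}}]$ is finite if and only if $M_S(s)<\infty$ and $D(s)>0$, and in that case $$\mathbb E[e^{sA_{c,i}}]=\frac{\lambda_c M_S(s)^2}{\lambda-s-(\lambda-\lambda_c)M_S(s)}.$$ 2. (AoI, stationary.) If the distribution of $\delta_c(t)$ does not depend on $t\ge 0$, then for every $t\ge0$ and real $s\neq0$, $\mathbb E[e^{s\delta_c(t)}]$ is finite if and only if $M_S(s)<\infty$ and $D(s)>0$, and in that case $$\mathbb E[e^{s\delta_c(t)}]=\frac{\lambda_c M_S(s)\,\bigl(s+\lambda(M_S(s)-1)\bigr)}{s(\lambda/\mu+1)\bigl(\lambda-s-(\lambda-\lambda_c)M_S(s)\bigr)}.$$ 3. (AoI, time average.) For every initial state, stationary or not, and every real $s\neq0$ with $M_S(s)<\infty$ and $D(s)>0$, almost surely $\lim_{\tau\to\infty}\frac1\tau\int_0^\tau e^{s\delta_c(t)}\,dt$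 exists and equals the right-hand side in 2. -/

import Mathlib

open MeasureTheory ProbabilityTheory Filter Topology

/-- The random inputs of a status update system with sources `Fin C`, one server and no waiting
room, observed from time `0` on. Nothing is assumed here about their joint distribution. -/
structure StatusUpdateSystem (C : ℕ) (Ω : Type*) where
  /-- `gap c n` is the time between the generations of the packets `n - 1` and `n` of source `c`
  (for `n = 0`: between time `0` and the first generation after time `0`). -/
  gap : Fin C → ℕ → Ω → ℝ
  /-- `service k` is the service time of the `k`-th packet that enters service after time `0`. -/
  service : ℕ → Ω → ℝ
  /-- Source of the last packet that entered service up to time `0`. -/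
  initSource : Ω → Fin C
  /-- Generation time of that packet. -/
  initStart : Ω → ℝ
  /-- Service completion time of that packet: the server is busy with it at time `0` if this
  time is positive, and idle at time `0` otherwise. -/
  initEnd : Ω → ℝ
  /-- For each source, the generation time of its last packet received before that packet entered
  service. -/
  initStamp : Fin C → Ω → ℝ

namespace StatusUpdateSystem

variable {C : ℕ} {Ω : Type*} (Q : StatusUpdateSystem C Ω)

/-- Generation time of the packet `n` of source `c` (which arrives at the server at once). -/
noncomputable def arrival (c : Fin C) (n : ℕ) (ω : Ω) : ℝ :=
  ∑ k ∈ Finset.range (n + 1), Q.gap c k ω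

/-- The first generation time, over all sources, after time `d`. -/
noncomputable def nextArrival (d : ℝ) (ω : Ω) : ℝ :=
  sInf {t : ℝ | d < t ∧ ∃ c n, Q.arrival c n ω = t}

/-- Service completion time of the `k`-th served packet under the non-preemptive policy. Packet
`0` is the last one that entered service up to time `0`. Whatever arrives while the server is busy
is lost, so the next packet to be served is the first to arrive after the server has become
idle. -/
noncomputable def serviceEnd : ℕ → Ω → ℝ
  | 0, ω => Q.initEnd ω
  | k + 1, ω => Q.nextArrival (serviceEnd k ω) ω + Q.service k ω

/-- Generation time, equal to the service starting time, of the `k`-th served packet. -/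
noncomputable def serviceStart : ℕ → Ω → ℝ
  | 0, ω => Q.initStart ω
  | k + 1, ω => Q.nextArrival (Q.serviceEnd k ω) ω

/-- The `k`-th served packet belongs to source `c`. -/
def IsFrom (c : Fin C) : ℕ → Ω → Prop
  | 0, ω => Q.initSource ω = c
  | k + 1, ω => ∃ n, Q.arrival c n ω = Q.serviceStart (k + 1) ω

/-- Generation time `t_{c,i}` of the `i`-th delivered packet of source `c`, `i = 0, 1, …`. -/
noncomputable def genTime (c : Fin C) (i : ℕ) (ω : Ω) : ℝ :=
  Q.serviceStart (Nat.nth (fun k => Q.IsFrom c k ω) i) ω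

/-- Time `t'_{c,i}` at which the `i`-th delivered packet of source `c` arrives at the sink. -/
noncomputable def recTime (c : Fin C) (i : ℕ) (ω : Ω) : ℝ :=
  Q.serviceEnd (Nat.nth (fun k => Q.IsFrom c k ω) i) ω

/-- System time `T_{c,i}`. -/
noncomputable def systemTime (c : Fin C) (i : ℕ) (ω : Ω) : ℝ :=
  Q.recTime c i ω - Q.genTime c i ω

/-- Interdeparture time `Y_{c,i}`. -/
noncomputable def interdeparture (c : Fin C) (i : ℕ) (ω : Ω) : ℝ :=
  Q.recTime c (i + 1) ω - Q.recTime c i ω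

/-- Peak age of information `A_{c,i}`, reached just before packet `i ≥ 1` is received. -/
noncomputable def peakAge (c : Fin C) (i : ℕ) (ω : Ω) : ℝ :=
  Q.interdeparture c (i - 1) ω + Q.systemTime c (i - 1) ω

open Classical in
/-- Time stamp `U_c(t)`, `t ≥ 0`, of the most recently received packet of source `c`. -/
noncomputable def stamp (c : Fin C) (t : ℝ) (ω : Ω) : ℝ :=
  if ∃ i, Q.recTime c i ω ≤ t then Q.genTime c (sSup {i : ℕ | Q.recTime c i ω ≤ t}) ω
  else Q.initStamp c ω

/-- Age of information `δ_c(t)`, `t ≥ 0`, of source `c` at the sink. -/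
noncomputable def age (c : Fin C) (t : ℝ) (ω : Ω) : ℝ :=
  t - Q.stamp c t ω

/-- The multi-source M/G/1/1 assumptions: after time `0` the sources generate packets according
to independent Poisson processes of rates `lam c`; the service times of the served packets are
independent with common distribution `ν`, and independent of the packet generation; the state of
the system at time `0` is arbitrary, possibly random, but independent of all of these. -/
structure IsMG11 [MeasurableSpace Ω] (P : Measure Ω) (lam : Fin C → ℝ) (ν : Measure ℝ) :
    Prop where
  measurable_gap : ∀ c n, Measurable (Q.gap c n)
  measurable_service : ∀ k, Measurable (Q.service k)
  measurable_initSource : Measurable Q.initSource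
  measurable_initStart : Measurable Q.initStart
  measurable_initEnd : Measurable Q.initEnd
  measurable_initStamp : ∀ c, Measurable (Q.initStamp c)
  gap_law : ∀ c n, P.map (Q.gap c n) = expMeasure (lam c)
  service_law : ∀ k, P.map (Q.service k) = ν
  indep_gap : iIndepFun (fun p : Fin C × ℕ => Q.gap p.1 p.2) P
  indep_service : iIndepFun Q.service P
  indep_gap_service :
    IndepFun (fun ω => fun (c : Fin C) (n : ℕ) => Q.gap c n ω)
      (fun ω => fun k : ℕ => Q.service k ω) P
  indep_init :
    IndepFun
      (fun ω => (Q.initSource ω, Q.initStart ω, Q.initEnd ω, fun c : Fin C => Q.initStamp c ω))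
      (fun ω => (fun (c : Fin C) (n : ℕ) => Q.gap c n ω, fun k : ℕ => Q.service k ω)) P
  initStart_nonpos : ∀ᵐ ω ∂P, Q.initStart ω ≤ 0
  initStart_le_initEnd : ∀ᵐ ω ∂P, Q.initStart ω ≤ Q.initEnd ω
  initStamp_le_initStart : ∀ᵐ ω ∂P, ∀ c, Q.initStamp c ω ≤ Q.initStart ω

end StatusUpdateSystem

/-! The ends of services are regeneration points. By memorylessness, the Poisson streams seen from
such a moment are again independent Poisson streams. So the idle time X until the next arrival is
exponential of rate λ, its source is c with probability λ_c/λ, and both are independent of each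
other, of the service time S that follows, and of the state after that service (`lintegral_race`,
`regenerative_next`).

A cycle runs from one end of a service of source c to the next: a geometric number of stages X + S
lost to other sources, then one that is won. With M = M_S(s), each stage has the exponential moment
λM/(λ - s) for s < λ, and a geometric series gives E e^{sY} = λ_c M/D(s) for the cycle length Y
(`lintegral_exp_cycleLength`). The series is summed in [0,∞], so it also decides when the moment is
finite. The peak age is the service time that ends one cycle plus the length of the next cycle.
These are independent, whence a further factor M and claim 1.

During a cycle the age grows at unit speed from the preceding service time T to T + Y. When D(s) >
0, the integral of e^{sδ} over a cycle therefore has mean M(E e^{sY} - 1)/s = M(s + λ(M - 1))/(sD).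
Wald's identity gives E Y = (λ/λ_c)(1/λ + 1/μ), and the quotient of the two means is the value in
claims 2 and 3 (`integral_reward_exp_div`). Claim 3 is the strong law for cycles
(`tendsto_timeAverage_age`). The initial state is forgotten because the inputs, seen from the moment
when the initial packet is done, keep their law and are independent of the initial data
(`lintegral_initData_freeState`).

For claim 2, stationarity and Fubini identify the mean of a bounded function of the age with its
time average (`integral_age_eq_of_bounded`). Truncation and monotone convergence extend this to
e^{sδ} as an identity in [0,∞] (`lintegral_exp_age`), which again settles finiteness. -/

open scoped ENNReal

/-! ### Regenerative maps and the strong law along them -/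

/-- The observation `φ` is independent of the state `T` reached after it, which is distributed like
the initial state. -/
structure Regenerative {E F : Type*} [MeasurableSpace E] [MeasurableSpace F] (ρ : Measure E)
    (φ : E → F) (T : E → E) : Prop where
  preserving : MeasurePreserving T ρ ρ
  measurable : Measurable φ
  indep : IndepFun φ T ρ

namespace Regenerative

variable {E F : Type*} [MeasurableSpace E] [MeasurableSpace F] {ρ : Measure E} {φ : E → F}
  {T : E → E}

theorem lintegral_mul (h : Regenerative ρ φ T) {u : F → ℝ≥0∞} (hu : Measurable u) {w : E → ℝ≥0∞}
    (hw : Measurable w) :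
    ∫⁻ e, u (φ e) * w (T e) ∂ρ = (∫⁻ e, u (φ e) ∂ρ) * ∫⁻ e, w e ∂ρ := by
  rw [← h.preserving.lintegral_comp hw]
  exact lintegral_mul_eq_lintegral_mul_lintegral_of_indepFun (hu.comp h.measurable)
    (hw.comp h.preserving.measurable) (h.indep.comp hu hw)

theorem comp (h : Regenerative ρ φ T) {H : Type*} [MeasurableSpace H] {g : F → H}
    (hg : Measurable g) : Regenerative ρ (fun e => g (φ e)) T :=
  ⟨h.preserving, hg.comp h.measurable, h.indep.comp hg measurable_id⟩

/-- For integrands that couple the observation with the future and are not products: the future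
state becomes an independent copy of the initial one. -/
theorem lintegral_pair (h : Regenerative ρ φ T) [IsProbabilityMeasure ρ] {K : F × E → ℝ≥0∞}
    (hK : Measurable K) :
    ∫⁻ e, K (φ e, T e) ∂ρ = ∫⁻ e, ∫⁻ e', K (φ e, e') ∂ρ ∂ρ := by
  have hφ := h.measurable
  have hT := h.preserving.measurable
  have h1 := (indepFun_iff_map_prod_eq_prod_map_map hφ.aemeasurable hT.aemeasurable).1 h.indep
  rw [h.preserving.map_eq] at h1
  have : IsProbabilityMeasure (ρ.map φ) := Measure.isProbabilityMeasure_map hφ.aemeasurable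
  rw [← lintegral_map (f := K) (g := fun e => (φ e, T e)) hK (hφ.prodMk hT), h1,
    lintegral_prod _ hK.aemeasurable, lintegral_map hK.lintegral_prod_right' hφ]

/-- Taking `u = 1` gives invariance of `ρ`, and indicators give independence, so one product formula
yields the whole structure. -/
theorem of_lintegral [IsProbabilityMeasure ρ] (hφ : Measurable φ) (hT : Measurable T)
    (h : ∀ (u : F → ℝ≥0∞) (w : E → ℝ≥0∞), Measurable u → Measurable w →
      ∫⁻ e, u (φ e) * w (T e) ∂ρ = (∫⁻ e, u (φ e) ∂ρ) * ∫⁻ e, w e ∂ρ) :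
    Regenerative ρ φ T := by
  have hp : MeasurePreserving T ρ ρ := by
    refine ⟨hT, ?_⟩
    ext A hA
    have := h (fun _ => 1) (A.indicator 1) measurable_const (measurable_one.indicator hA)
    rw [Measure.map_apply hT hA, ← lintegral_indicator_one (hT hA), ← lintegral_indicator_one hA]
    simp only [one_mul, lintegral_one, measure_univ] at this
    exact this
  refine ⟨hp, hφ, ?_⟩
  rw [indepFun_iff_measure_inter_preimage_eq_mul]
  intro B A hB hA
  have := h (B.indicator 1) (A.indicator 1) (measurable_one.indicator hB)
    (measurable_one.indicator hA)
  rw [hp.measure_preimage hA.nullMeasurableSet, ← lintegral_indicator_one hA,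
    ← lintegral_indicator_one (hφ hB),
    ← lintegral_indicator_one ((hφ hB).inter (hT hA)), Set.inter_indicator_one]
  exact this

/-- Peel off the first factor: all the others are functions of `T e`, so the induction hypothesis
applies to them. -/
theorem lintegral_prod_mul (h : Regenerative ρ φ T) {a b : F → ℝ≥0∞} (ha : Measurable a)
    (hb : Measurable b) (n : ℕ) :
    ∫⁻ e, (∏ k ∈ Finset.range n, b (φ (T^[k] e))) * a (φ (T^[n] e)) ∂ρ =
      (∫⁻ e, b (φ e) ∂ρ) ^ n * ∫⁻ e, a (φ e) ∂ρ := by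
  induction n with
  | zero => simp
  | succ n ih =>
    have hm : ∀ k, Measurable (T^[k]) := fun k => h.preserving.measurable.iterate k
    have hφ := h.measurable
    have := h.lintegral_mul hb (w := fun e =>
      (∏ k ∈ Finset.range n, b (φ (T^[k] e))) * a (φ (T^[n] e)))
      (by fun_prop)
    rw [ih] at this
    rw [pow_succ', mul_assoc, ← this]
    refine lintegral_congr fun e => ?_
    rw [Finset.prod_range_succ']
    simp only [Function.iterate_succ_apply, Function.iterate_zero, id]
    ring

/-- If `b` vanishes on success and `a` on failure, only the term of the first success survives, so
this evaluates functionals of a run of trials. The truncated `1 - ∫ b` is `0` when `∫ b ≥ 1`, with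
inverse `⊤`, so a divergent series is covered as well. -/
theorem lintegral_tsum_prod_mul (h : Regenerative ρ φ T) {a b : F → ℝ≥0∞} (ha : Measurable a)
    (hb : Measurable b) :
    ∫⁻ e, ∑' n, (∏ k ∈ Finset.range n, b (φ (T^[k] e))) * a (φ (T^[n] e)) ∂ρ =
      (1 - ∫⁻ e, b (φ e) ∂ρ)⁻¹ * ∫⁻ e, a (φ e) ∂ρ := by
  have hm : ∀ k, Measurable (T^[k]) := fun k => h.preserving.measurable.iterate k
  have hφ := h.measurable
  rw [lintegral_tsum fun n => Measurable.aemeasurable (by fun_prop)]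
  simp only [h.lintegral_prod_mul ha hb]
  rw [ENNReal.tsum_mul_right, ENNReal.tsum_geometric]

/-- The first `n` observations. -/
def path (φ : E → F) (T : E → E) (n : ℕ) (e : E) : Fin n → F := fun i => φ (T^[i] e)

theorem measurable_path (h : Regenerative ρ φ T) (n : ℕ) : Measurable (path φ T n) :=
  measurable_pi_lambda _ fun i => h.measurable.comp (h.preserving.measurable.iterate i)

/-- Observations in blocks of `n`; needed for stopping and for quantities that involve two
consecutive cycles. -/
theorem iterate (h : Regenerative ρ φ T) [IsProbabilityMeasure ρ] (n : ℕ) :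
    Regenerative ρ (path φ T n) (T^[n]) := by
  refine ⟨h.preserving.iterate n, h.measurable_path n, ?_⟩
  induction n with
  | zero =>
    have : path φ T 0 = fun _ => Fin.elim0 := by
      ext e i; exact i.elim0
    rw [this]
    exact indepFun_const_left _ _
  | succ n ih =>
    have hT := h.preserving.measurable
    have hp := h.measurable_path n
    have hcons : Measurable fun p : F × (Fin n → F) => (Fin.cons p.1 p.2 : Fin (n + 1) → F) := by
      refine measurable_pi_lambda _ fun i => ?_
      refine Fin.cases ?_ (fun i => ?_) i
      · simpa using measurable_fst
      · simp only [Fin.cons_succ]; fun_prop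
    -- The law of the triple (first observation, later observations, final state) is a product;
    -- reassociating it splits off the final state.
    have key : Regenerative ρ (fun e => (φ e, path φ T n (T e))) (T^[n + 1]) := by
      have R : Regenerative ρ (path φ T n) (T^[n]) :=
        ⟨h.preserving.iterate n, h.measurable_path n, ih⟩
      refine ⟨h.preserving.iterate _, h.measurable.prodMk (hp.comp hT), ?_⟩
      refine (indepFun_iff_map_prod_eq_prod_map_map (f := fun e => (φ e, path φ T n (T e)))
        (h.measurable.prodMk (hp.comp hT)).aemeasurable
        (h.preserving.iterate _).measurable.aemeasurable).2 ?_
      have e1 : ρ.map (fun e => (φ e, path φ T n (T e)))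
          = (ρ.map φ).prod (ρ.map (path φ T n)) := by
        have : IndepFun φ (path φ T n ∘ T) ρ := h.indep.comp measurable_id hp
        rw [indepFun_iff_map_prod_eq_prod_map_map h.measurable.aemeasurable
          (hp.comp hT).aemeasurable] at this
        refine this.trans ?_
        rw [← Measure.map_map hp hT, h.preserving.map_eq]
      have hTn := (h.preserving.iterate n).measurable
      have e2 : ρ.map (fun e => (path φ T n e, T^[n] e)) =
          (ρ.map (path φ T n)).prod ρ := by
        rw [(indepFun_iff_map_prod_eq_prod_map_map hp.aemeasurable hTn.aemeasurable).1 ih,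
          (h.preserving.iterate n).map_eq]
      have e3 : ρ.map (fun e => (φ e, path φ T n (T e), T^[n] (T e))) =
          (ρ.map φ).prod ((ρ.map (path φ T n)).prod ρ) := by
        have : IndepFun φ ((fun e => (path φ T n e, T^[n] e)) ∘ T) ρ :=
          h.indep.comp measurable_id (hp.prodMk hTn)
        rw [indepFun_iff_map_prod_eq_prod_map_map h.measurable.aemeasurable
          ((hp.prodMk hTn).comp hT).aemeasurable] at this
        refine this.trans ?_
        rw [← Measure.map_map (hp.prodMk hTn) hT, h.preserving.map_eq, e2]
      have hφ := h.measurable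
      have : IsProbabilityMeasure (ρ.map φ) := Measure.isProbabilityMeasure_map hφ.aemeasurable
      have : IsProbabilityMeasure (ρ.map (path φ T n)) :=
        Measure.isProbabilityMeasure_map hp.aemeasurable
      rw [e1, (h.preserving.iterate _).map_eq]
      have e4 := (measurePreserving_prodAssoc (ρ.map φ) (ρ.map (path φ T n)) ρ).symm
      rw [← e4.map_eq, ← e3, Measure.map_map e4.measurable (by fun_prop)]
      rfl
    have := key.indep.comp hcons measurable_id
    convert! this using 1
    ext e i
    refine Fin.cases ?_ (fun i => ?_) i
    · simp [path]
    · simp [path, Function.iterate_succ_apply]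

/-- A regenerative map may be iterated until a time that is determined by the observations made
so far. -/
theorem stopped (h : Regenerative ρ φ T) [IsProbabilityMeasure ρ] {H : Type*} [MeasurableSpace H]
    {N : E → ℕ} {Ψ : E → H} (hN : Measurable N) (hΨ : Measurable Ψ)
    {D : ∀ n, Set (Fin (n + 1) → F)} (hD : ∀ n, MeasurableSet (D n))
    {ψ : ∀ n, (Fin (n + 1) → F) → H} (hψ : ∀ n, Measurable (ψ n))
    (hND : ∀ᵐ e ∂ρ, ∀ n, N e = n ↔ path φ T (n + 1) e ∈ D n)
    (hΨψ : ∀ e, Ψ e = ψ (N e) (path φ T (N e + 1) e)) :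
    Regenerative ρ Ψ (fun e => T^[N e + 1] e) := by
  have hT := h.preserving.measurable
  have hm : Measurable (fun e => T^[N e + 1] e) := by
    have : Measurable (fun p : ℕ × E => T^[p.1 + 1] p.2) :=
      measurable_from_prod_countable_right fun n => hT.iterate (n + 1)
    exact this.comp (hN.prodMk measurable_id)
  refine of_lintegral hΨ hm fun u w hu hw => ?_
  -- The event `N = n` is decided by the first `n + 1` observations, and on it `Ψ` is a function of
  -- them; `U n` carries the indicator of that event.
  let U : ∀ n, (Fin (n + 1) → F) → ℝ≥0∞ := fun n => (D n).indicator fun p => u (ψ n p)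
  have hU : ∀ n, Measurable (U n) := fun n => (hu.comp (hψ n)).indicator (hD n)
  have key : ∀ (w : E → ℝ≥0∞), ∀ᵐ e ∂ρ,
      u (Ψ e) * w (T^[N e + 1] e) = ∑' n, U n (path φ T (n + 1) e) * w (T^[n + 1] e) := by
    intro w
    filter_upwards [hND] with e hND
    rw [tsum_eq_single (N e)]
    · simp only [U]
      rw [Set.indicator_of_mem ((hND _).1 rfl), hΨψ]
    · intro n hn
      simp only [U]
      rw [Set.indicator_of_notMem, zero_mul]
      exact fun h' => hn ((hND _).2 h').symm
  have hm' : ∀ n (w : E → ℝ≥0∞), Measurable w →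
      Measurable fun e => U n (path φ T (n + 1) e) * w (T^[n + 1] e) := fun n w hw =>
    ((hU n).comp (h.measurable_path _)).mul (hw.comp (hT.iterate _))
  have key2 : ∫⁻ e, u (Ψ e) ∂ρ = ∑' n, ∫⁻ e, U n (path φ T (n + 1) e) ∂ρ := by
    have := key (fun _ => 1)
    simp only [mul_one] at this
    rw [lintegral_congr_ae this]
    exact lintegral_tsum fun n => ((hU n).comp (h.measurable_path _)).aemeasurable
  rw [lintegral_congr_ae (key w), lintegral_tsum fun n => (hm' n w hw).aemeasurable, key2, ← ENNReal.tsum_mul_right]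
  exact tsum_congr fun n => (h.iterate (n + 1)).lintegral_mul (hU n) hw

/-- A sequence of observations along a regenerative map obeys the strong law of large numbers. -/
theorem strong_law {q : E → ℝ} (h : Regenerative ρ q T) [IsProbabilityMeasure ρ]
    (hq : Integrable q ρ) :
    ∀ᵐ e ∂ρ, Tendsto (fun n : ℕ => (∑ i ∈ Finset.range n, q (T^[i] e)) / n) atTop
      (𝓝 (∫ e, q e ∂ρ)) := by
  have hT := h.preserving.measurable
  have hind : ∀ i j, i < j → IndepFun (fun e => q (T^[i] e)) (fun e => q (T^[j] e)) ρ := by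
    intro i j hij
    obtain ⟨k, rfl⟩ := Nat.exists_eq_add_of_lt hij
    -- This is the case `i = 0`; the measure-preserving `T^[i]` carries it to every `i`.
    have h1 : IndepFun q (fun e => q (T^[k] (T e))) ρ :=
      h.indep.comp measurable_id (h.measurable.comp (hT.iterate k))
    have hm := (h.preserving.iterate i)
    rw [indepFun_iff_measure_inter_preimage_eq_mul] at h1 ⊢
    intro A B hA hB
    have h2 := h1 A B hA hB
    have m1 := h.measurable hA
    have m2 : MeasurableSet ((fun e => q (T^[k] (T e))) ⁻¹' B) :=
      (h.measurable.comp ((hT.iterate k).comp hT)) hB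
    rw [← hm.measure_preimage (m1.inter m2).nullMeasurableSet,
      ← hm.measure_preimage m1.nullMeasurableSet, ← hm.measure_preimage m2.nullMeasurableSet] at h2
    have : ∀ e, T^[i + k + 1] e = T^[k] (T (T^[i] e)) := fun e => by
      rw [add_assoc, add_comm, Function.iterate_add_apply, Function.iterate_succ_apply]
    simp only [this]
    exact h2
  refine strong_law_ae_real (fun n e => q (T^[n] e)) hq ?_ ?_
  · intro i j hij
    rcases lt_or_gt_of_ne hij with h' | h'
    · exact hind i j h'
    · exact (hind j i h').symm
  · intro i
    refine ⟨(h.measurable.comp (hT.iterate i)).aemeasurable, h.measurable.aemeasurable, ?_⟩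
    change ρ.map (q ∘ T^[i]) = ρ.map q
    rw [← Measure.map_map h.measurable (hT.iterate i), (h.preserving.iterate i).map_eq]

end Regenerative

/-! ### Independent identically distributed sequences -/

section Sequences

/-- The sequence without its first term. -/
def seqTail {X : Type*} (x : ℕ → X) (n : ℕ) : X := x (n + 1)

@[fun_prop]
theorem measurable_seqTail {X : Type*} [MeasurableSpace X] : Measurable (seqTail : (ℕ → X) → ℕ → X) :=
  measurable_pi_lambda _ fun n => measurable_pi_apply (n + 1)

theorem seqTail_iterate {X : Type*} (x : ℕ → X) (k n : ℕ) : (seqTail^[k] x) n = x (n + k) := by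
  induction k generalizing x with
  | zero => rfl
  | succ k ih => rw [Function.iterate_succ_apply, ih]; simp [seqTail, add_assoc]

/-- The first term of an independent identically distributed sequence is independent of the rest,
which is distributed like the sequence itself. -/
theorem regenerative_seqTail {X : Type*} [MeasurableSpace X] (ν : Measure X)
    [IsProbabilityMeasure ν] :
    Regenerative (Measure.infinitePi fun _ : ℕ => ν) (fun x => x 0) seqTail := by
  have h0 : Measurable fun x : ℕ → X => x 0 := measurable_pi_apply 0
  have hp : MeasurePreserving seqTail (Measure.infinitePi fun _ : ℕ => ν)
      (Measure.infinitePi fun _ : ℕ => ν) :=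
    ⟨measurable_seqTail, Measure.map_infinitePi_infinitePi_of_inj (P := fun _ : ℕ => ν)
      (f := fun n : ℕ => n + 1) (add_left_injective 1)⟩
  refine ⟨hp, h0, ?_⟩
  let cons : X × (ℕ → X) → ℕ → X := fun p n => Nat.casesOn n p.1 p.2
  have hc : Measurable cons := by
    refine measurable_pi_lambda _ fun n => ?_
    cases n with
    | zero => exact measurable_fst
    | succ n => exact (measurable_pi_apply n).comp measurable_snd
  -- Gluing an independent head to a sequence reproduces the law of the sequence; undoing the gluing
  -- then shows that head and tail are independent. The boxes are padded with `Set.univ` to range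
  -- over an initial segment of `ℕ`.
  have key : (ν.prod (Measure.infinitePi fun _ : ℕ => ν)).map cons =
      Measure.infinitePi fun _ : ℕ => ν := by
    refine Measure.eq_infinitePi _ fun s t ht => ?_
    classical
    obtain ⟨n, hn⟩ := s.exists_nat_subset_range
    let t' : ℕ → Set X := fun i => if i ∈ s then t i else Set.univ
    have ht' : ∀ i, MeasurableSet (t' i) := fun i => by
      by_cases hi : i ∈ s <;> simp [t', hi, ht]
    have e1 : Set.pi (s : Set ℕ) t = Set.pi (Finset.range (n + 1) : Set ℕ) t' := by
      ext x
      simp only [Set.mem_pi, Finset.mem_coe, t']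
      refine ⟨fun h i _ => ?_, fun h i hi => ?_⟩
      · by_cases his : i ∈ s
        · simpa [his] using h i his
        · simp [his]
      · simpa [hi] using h i (Finset.range_mono n.le_succ (hn hi))
    have e2 : ∏ i ∈ s, ν (t i) = ∏ i ∈ Finset.range (n + 1), ν (t' i) := by
      have : ∏ i ∈ s, ν (t i) = ∏ i ∈ s, ν (t' i) :=
        Finset.prod_congr rfl fun i hi => by simp [t', hi]
      rw [this]
      refine Finset.prod_subset (hn.trans (Finset.range_mono n.le_succ)) fun i _ hi => ?_
      simp [t', hi]
    have e3 : cons ⁻¹' Set.pi (Finset.range (n + 1) : Set ℕ) t' =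
        t' 0 ×ˢ Set.pi (Finset.range n : Set ℕ) fun i => t' (i + 1) := by
      ext ⟨y, x⟩
      simp only [Set.mem_preimage, Set.mem_pi, Finset.mem_coe, Finset.mem_range, Set.mem_prod]
      refine ⟨fun h => ⟨h 0 (Nat.succ_pos n), fun i hi => h (i + 1) (by omega)⟩, fun h i hi => ?_⟩
      cases i with
      | zero => exact h.1
      | succ i => exact h.2 i (by omega)
    rw [e1, e2, Measure.map_apply hc, e3, Measure.prod_prod,
      Measure.infinitePi_pi _ fun i _ => ht' (i + 1), Finset.prod_range_succ', mul_comm]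
    exact MeasurableSet.pi (Finset.countable_toSet _) fun i _ => ht' i
  refine (indepFun_iff_map_prod_eq_prod_map_map h0.aemeasurable
    measurable_seqTail.aemeasurable).2 ?_
  rw [hp.map_eq, Measure.infinitePi_map_eval (fun _ : ℕ => ν) 0]
  conv_lhs => rw [← key]
  rw [Measure.map_map (by fun_prop) hc]
  exact Measure.map_id

end Sequences

/-! ### The exponential distribution -/

section Exponential

theorem lintegral_expMeasure (r : ℝ) {w : ℝ → ℝ≥0∞} (hw : Measurable w) :
    ∫⁻ x, w x ∂expMeasure r =
      ∫⁻ x in Set.Ioi 0, ENNReal.ofReal (r * Real.exp (-(r * x))) * w x := by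
  have h1 : expMeasure r = volume.withDensity (exponentialPDF r) := rfl
  have hm : Measurable (exponentialPDF r) := (measurable_exponentialPDFReal r).ennreal_ofReal
  rw [h1, lintegral_withDensity_eq_lintegral_mul _ hm hw, ← lintegral_indicator measurableSet_Ioi]
  have h0 : ∀ᵐ x : ℝ, x ≠ 0 := by simp [ae_iff]
  refine lintegral_congr_ae ?_
  filter_upwards [h0] with x hx
  simp only [Pi.mul_apply]
  rcases lt_or_gt_of_ne hx with h | h
  · rw [exponentialPDF_of_neg h, Set.indicator_of_notMem (by simpa using h.le), zero_mul]
  · rw [exponentialPDF_of_nonneg h.le, Set.indicator_of_mem (by simpa using h)]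

theorem ae_pos_expMeasure (r : ℝ) : ∀ᵐ x ∂expMeasure r, 0 < x := by
  have := lintegral_expMeasure r (w := (Set.Iic 0).indicator 1)
    (measurable_one.indicator measurableSet_Iic)
  rw [lintegral_indicator_one measurableSet_Iic] at this
  rw [ae_iff]
  have h2 : {x : ℝ | ¬ 0 < x} = Set.Iic 0 := by ext; simp
  rw [h2, this, ← lintegral_zero (μ := volume.restrict (Set.Ioi (0 : ℝ)))]
  refine setLIntegral_congr_fun measurableSet_Ioi fun x hx => ?_
  simp only [Set.mem_Ioi] at hx
  simp [hx]

/-- The exponential distribution is memoryless. -/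
theorem lintegral_expMeasure_memoryless {r : ℝ} {t : ℝ} (ht : 0 ≤ t) {w : ℝ → ℝ≥0∞}
    (hw : Measurable w) :
    ∫⁻ x, (Set.Ioi t).indicator (fun x => w (x - t)) x ∂expMeasure r =
      ENNReal.ofReal (Real.exp (-(r * t))) * ∫⁻ x, w x ∂expMeasure r := by
  have hw' : Measurable fun x => w (x - t) := by fun_prop
  rw [lintegral_expMeasure r hw, lintegral_expMeasure r (hw'.indicator measurableSet_Ioi),
    ← lintegral_const_mul _ (by fun_prop), ← lintegral_indicator measurableSet_Ioi,
    ← lintegral_indicator measurableSet_Ioi, ← lintegral_add_right_eq_self _ t]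
  refine lintegral_congr fun x => ?_
  by_cases hx : 0 < x
  · rw [Set.indicator_of_mem (by simp; linarith), Set.indicator_of_mem (by simpa using hx),
      Set.indicator_of_mem (by simpa using hx), ← mul_assoc,
      ← ENNReal.ofReal_mul (Real.exp_pos _).le]
    congr 2
    · rw [mul_left_comm, ← Real.exp_add]; ring_nf
    · simp
  · rw [Set.indicator_of_notMem (s := Set.Ioi 0) (a := x) (by simpa using hx)]
    by_cases hx2 : x + t ∈ Set.Ioi 0
    · rw [Set.indicator_of_mem hx2, Set.indicator_of_notMem (by simpa using hx), mul_zero]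
    · rw [Set.indicator_of_notMem hx2]

/-- A competing exponential clock of rate `q` thins the clock of rate `r`. -/
theorem lintegral_expMeasure_mul_exp {r q : ℝ} (hr : 0 < r) (hq : 0 ≤ q) {u : ℝ → ℝ≥0∞}
    (hu : Measurable u) :
    ∫⁻ x, ENNReal.ofReal (Real.exp (-(q * x))) * u x ∂expMeasure r =
      ENNReal.ofReal (r / (r + q)) * ∫⁻ x, u x ∂expMeasure (r + q) := by
  rw [lintegral_expMeasure _ hu, lintegral_expMeasure _ (by fun_prop),
    ← lintegral_const_mul _ (by fun_prop)]
  refine lintegral_congr fun x => ?_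
  have : 0 < r + q := by linarith
  rw [← mul_assoc, ← mul_assoc, ← ENNReal.ofReal_mul (by positivity),
    ← ENNReal.ofReal_mul (by positivity)]
  congr 2
  rw [mul_assoc, ← Real.exp_add]
  field_simp
  ring_nf

/-- The value `⊤` for `s ≥ r` is recorded because the finiteness criterion depends on it. -/
theorem lintegral_exp_expMeasure {r s : ℝ} (hr : 0 < r) :
    ∫⁻ x, ENNReal.ofReal (Real.exp (s * x)) ∂expMeasure r =
      if s < r then ENNReal.ofReal (r / (r - s)) else ⊤ := by
  rw [lintegral_expMeasure _ (by fun_prop)]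
  have e : ∀ x : ℝ, ENNReal.ofReal (r * Real.exp (-(r * x))) * ENNReal.ofReal (Real.exp (s * x)) =
      ENNReal.ofReal (r * Real.exp ((s - r) * x)) := fun x => by
    rw [← ENNReal.ofReal_mul (by positivity), mul_assoc, ← Real.exp_add]; ring_nf
  simp_rw [e]
  split_ifs with h
  · have h1 := integral_exp_mul_Ioi (a := s - r) (by linarith) 0
    have h2 := (integrableOn_exp_mul_Ioi (a := s - r) (by linarith) 0).const_mul r
    rw [← ofReal_integral_eq_lintegral_ofReal h2 (ae_of_all _ fun x => by positivity),
      integral_const_mul, h1]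
    congr 1
    have : r - s ≠ 0 := by linarith
    have : s - r ≠ 0 := by intro h'; apply this; linarith
    field_simp
    simp
  · push Not at h
    rw [eq_top_iff]
    calc (⊤ : ℝ≥0∞) = ∫⁻ x in Set.Ioi (0 : ℝ), ENNReal.ofReal r := by
          simp [hr]
      _ ≤ _ := by
          refine setLIntegral_mono' measurableSet_Ioi fun x hx => ENNReal.ofReal_le_ofReal ?_
          have : 0 ≤ (s - r) * x := mul_nonneg (by linarith) (le_of_lt hx)
          nlinarith [Real.one_le_exp this]

theorem lintegral_id_expMeasure {r : ℝ} (hr : 0 < r) :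
    ∫⁻ x, ENNReal.ofReal x ∂expMeasure r = ENNReal.ofReal (1 / r) := by
  have := isProbabilityMeasure_expMeasure hr
  have h1 := lintegral_eq_lintegral_meas_lt (expMeasure r) (f := fun x => x)
    ((ae_pos_expMeasure r).mono fun x hx => hx.le) aemeasurable_id
  rw [h1]
  -- The tail at `t` is `1 / r` times the density at `t`, so the integral of the tail is `1 / r`
  -- times the total mass.
  have h2 : ∀ t ∈ Set.Ioi (0 : ℝ), expMeasure r {a | t < a} =
      ENNReal.ofReal (1 / r) * (ENNReal.ofReal (r * Real.exp (-(r * t))) * 1) := by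
    intro t ht
    have h3 := lintegral_expMeasure_memoryless (r := r) (t := t) (le_of_lt ht) (w := fun _ => 1)
      measurable_const
    have h4 := lintegral_indicator_one (μ := expMeasure r) (measurableSet_Ioi (a := t))
    have h5 : {a : ℝ | t < a} = Set.Ioi t := rfl
    rw [h5, ← h4]
    rw [lintegral_one, measure_univ, mul_one] at h3
    rw [mul_one, ← ENNReal.ofReal_mul (by positivity), ← mul_assoc, one_div_mul_cancel hr.ne',
      one_mul, ← h3]
    rfl
  rw [setLIntegral_congr_fun measurableSet_Ioi h2, lintegral_const_mul _ (by fun_prop),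
    ← lintegral_expMeasure r measurable_const]
  simp

end Exponential

/-! ### First passage indices -/

section FirstIndex

/-- The first index at which the sequence `a` exceeds the level `d`. -/
noncomputable def firstIdx (a : ℕ → ℝ) (d : ℝ) : ℕ := sInf {n | d < a n}

variable {a : ℕ → ℝ} {d : ℝ}

theorem le_of_lt_firstIdx {n : ℕ} (h : n < firstIdx a d) : a n ≤ d :=
  not_lt.1 fun h' => Nat.notMem_of_lt_sInf h h'

theorem lt_apply_firstIdx (ha : Tendsto a atTop atTop) : d < a (firstIdx a d) :=
  Nat.sInf_mem (s := {n | d < a n}) (ha.eventually_gt_atTop d).exists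

theorem firstIdx_eq (n : ℕ) (h1 : ∀ m < n, a m ≤ d) (h2 : d < a n) : firstIdx a d = n := by
  refine le_antisymm (Nat.sInf_le h2) ?_
  by_contra! h
  have h3 : d < a (firstIdx a d) := Nat.sInf_mem (s := {n | d < a n}) ⟨n, h2⟩
  exact absurd (h1 _ h) (not_le.2 h3)

theorem lt_iff_firstIdx_le (ha : Tendsto a atTop atTop) (hm : Monotone a) {n : ℕ} :
    d < a n ↔ firstIdx a d ≤ n :=
  ⟨fun h => Nat.sInf_le h, fun h => (lt_apply_firstIdx ha).trans_le (hm h)⟩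

theorem measurable_firstIdx : Measurable fun p : (ℕ → ℝ) × ℝ => firstIdx p.1 p.2 := by
  refine measurable_to_countable' fun n => ?_
  have hs : ∀ n, MeasurableSet {p : (ℕ → ℝ) × ℝ | p.2 < p.1 n} := fun n =>
    measurableSet_lt measurable_snd (by fun_prop)
  -- The second set accounts for the default `sInf ∅ = 0`, when the level is never exceeded.
  have : (fun p : (ℕ → ℝ) × ℝ => firstIdx p.1 p.2) ⁻¹' {n} =
      ((⋂ m ∈ Set.Iio n, {p : (ℕ → ℝ) × ℝ | p.2 < p.1 m}ᶜ) ∩ {p | p.2 < p.1 n}) ∪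
      ({p | n = 0} ∩ ⋂ m, {p : (ℕ → ℝ) × ℝ | p.2 < p.1 m}ᶜ) := by
    ext p
    simp only [Set.mem_preimage, Set.mem_singleton_iff, Set.mem_union, Set.mem_inter_iff,
      Set.mem_iInter, Set.mem_compl_iff, Set.mem_ofPred_eq, Set.mem_Iio, not_lt]
    constructor
    · intro h
      by_cases hne : ∃ n, p.2 < p.1 n
      · left
        refine ⟨fun m hm => le_of_lt_firstIdx (by omega), ?_⟩
        rw [← h]
        exact Nat.sInf_mem (s := {n | p.2 < p.1 n}) hne
      · right
        push Not at hne
        refine ⟨?_, hne⟩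
        rw [← h, firstIdx, Nat.sInf_eq_zero]
        right
        ext m
        simpa using hne m
    · rintro (⟨h1, h2⟩ | ⟨h1, h2⟩)
      · exact firstIdx_eq n h1 h2
      · rw [h1, firstIdx, Nat.sInf_eq_zero]
        right
        ext m
        simpa using h2 m
  rw [this]
  refine ((MeasurableSet.biInter (Set.to_countable _) fun m _ => (hs m).compl).inter (hs n)).union
    ((MeasurableSet.const _).inter (MeasurableSet.iInter fun m => (hs m).compl))

theorem measurable_eval_index {X : Type*} [MeasurableSpace X] :
    Measurable fun p : ℕ × (ℕ → X) => p.2 p.1 :=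
  measurable_from_prod_countable_right fun n => measurable_pi_apply n

end FirstIndex

/-! ### Gap sequences seen from a later time -/

section Shift

/-- Partial sums of a sequence of gaps, that is, the times at which points are generated. -/
noncomputable def psum (x : ℕ → ℝ) (n : ℕ) : ℝ := ∑ k ∈ Finset.range (n + 1), x k

theorem psum_zero (x : ℕ → ℝ) : psum x 0 = x 0 := by simp [psum]

theorem psum_succ (x : ℕ → ℝ) (n : ℕ) : psum x (n + 1) = psum x n + x (n + 1) :=
  Finset.sum_range_succ _ _

theorem psum_injective : Function.Injective psum := by
  intro x y h
  ext n
  cases n with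
  | zero => simpa [psum_zero] using congrFun h 0
  | succ n =>
    have h1 := congrFun h (n + 1)
    rw [psum_succ, psum_succ, congrFun h n] at h1
    linarith

@[fun_prop]
theorem measurable_psum : Measurable psum :=
  measurable_pi_lambda _ fun n => by unfold psum; fun_prop

/-- The gaps as they are seen from time `d` on. -/
noncomputable def shift (d : ℝ) (x : ℕ → ℝ) (k : ℕ) : ℝ :=
  if k = 0 then psum x (firstIdx (psum x) d) - d else x (firstIdx (psum x) d + k)

/-- The points seen from `d` are the old ones from the first passage on, translated by `d`. Since
`psum` is injective, this determines `shift`. -/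
theorem psum_shift (d : ℝ) (x : ℕ → ℝ) (k : ℕ) :
    psum (shift d x) k = psum x (firstIdx (psum x) d + k) - d := by
  induction k with
  | zero => simp [psum_zero, shift]
  | succ k ih => rw [psum_succ, ih, ← add_assoc, psum_succ]; simp [shift]; ring_nf

theorem measurable_shift : Measurable fun p : ℝ × (ℕ → ℝ) => shift p.1 p.2 := by
  have h1 : Measurable fun p : ℝ × (ℕ → ℝ) => firstIdx (psum p.2) p.1 :=
    measurable_firstIdx.comp (f := fun p : ℝ × (ℕ → ℝ) => (psum p.2, p.1)) (by fun_prop)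
  refine measurable_pi_lambda _ fun k => ?_
  unfold shift
  split_ifs
  · have h2 : Measurable fun p : ℝ × (ℕ → ℝ) => psum p.2 (firstIdx (psum p.2) p.1) :=
      measurable_eval_index.comp (h1.prodMk (measurable_psum.comp measurable_snd))
    fun_prop
  · exact measurable_eval_index.comp ((h1.add_const k).prodMk measurable_snd)

/-- Positive gaps with infinite sum. -/
structure GoodGaps (x : ℕ → ℝ) : Prop where
  pos : ∀ n, 0 < x n
  tendsto : Tendsto (psum x) atTop atTop

namespace GoodGaps

variable {x : ℕ → ℝ} (hx : GoodGaps x)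
include hx

theorem strictMono : StrictMono (psum x) :=
  strictMono_nat_of_lt_succ fun n => by rw [psum_succ]; linarith [hx.pos (n + 1)]

theorem psum_pos (n : ℕ) : 0 < psum x n :=
  (by rw [psum_zero]; exact hx.pos 0 : 0 < psum x 0).trans_le (hx.strictMono.monotone n.zero_le)

theorem lt_psum_iff {d : ℝ} {n : ℕ} : d < psum x n ↔ firstIdx (psum x) d ≤ n :=
  lt_iff_firstIdx_le hx.tendsto hx.strictMono.monotone

theorem shift (d : ℝ) : GoodGaps (shift d x) := by
  refine ⟨fun n => ?_, ?_⟩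
  · unfold _root_.shift
    split_ifs
    · linarith [lt_apply_firstIdx (d := d) hx.tendsto]
    · exact hx.pos _
  · have : psum (_root_.shift d x) = fun k => psum x (k + firstIdx (psum x) d) + (-d) := by
      ext k; rw [psum_shift, add_comm k]; rfl
    rw [this]
    exact tendsto_atTop_add_const_right _ _ ((tendsto_add_atTop_iff_nat _).2 hx.tendsto)

/-- Both sides list the points after `d + d'`. For negative `d'` the left side would miss those
between `d + d'` and `d`. -/
theorem shift_shift {d d' : ℝ} (hd : 0 ≤ d') :
    _root_.shift d' (_root_.shift d x) = _root_.shift (d + d') x := by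
  apply psum_injective
  ext k
  rw [psum_shift, psum_shift, psum_shift, ← add_assoc]
  have : firstIdx (psum x) (d + d') =
      firstIdx (psum x) d + firstIdx (psum (_root_.shift d x)) d' := by
    refine firstIdx_eq _ (fun m hm => ?_) ?_
    · by_contra! h
      obtain ⟨j, rfl⟩ := Nat.exists_eq_add_of_le (hx.lt_psum_iff.1 (by linarith : d < psum x m))
      have h2 := le_of_lt_firstIdx (a := psum (_root_.shift d x)) (d := d') (n := j) (by omega)
      rw [psum_shift] at h2
      linarith
    · have := lt_apply_firstIdx (d := d') (hx.shift d).tendsto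
      rw [psum_shift] at this
      linarith
  rw [this]
  ring

theorem exists_psum_shift {d t : ℝ} :
    (∃ n, psum (_root_.shift d x) n = t - d) ↔ d < t ∧ ∃ n, psum x n = t := by
  constructor
  · rintro ⟨n, hn⟩
    have := (hx.shift d).psum_pos n
    refine ⟨by linarith, firstIdx (psum x) d + n, ?_⟩
    rw [psum_shift] at hn
    linarith
  · rintro ⟨h1, n, rfl⟩
    obtain ⟨j, rfl⟩ := Nat.exists_eq_add_of_le (hx.lt_psum_iff.1 h1)
    exact ⟨j, psum_shift _ _ _⟩

theorem exists_psum_eq_iff {t : ℝ} (ht : t ≤ x 0) : (∃ n, psum x n = t) ↔ x 0 = t := by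
  constructor
  · rintro ⟨n, rfl⟩
    rcases Nat.eq_zero_or_pos n with rfl | hn
    · exact (psum_zero x).symm
    · have := hx.strictMono hn
      rw [psum_zero] at this
      linarith
  · rintro rfl
    exact ⟨0, psum_zero x⟩

end GoodGaps

/-- The sequence that starts with `y` and goes on with `x`. -/
def seqCons {X : Type*} (y : X) (x : ℕ → X) : ℕ → X
  | 0 => y
  | n + 1 => x n

theorem measurable_seqCons {X : Type*} [MeasurableSpace X] :
    Measurable fun p : X × (ℕ → X) => seqCons p.1 p.2 := by
  refine measurable_pi_lambda _ fun n => ?_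
  cases n with
  | zero => exact measurable_fst
  | succ n => exact (measurable_pi_apply n).comp measurable_snd

theorem seqCons_seqTail {X : Type*} (x : ℕ → X) : seqCons (x 0) (seqTail x) = x := by
  ext n; cases n <;> rfl

/-- The first gap is shortened by `t`. -/
def shorten (t : ℝ) (x : ℕ → ℝ) : ℕ → ℝ := seqCons (x 0 - t) (seqTail x)

theorem measurable_shorten : Measurable fun p : ℝ × (ℕ → ℝ) => shorten p.1 p.2 :=
  measurable_seqCons.comp (f := fun p : ℝ × (ℕ → ℝ) => (p.2 0 - p.1, seqTail p.2)) (by fun_prop)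

/-- Describes what the losers of a race see at its end; `GoodGaps.shift_self` does so for the
winner. -/
theorem shift_of_lt {x : ℕ → ℝ} {d : ℝ} (h : d < x 0) : shift d x = shorten d x := by
  have : firstIdx (psum x) d = 0 :=
    firstIdx_eq 0 (fun m hm => absurd hm (Nat.not_lt_zero m)) (by rwa [psum_zero])
  ext k
  unfold shift
  rw [this]
  cases k with
  | zero => simp [shorten, seqCons, psum_zero]
  | succ k => simp [shorten, seqCons, seqTail]

theorem GoodGaps.shift_self {x : ℕ → ℝ} (hx : GoodGaps x) : _root_.shift (x 0) x = seqTail x := by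
  have : firstIdx (psum x) (x 0) = 1 := by
    refine firstIdx_eq 1 (fun m hm => ?_) ?_
    · rw [Nat.lt_one_iff.1 hm, psum_zero]
    · rw [psum_succ, psum_zero]; linarith [hx.pos 1]
  ext k
  unfold _root_.shift
  rw [this]
  cases k with
  | zero => simp [seqTail, psum_succ, psum_zero]
  | succ k => simp [seqTail]; ring_nf

theorem shift_of_firstIdx {x : ℕ → ℝ} {d : ℝ} {n : ℕ} (h : firstIdx (psum x) d = n) :
    shift d x = shorten (d - ∑ k ∈ Finset.range n, x k) (seqTail^[n] x) := by
  ext k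
  unfold shift
  rw [h]
  cases k with
  | zero => simp [shorten, seqCons, psum, Finset.sum_range_succ, seqTail_iterate]; ring
  | succ k => simp [shorten, seqCons, seqTail, seqTail_iterate]; ring_nf

/-- Separates a condition on the first `n` gaps from one on the next gap, so that memorylessness can
be applied to the latter with the former held fixed. -/
theorem GoodGaps.firstIdx_eq_iff {x : ℕ → ℝ} (hx : GoodGaps x) {d : ℝ} (hd : 0 ≤ d) {n : ℕ} :
    firstIdx (psum x) d = n ↔ ∑ k ∈ Finset.range n, x k ≤ d ∧
      d - ∑ k ∈ Finset.range n, x k < (seqTail^[n] x) 0 := by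
  rw [seqTail_iterate, zero_add, sub_lt_iff_lt_add', ← Finset.sum_range_succ]
  change _ ↔ _ ∧ d < psum x n
  constructor
  · rintro rfl
    refine ⟨?_, lt_apply_firstIdx hx.tendsto⟩
    rcases Nat.eq_zero_or_eq_succ_pred (firstIdx (psum x) d) with h | h
    · rw [h]; simpa using hd
    · rw [h]
      exact le_of_lt_firstIdx (a := psum x) (by omega)
  · rintro ⟨h1, h2⟩
    refine firstIdx_eq n (fun m hm => ?_) h2
    refine le_trans ?_ h1
    obtain ⟨k, rfl⟩ := Nat.exists_eq_succ_of_ne_zero (by omega : n ≠ 0)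
    exact hx.strictMono.monotone (by omega : m ≤ k)

end Shift

/-! ### Stationarity of the Poisson process -/

section ShiftMeasure

/-- The law of the gaps of a Poisson process of rate `r`. -/
noncomputable def gapMeasure (r : ℝ) : Measure (ℕ → ℝ) := Measure.infinitePi fun _ => expMeasure r

variable {r : ℝ}

theorem regenerative_gapMeasure (hr : 0 < r) :
    Regenerative (gapMeasure r) (fun x => x 0) seqTail :=
  have := isProbabilityMeasure_expMeasure hr
  regenerative_seqTail _

theorem isProbabilityMeasure_gapMeasure (hr : 0 < r) : IsProbabilityMeasure (gapMeasure r) := by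
  have := isProbabilityMeasure_expMeasure hr
  unfold gapMeasure
  infer_instance

theorem map_eval_gapMeasure (hr : 0 < r) (n : ℕ) :
    (gapMeasure r).map (fun x => x n) = expMeasure r :=
  have := isProbabilityMeasure_expMeasure hr
  Measure.infinitePi_map_eval (fun _ : ℕ => expMeasure r) n

theorem lintegral_eval_gapMeasure (hr : 0 < r) {w : ℝ → ℝ≥0∞} (hw : Measurable w) :
    ∫⁻ x, w (x 0) ∂gapMeasure r = ∫⁻ y, w y ∂expMeasure r := by
  rw [← map_eval_gapMeasure hr 0, lintegral_map hw (measurable_pi_apply 0)]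

/-- The partial sums diverge by the strong law, because the mean gap `1 / r` is positive. -/
theorem ae_goodGaps (hr : 0 < r) : ∀ᵐ x ∂gapMeasure r, GoodGaps x := by
  have := isProbabilityMeasure_gapMeasure hr
  have hpos : ∀ᵐ x ∂gapMeasure r, ∀ n, 0 < x n := by
    refine ae_all_iff.2 fun n => ?_
    have := ae_pos_expMeasure r
    rw [← map_eval_gapMeasure hr n] at this
    exact ae_of_ae_map (measurable_pi_apply n).aemeasurable this
  have hl : ∫⁻ x, ENNReal.ofReal (x 0) ∂gapMeasure r = ENNReal.ofReal (1 / r) :=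
    (lintegral_eval_gapMeasure hr (w := fun y => ENNReal.ofReal y) (by fun_prop)).trans
      (lintegral_id_expMeasure hr)
  have h0 : ∀ᵐ x ∂gapMeasure r, 0 ≤ x 0 := hpos.mono fun x hx => (hx 0).le
  have hm : Measurable fun x : ℕ → ℝ => x 0 := measurable_pi_apply 0
  have hint : Integrable (fun x : ℕ → ℝ => x 0) (gapMeasure r) := by
    refine ⟨hm.aestronglyMeasurable, ?_⟩
    rw [hasFiniteIntegral_iff_ofReal h0, hl]
    exact ENNReal.ofReal_lt_top
  have hmean : ∫ x, x 0 ∂gapMeasure r = 1 / r := by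
    rw [integral_eq_lintegral_of_nonneg_ae h0 hm.aestronglyMeasurable, hl,
      ENNReal.toReal_ofReal (by positivity)]
  filter_upwards [hpos, (regenerative_gapMeasure hr).strong_law hint] with x h1 h2
  refine ⟨h1, ?_⟩
  rw [hmean] at h2
  have h3 := (h2.pos_mul_atTop (by positivity) tendsto_natCast_atTop_atTop)
  have h4 := (tendsto_add_atTop_iff_nat 1).2 h3
  refine h4.congr fun n => ?_
  rw [div_mul_cancel₀ _ (by positivity)]
  simp [psum, seqTail_iterate]

theorem lintegral_gapMeasure_zero_seqTail (hr : 0 < r) {K : ℝ × (ℕ → ℝ) → ℝ≥0∞}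
    (hK : Measurable K) :
    ∫⁻ x, K (x 0, seqTail x) ∂gapMeasure r =
      ∫⁻ x, ∫⁻ y, K (y, x) ∂expMeasure r ∂gapMeasure r := by
  have := isProbabilityMeasure_gapMeasure hr
  rw [(regenerative_gapMeasure hr).lintegral_pair hK, lintegral_lintegral_swap (by fun_prop)]
  exact lintegral_congr fun x =>
    lintegral_eval_gapMeasure hr (w := fun y => K (y, x)) (by fun_prop)

/-- Memorylessness of the first gap; the later gaps are independent of it and untouched. -/
theorem lintegral_shorten (hr : 0 < r) {t : ℝ} (ht : 0 ≤ t) {w : (ℕ → ℝ) → ℝ≥0∞}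
    (hw : Measurable w) :
    ∫⁻ x, {x | t < x 0}.indicator (fun x => w (shorten t x)) x ∂gapMeasure r =
      ENNReal.ofReal (Real.exp (-(r * t))) * ∫⁻ x, w x ∂gapMeasure r := by
  have := isProbabilityMeasure_gapMeasure hr
  have := isProbabilityMeasure_expMeasure hr
  let K : ℝ × (ℕ → ℝ) → ℝ≥0∞ := {p | t < p.1}.indicator fun p => w (seqCons (p.1 - t) p.2)
  have hw' : Measurable fun p : ℝ × (ℕ → ℝ) => w (seqCons p.1 p.2) := hw.comp measurable_seqCons
  have hK : Measurable K := by
    refine Measurable.indicator ?_ (measurableSet_lt measurable_const measurable_fst)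
    exact hw'.comp (f := fun p : ℝ × (ℕ → ℝ) => (p.1 - t, p.2)) (by fun_prop)
  have h1 : ∫⁻ x, {x | t < x 0}.indicator (fun x => w (shorten t x)) x ∂gapMeasure r =
      ∫⁻ x, K (x 0, seqTail x) ∂gapMeasure r := rfl
  have h2 : ∫⁻ x, w x ∂gapMeasure r =
      ∫⁻ x, (fun p : ℝ × (ℕ → ℝ) => w (seqCons p.1 p.2)) (x 0, seqTail x) ∂gapMeasure r := by
    simp only [seqCons_seqTail]
  rw [h1, h2, lintegral_gapMeasure_zero_seqTail hr hK, lintegral_gapMeasure_zero_seqTail hr hw',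
    ← lintegral_const_mul _ hw'.lintegral_prod_left']
  refine lintegral_congr fun x' => ?_
  exact lintegral_expMeasure_memoryless (w := fun y => w (seqCons y x')) ht
    (hw'.comp (measurable_id.prodMk measurable_const))

/-- The Poisson process looks the same from every time on. -/
theorem measurePreserving_shift (hr : 0 < r) {d : ℝ} (hd : 0 ≤ d) :
    MeasurePreserving (shift d) (gapMeasure r) (gapMeasure r) := by
  have := isProbabilityMeasure_gapMeasure hr
  have hm : Measurable (shift d) :=
    measurable_shift.comp (f := fun x : ℕ → ℝ => (d, x)) (by fun_prop)
  have hit := fun n => (regenerative_gapMeasure hr).iterate n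
  -- `c n` is the probability that exactly `n` points lie up to `d`, with the condition on the next
  -- gap already integrated out.
  let c : ℕ → ℝ≥0∞ := fun n => ∫⁻ x, {x : ℕ → ℝ | ∑ k ∈ Finset.range n, x k ≤ d}.indicator
    (fun x => ENNReal.ofReal (Real.exp (-(r * (d - ∑ k ∈ Finset.range n, x k))))) x ∂gapMeasure r
  have key : ∀ w : (ℕ → ℝ) → ℝ≥0∞, Measurable w →
      ∫⁻ x, w (shift d x) ∂gapMeasure r = (∑' n, c n) * ∫⁻ x, w x ∂gapMeasure r := by
    intro w hw
    let K : ℝ × (ℕ → ℝ) → ℝ≥0∞ := {p | p.1 ≤ d}.indicator fun p =>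
      {x : ℕ → ℝ | d - p.1 < x 0}.indicator (fun x => w (shorten (d - p.1) x)) p.2
    have hK : Measurable K := by
      refine Measurable.indicator ?_ (measurableSet_le measurable_fst measurable_const)
      refine Measurable.indicator (f := fun p : ℝ × (ℕ → ℝ) => w (shorten (d - p.1) p.2))
        (s := {p : ℝ × (ℕ → ℝ) | d - p.1 < p.2 0}) ?_ (measurableSet_lt (by fun_prop) (by fun_prop))
      exact hw.comp (measurable_shorten.comp (f := fun p : ℝ × (ℕ → ℝ) => (d - p.1, p.2))
        (by fun_prop))
    have hK1 : ∀ σ y, σ ≤ d →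
        K (σ, y) = {x : ℕ → ℝ | d - σ < x 0}.indicator (fun x => w (shorten (d - σ) x)) y :=
      fun σ y h => by simp [K, h]
    have hK2 : ∀ σ y, ¬ σ ≤ d → K (σ, y) = 0 := fun σ y h => by
      simp only [K]
      exact Set.indicator_of_notMem (by simpa using h) _
    have h1 : ∀ᵐ x ∂gapMeasure r, w (shift d x) =
        ∑' n, K (∑ k ∈ Finset.range n, x k, seqTail^[n] x) := by
      filter_upwards [ae_goodGaps hr] with x hx
      rw [tsum_eq_single (firstIdx (psum x) d)]
      · have h := (hx.firstIdx_eq_iff hd).1 rfl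
        rw [hK1 _ _ h.1, Set.indicator_of_mem (by exact h.2), ← shift_of_firstIdx rfl]
      · intro n hn
        by_cases ha : ∑ k ∈ Finset.range n, x k ≤ d
        · rw [hK1 _ _ ha, Set.indicator_of_notMem]
          exact fun hb => hn ((hx.firstIdx_eq_iff hd).2 ⟨ha, hb⟩).symm
        · exact hK2 _ _ ha
    have hT : Measurable (seqTail : (ℕ → ℝ) → ℕ → ℝ) := measurable_seqTail
    have hKn : ∀ n, Measurable fun x : ℕ → ℝ =>
        K (∑ k ∈ Finset.range n, x k, seqTail^[n] x) := fun n =>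
      hK.comp ((by fun_prop : Measurable fun x : ℕ → ℝ => ∑ k ∈ Finset.range n, x k).prodMk
        (hT.iterate n))
    rw [lintegral_congr_ae h1, lintegral_tsum fun n => (hKn n).aemeasurable, ← ENNReal.tsum_mul_right]
    refine tsum_congr fun n => ?_
    have h2 := (hit n).comp (g := fun p : Fin n → ℝ => ∑ k, p k) (by fun_prop)
    have h3 : ∀ x : ℕ → ℝ, ∑ k, Regenerative.path (fun x => x 0) seqTail n x k =
        ∑ k ∈ Finset.range n, x k := fun x => by
      rw [← Fin.sum_univ_eq_sum_range]
      simp [Regenerative.path, seqTail_iterate]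
    simp only [h3] at h2
    rw [h2.lintegral_pair hK]
    simp only [c]
    rw [← lintegral_mul_const _ (Measurable.indicator (by fun_prop)
      (measurableSet_le (by fun_prop) measurable_const))]
    refine lintegral_congr fun x => ?_
    by_cases hx : ∑ k ∈ Finset.range n, x k ≤ d
    · rw [Set.indicator_of_mem (by exact hx), ← lintegral_shorten hr (by linarith) hw]
      exact lintegral_congr fun y => hK1 _ _ hx
    · rw [Set.indicator_of_notMem (by exact hx), zero_mul, ← lintegral_zero (μ := gapMeasure r)]
      exact lintegral_congr fun y => hK2 _ _ hx
  -- The Poisson weights need not be computed: `w = 1` in `key` shows that they sum to `1`.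
  have hc : ∑' n, c n = 1 := by
    have := key (fun _ => 1) measurable_const
    simpa using this.symm
  refine ⟨hm, ?_⟩
  ext A hA
  have := key (A.indicator 1) (measurable_one.indicator hA)
  rw [hc, one_mul, lintegral_indicator_one hA] at this
  rw [Measure.map_apply hm hA, ← this, ← lintegral_indicator_one (hm hA)]
  rfl

end ShiftMeasure

/-! ### The race between the sources -/

section Race

variable {ι : Type*}

/-- The time until the first point over all sources. -/
noncomputable def firstGap (g : ι → ℕ → ℝ) : ℝ := ⨅ c, g c 0

/-- The gaps of all sources as they are seen from time `d` on. -/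
noncomputable def shiftAll (d : ℝ) (g : ι → ℕ → ℝ) : ι → ℕ → ℝ := fun c => shift d (g c)

theorem measurable_shiftAll : Measurable fun p : ℝ × (ι → ℕ → ℝ) => shiftAll p.1 p.2 :=
  measurable_pi_lambda _ fun c =>
    measurable_shift.comp (f := fun p : ℝ × (ι → ℕ → ℝ) => (p.1, p.2 c)) (by fun_prop)

theorem firstGap_le [Finite ι] (g : ι → ℕ → ℝ) (c : ι) : firstGap g ≤ g c 0 :=
  ciInf_le (Set.finite_range _).bddBelow c

theorem exists_eq_firstGap [Finite ι] [Nonempty ι] (g : ι → ℕ → ℝ) : ∃ c, g c 0 = firstGap g :=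
  exists_eq_ciInf_of_finite

theorem firstGap_eq [Finite ι] [Nonempty ι] {g : ι → ℕ → ℝ} {j : ι}
    (h : ∀ c, c ≠ j → g j 0 < g c 0) : firstGap g = g j 0 := by
  refine le_antisymm (firstGap_le g j) (le_ciInf fun c => ?_)
  by_cases hc : c = j
  · rw [hc]
  · exact (h c hc).le

variable [Fintype ι]

@[fun_prop]
theorem measurable_firstGap : Measurable (firstGap : (ι → ℕ → ℝ) → ℝ) :=
  Measurable.iInf fun c => by fun_prop

/-- The law of the gaps of independent Poisson processes of rates `lam c`. -/
noncomputable def gapsMeasure (lam : ι → ℝ) : Measure (ι → ℕ → ℝ) :=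
  Measure.pi fun c => gapMeasure (lam c)

theorem measurableSet_forall_lt (j : ι) {f : (ι → ℕ → ℝ) → ℝ} (hf : Measurable f) :
    MeasurableSet {g : ι → ℕ → ℝ | ∀ c, c ≠ j → f g < g c 0} := by
  have : {g : ι → ℕ → ℝ | ∀ c, c ≠ j → f g < g c 0} =
      ⋂ c, ⋂ (_ : c ≠ j), {g | f g < g c 0} := by ext; simp
  rw [this]
  exact MeasurableSet.iInter fun c => MeasurableSet.iInter fun _ =>
    measurableSet_lt hf (by fun_prop)

variable {lam : ι → ℝ} (hlam : ∀ c, 0 < lam c)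
include hlam

theorem isProbabilityMeasure_gapsMeasure : IsProbabilityMeasure (gapsMeasure lam) := by
  have := fun c => isProbabilityMeasure_gapMeasure (hlam c)
  unfold gapsMeasure
  infer_instance

theorem ae_goodGaps_all : ∀ᵐ g ∂gapsMeasure lam, ∀ c, GoodGaps (g c) := by
  have := fun c => isProbabilityMeasure_gapMeasure (hlam c)
  refine ae_all_iff.2 fun c => ?_
  exact (measurePreserving_eval (fun c => gapMeasure (lam c)) c).quasiMeasurePreserving.ae
    (ae_goodGaps (hlam c))

theorem measurePreserving_shiftAll {d : ℝ} (hd : 0 ≤ d) :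
    MeasurePreserving (shiftAll d) (gapsMeasure lam) (gapsMeasure lam) := by
  have := fun c => isProbabilityMeasure_gapMeasure (hlam c)
  exact measurePreserving_pi _ _ fun c => measurePreserving_shift (hlam c) hd

/-- Fubini for the coordinate `j`: overwriting `g j` by an independent `x` avoids splitting the
product space. -/
theorem lintegral_gapsMeasure_update [DecidableEq ι] (j : ι) {K : (ι → ℕ → ℝ) → ℝ≥0∞}
    (hK : Measurable K) :
    ∫⁻ g, K g ∂gapsMeasure lam =
      ∫⁻ x, ∫⁻ g, K (Function.update g j x) ∂gapsMeasure lam ∂gapMeasure (lam j) := by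
  have := fun c => isProbabilityMeasure_gapMeasure (hlam c)
  have := isProbabilityMeasure_gapsMeasure hlam
  have hu : Measurable fun p : (ℕ → ℝ) × (ι → ℕ → ℝ) => Function.update p.2 j p.1 := by
    refine measurable_pi_lambda _ fun c => ?_
    by_cases hc : c = j
    · subst hc; simpa using measurable_fst
    · simp only [Function.update_of_ne hc]; fun_prop
  have h1 : gapsMeasure lam = ((gapMeasure (lam j)).prod (gapsMeasure lam)).map
      fun p => Function.update p.2 j p.1 := by
    refine Measure.pi_eq fun A hA => ?_
    rw [Measure.map_apply hu (MeasurableSet.univ_pi hA)]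
    have : (fun p : (ℕ → ℝ) × (ι → ℕ → ℝ) => Function.update p.2 j p.1) ⁻¹' Set.univ.pi A =
        A j ×ˢ Set.univ.pi (Function.update A j Set.univ) := by
      ext p
      simp only [Set.mem_preimage, Set.mem_univ_pi, Set.mem_prod]
      constructor
      · intro h
        refine ⟨by simpa using h j, fun c => ?_⟩
        by_cases hc : c = j
        · subst hc; simp
        · simpa [hc] using h c
      · rintro ⟨h1, h2⟩ c
        by_cases hc : c = j
        · subst hc; simpa using h1
        · simpa [hc] using h2 c
    rw [this, Measure.prod_prod, gapsMeasure, Measure.pi_pi,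
      ← Finset.mul_prod_erase Finset.univ _ (Finset.mem_univ j),
      ← Finset.mul_prod_erase Finset.univ (fun i => gapMeasure (lam i) (A i)) (Finset.mem_univ j)]
    simp only [Function.update_self, measure_univ, one_mul]
    congr 1
    refine Finset.prod_congr rfl fun c hc => ?_
    rw [Function.update_of_ne (Finset.ne_of_mem_erase hc)]
  conv_lhs => rw [h1]
  have hKu : Measurable fun p : (ℕ → ℝ) × (ι → ℕ → ℝ) => K (Function.update p.2 j p.1) :=
    hK.comp hu
  rw [lintegral_map hK hu, lintegral_prod _ hKu.aemeasurable]

/-- Each source `c` other than `j` has no point up to `t` with probability `exp (-(lam c * t))`, and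
is then as good as new. By independence these probabilities multiply. -/
theorem lintegral_shorten_all [DecidableEq ι] (j : ι) {t : ℝ} (ht : 0 ≤ t)
    {w : (ι → ℕ → ℝ) → ℝ≥0∞} (hw : Measurable w) :
    ∫⁻ g, {g : ι → ℕ → ℝ | ∀ c, c ≠ j → t < g c 0}.indicator
        (fun g => w fun c => if c = j then g c else shorten t (g c)) g ∂gapsMeasure lam =
      ENNReal.ofReal (Real.exp (-((∑ c, lam c - lam j) * t))) * ∫⁻ g, w g ∂gapsMeasure lam := by
  have := fun c => isProbabilityMeasure_gapMeasure (hlam c)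
  let B : ι → Set (ℕ → ℝ) := fun c => if c = j then Set.univ else {x | t < x 0}
  let m : ι → (ℕ → ℝ) → ℕ → ℝ := fun c x => if c = j then x else shorten t x
  let k : ι → ℝ≥0∞ := fun c => if c = j then 1 else ENNReal.ofReal (Real.exp (-(lam c * t)))
  have hst : Measurable (shorten t) :=
    measurable_shorten.comp (f := fun x : ℕ → ℝ => (t, x)) (by fun_prop)
  have hm : ∀ c, Measurable (m c) := fun c => by
    by_cases hc : c = j
    · simp only [m, hc, if_true]; fun_prop
    · simpa only [m, hc, if_false] using hst
  have hB0 : MeasurableSet {x : ℕ → ℝ | t < x 0} := measurableSet_lt (by fun_prop) (by fun_prop)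
  -- In one coordinate, restricting to survival and shortening the gap rescales the law by `k c`.
  have hone : ∀ c, ((gapMeasure (lam c)).restrict (B c)).map (m c) = k c • gapMeasure (lam c) := by
    intro c
    by_cases hc : c = j
    · simp only [B, m, k, hc, if_true, Measure.restrict_univ, one_smul]
      exact Measure.map_id
    · ext A hA
      have h1 := lintegral_shorten (hlam c) ht (w := A.indicator 1) (measurable_one.indicator hA)
      rw [lintegral_indicator_one hA] at h1
      simp only [Measure.smul_apply, smul_eq_mul]
      rw [Measure.map_apply (hm c) hA, Measure.restrict_apply (hm c hA)]
      simp only [B, m, k, hc, if_false]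
      rw [← h1, ← lintegral_indicator_one ((hst hA).inter hB0)]
      refine lintegral_congr fun x => ?_
      by_cases hx : t < x 0
      · by_cases hxA : shorten t x ∈ A <;> simp [Set.indicator, hx, hxA]
      · simp [Set.indicator, hx]
  have hBm : MeasurableSet (Set.univ.pi B) := MeasurableSet.univ_pi fun c => by
    by_cases hc : c = j
    · simp [B, hc]
    · simpa [B, hc] using hB0
  have hset : {g : ι → ℕ → ℝ | ∀ c, c ≠ j → t < g c 0} = Set.univ.pi B := by
    ext g
    simp only [Set.mem_univ_pi, B]
    refine forall_congr' fun c => ?_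
    by_cases hc : c = j <;> simp [hc]
  have hfin : ∀ c, IsFiniteMeasure (k c • gapMeasure (lam c)) := fun c => by
    rw [← hone c]; infer_instance
  have hmap : ((gapsMeasure lam).restrict (Set.univ.pi B)).map (fun g c => m c (g c)) =
      (∏ c, k c) • gapsMeasure lam := by
    have hone' := funext hone
    have : ∀ c, SigmaFinite (((gapMeasure (lam c)).restrict (B c)).map (m c)) := fun c => by
      rw [hone c]; infer_instance
    rw [gapsMeasure, Measure.restrict_pi_pi, Measure.pi_map_pi fun c => (hm c).aemeasurable, hone']
    refine Measure.pi_eq fun A hA => ?_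
    simp [Measure.pi_pi, Finset.prod_mul_distrib]
  have hk : ∏ c, k c = ENNReal.ofReal (Real.exp (-((∑ c, lam c - lam j) * t))) := by
    have : ∀ c, k c = ENNReal.ofReal (Real.exp (if c = j then 0 else -(lam c * t))) := fun c => by
      by_cases hc : c = j <;> simp [k, hc]
    simp only [this]
    rw [← ENNReal.ofReal_prod_of_nonneg fun _ _ => (Real.exp_pos _).le, ← Real.exp_sum]
    congr 2
    rw [← Finset.add_sum_erase Finset.univ _ (Finset.mem_univ j),
      ← Finset.add_sum_erase Finset.univ lam (Finset.mem_univ j), if_pos rfl, zero_add,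
      add_sub_cancel_left, Finset.sum_mul, ← Finset.sum_neg_distrib]
    exact Finset.sum_congr rfl fun c hc => if_neg (Finset.ne_of_mem_erase hc)
  have hmm : Measurable fun (g : ι → ℕ → ℝ) c => m c (g c) :=
    measurable_pi_lambda _ fun c => (hm c).comp (measurable_pi_apply c)
  rw [hset, lintegral_indicator hBm, ← hk, ← smul_eq_mul, ← lintegral_smul_measure, ← hmap,
    lintegral_map hw hmm]

/-- The source `j` wins the race for the next point with probability proportional to its rate;
this, the time of that point and the gaps seen from it on are independent. -/
theorem lintegral_race [DecidableEq ι] (j : ι) {u : ℝ → ℝ≥0∞} (hu : Measurable u)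
    {w : (ι → ℕ → ℝ) → ℝ≥0∞} (hw : Measurable w) :
    ∫⁻ g, {g : ι → ℕ → ℝ | ∀ c, c ≠ j → g j 0 < g c 0}.indicator
        (fun g => u (g j 0) * w (shiftAll (g j 0) g)) g ∂gapsMeasure lam =
      ENNReal.ofReal (lam j / ∑ c, lam c) * (∫⁻ x, u x ∂expMeasure (∑ c, lam c)) *
        ∫⁻ g, w g ∂gapsMeasure lam := by
  have := fun c => isProbabilityMeasure_gapMeasure (hlam c)
  have := isProbabilityMeasure_gapsMeasure hlam
  have hset : MeasurableSet {g : ι → ℕ → ℝ | ∀ c, c ≠ j → g j 0 < g c 0} :=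
    measurableSet_forall_lt j (by fun_prop)
  have hsh : Measurable fun g : ι → ℕ → ℝ => shiftAll (g j 0) g :=
    measurable_shiftAll.comp (f := fun g : ι → ℕ → ℝ => (g j 0, g)) (by fun_prop)
  have hq : 0 ≤ ∑ c, lam c - lam j :=
    sub_nonneg.2 (Finset.single_le_sum (fun c _ => (hlam c).le) (Finset.mem_univ j))
  rw [lintegral_gapsMeasure_update hlam j (Measurable.indicator (by fun_prop) hset)]
  -- Fix the gaps `x` of the source `j`, which wins at time `x 0`. Seen from then, its own first gap
  -- is gone and those of the other sources are shortened by `x 0`.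
  have h1 : ∀ᵐ x ∂gapMeasure (lam j),
      ∫⁻ g, {g : ι → ℕ → ℝ | ∀ c, c ≠ j → g j 0 < g c 0}.indicator
        (fun g => u (g j 0) * w (shiftAll (g j 0) g)) (Function.update g j x) ∂gapsMeasure lam =
      (fun y => ENNReal.ofReal (Real.exp (-((∑ c, lam c - lam j) * y))) * u y) (x 0) *
        (fun x => ∫⁻ g, w (Function.update g j x) ∂gapsMeasure lam) (seqTail x) := by
    filter_upwards [ae_goodGaps (hlam j)] with x hx
    have h2 := lintegral_shorten_all hlam j (hx.pos 0).le
      (w := fun g => w (Function.update g j (seqTail x))) (by fun_prop)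
    rw [mul_right_comm, ← h2, mul_comm, ← lintegral_const_mul]
    · refine lintegral_congr fun g => ?_
      by_cases hg : ∀ c, c ≠ j → x 0 < g c 0
      · rw [Set.indicator_of_mem, Set.indicator_of_mem (by exact hg)]
        · simp only [Function.update_self]
          congr 2
          ext c : 1
          by_cases hc : c = j
          · subst hc; simp [shiftAll, hx.shift_self]
          · simp [shiftAll, hc, shift_of_lt (hg c hc)]
        · intro c hc
          simpa [hc] using hg c hc
      · rw [Set.indicator_of_notMem, Set.indicator_of_notMem (by exact hg), mul_zero]
        intro h
        refine hg fun c hc => ?_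
        simpa [hc] using h c hc
    · refine Measurable.indicator ?_ ?_
      · refine hw.comp (measurable_pi_lambda _ fun c => ?_)
        by_cases hc : c = j
        · subst hc; simp
        · simp only [Function.update_of_ne hc, if_neg hc]
          exact measurable_shorten.comp (f := fun g : ι → ℕ → ℝ => (x 0, g c)) (by fun_prop)
      · exact measurableSet_forall_lt j measurable_const
  have hupd : Measurable fun p : (ℕ → ℝ) × (ι → ℕ → ℝ) => Function.update p.2 j p.1 := by
    refine measurable_pi_lambda _ fun c => ?_
    by_cases hc : c = j
    · subst hc; simpa using measurable_fst
    · simp only [Function.update_of_ne hc]; fun_prop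
  have hwu : Measurable fun p : (ℕ → ℝ) × (ι → ℕ → ℝ) => w (Function.update p.2 j p.1) :=
    hw.comp hupd
  have hwi : Measurable fun x => ∫⁻ g, w (Function.update g j x) ∂gapsMeasure lam :=
    hwu.lintegral_prod_right'
  rw [lintegral_congr_ae h1, (regenerative_gapMeasure (hlam j)).lintegral_mul
    (u := fun y => ENNReal.ofReal (Real.exp (-((∑ c, lam c - lam j) * y))) * u y) (by fun_prop) hwi,
    ← lintegral_gapsMeasure_update hlam j hw,
    lintegral_eval_gapMeasure (hlam j)
      (w := fun y => ENNReal.ofReal (Real.exp (-((∑ c, lam c - lam j) * y))) * u y) (by fun_prop),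
    lintegral_expMeasure_mul_exp (hlam j) hq hu]
  simp

/-- The events that `j` wins are disjoint, and their probabilities `lam j / ∑ c, lam c` add up to
`1`, so ties are null. -/
theorem ae_exists_winner [Nonempty ι] :
    ∀ᵐ g ∂gapsMeasure lam, ∃ j, ∀ c, c ≠ j → g j 0 < g c 0 := by
  classical
  have := isProbabilityMeasure_gapsMeasure hlam
  have hL : 0 < ∑ c, lam c := Finset.sum_pos (fun c _ => hlam c) Finset.univ_nonempty
  have := isProbabilityMeasure_expMeasure hL
  let W : ι → Set (ι → ℕ → ℝ) := fun j => {g | ∀ c, c ≠ j → g j 0 < g c 0}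
  have hW : ∀ j, MeasurableSet (W j) := fun j => measurableSet_forall_lt j (by fun_prop)
  have h1 : ∀ j, gapsMeasure lam (W j) = ENNReal.ofReal (lam j / ∑ c, lam c) := fun j => by
    have := lintegral_race hlam j (u := fun _ => 1) measurable_const (w := fun _ => 1)
      measurable_const
    simp only [mul_one, lintegral_one, measure_univ] at this
    rw [← this, ← lintegral_indicator_one (hW j)]
    rfl
  have h2 : Pairwise (Function.onFun Disjoint W) := by
    intro i j hij
    refine Set.disjoint_left.2 fun g hi hj => ?_
    exact lt_asymm (hi j hij.symm) (hj i hij)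
  have h3 : gapsMeasure lam (⋃ j, W j) = 1 := by
    rw [measure_iUnion h2 hW, tsum_fintype]
    simp only [h1]
    rw [← ENNReal.ofReal_sum_of_nonneg fun c _ => by have := hlam c; positivity,
      ← Finset.sum_div, div_self hL.ne', ENNReal.ofReal_one]
  have h4 : {g : ι → ℕ → ℝ | ∃ j, ∀ c, c ≠ j → g j 0 < g c 0} = ⋃ j, W j := by ext; simp [W]
  rw [ae_iff_measure_eq (by rw [h4]; exact (MeasurableSet.iUnion hW).nullMeasurableSet), h4, h3,
    measure_univ]

/-- The races of all possible winners are added up; only whether `c` or another source wins is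
recorded. -/
theorem lintegral_firstGap [Nonempty ι] (c : ι) {u : ℝ × Prop → ℝ≥0∞} (hu : Measurable u)
    {w : (ι → ℕ → ℝ) → ℝ≥0∞} (hw : Measurable w) :
    ∫⁻ g, u (firstGap g, g c 0 = firstGap g) * w (shiftAll (firstGap g) g) ∂gapsMeasure lam =
      (ENNReal.ofReal (lam c / ∑ c, lam c) * (∫⁻ x, u (x, True) ∂expMeasure (∑ c, lam c)) +
        ENNReal.ofReal ((∑ c, lam c - lam c) / ∑ c, lam c) *
          ∫⁻ x, u (x, False) ∂expMeasure (∑ c, lam c)) * ∫⁻ g, w g ∂gapsMeasure lam := by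
  classical
  have hL : 0 < ∑ c, lam c := Finset.sum_pos (fun c _ => hlam c) Finset.univ_nonempty
  let W : ι → Set (ι → ℕ → ℝ) := fun j => {g | ∀ c, c ≠ j → g j 0 < g c 0}
  have hW : ∀ j, MeasurableSet (W j) := fun j => measurableSet_forall_lt j (by fun_prop)
  have h1 : ∀ᵐ g ∂gapsMeasure lam,
      u (firstGap g, g c 0 = firstGap g) * w (shiftAll (firstGap g) g) =
      ∑ j, (W j).indicator (fun g => u (g j 0, c = j) * w (shiftAll (g j 0) g)) g := by
    filter_upwards [ae_exists_winner hlam] with g ⟨j, hj⟩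
    rw [Finset.sum_eq_single j]
    · rw [Set.indicator_of_mem (by exact hj), firstGap_eq hj]
      have : (g c 0 = g j 0) = (c = j) := by
        refine propext ⟨fun h => ?_, fun h => by rw [h]⟩
        by_contra hc
        exact (hj c hc).ne' h
      rw [this]
    · intro i _ hi
      exact Set.indicator_of_notMem (fun h : ∀ c, c ≠ i → g i 0 < g c 0 => lt_asymm (hj i hi) (h j hi.symm)) _
    · simp
  rw [lintegral_congr_ae h1, lintegral_finsetSum]
  · have h2 : ∀ j, ∫⁻ g, (W j).indicator (fun g => u (g j 0, c = j) * w (shiftAll (g j 0) g)) g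
        ∂gapsMeasure lam = ENNReal.ofReal (lam j / ∑ c, lam c) *
          (∫⁻ x, u (x, c = j) ∂expMeasure (∑ c, lam c)) * ∫⁻ g, w g ∂gapsMeasure lam := fun j =>
      lintegral_race hlam j (u := fun x => u (x, c = j)) (by fun_prop) hw
    simp only [h2]
    rw [← Finset.sum_mul, ← Finset.add_sum_erase Finset.univ _ (Finset.mem_univ c)]
    congr 2
    · simp
    · have h3 : ∀ j ∈ Finset.univ.erase c, ENNReal.ofReal (lam j / ∑ c, lam c) *
          (∫⁻ x, u (x, c = j) ∂expMeasure (∑ c, lam c)) = ENNReal.ofReal (lam j / ∑ c, lam c) *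
          (∫⁻ x, u (x, False) ∂expMeasure (∑ c, lam c)) := fun j hj => by
        have : (c = j) = False := eq_false (Finset.ne_of_mem_erase hj).symm
        rw [this]
      rw [Finset.sum_congr rfl h3, ← Finset.sum_mul,
        ← ENNReal.ofReal_sum_of_nonneg fun c _ => by have := hlam c; positivity,
        ← Finset.sum_div, ← Finset.add_sum_erase Finset.univ lam (Finset.mem_univ c),
        add_sub_cancel_left]
  · intro j _
    have hsh : Measurable fun g : ι → ℕ → ℝ => shiftAll (g j 0) g :=
      measurable_shiftAll.comp (f := fun g : ι → ℕ → ℝ => (g j 0, g)) (by fun_prop)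
    exact Measurable.indicator (by fun_prop) (hW j)

end Race

/-! ### One stage: an idle period and a service -/

section Service

variable {ι : Type*} [Fintype ι]

/-- What happens from the moment when the server becomes idle until the end of the next service:
the idle time, whether the packet served is from source `c`, and the service time. The state
consists of the gaps of the sources and the service times to come. -/
noncomputable def obs (c : ι) (e : (ι → ℕ → ℝ) × (ℕ → ℝ)) : ℝ × Prop × ℝ :=
  (firstGap e.1, e.1 c 0 = firstGap e.1, e.2 0)

/-- The state at the end of the next service. -/
noncomputable def next (e : (ι → ℕ → ℝ) × (ℕ → ℝ)) : (ι → ℕ → ℝ) × (ℕ → ℝ) :=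
  (shiftAll (firstGap e.1 + e.2 0) e.1, seqTail e.2)

/-- The law of the state of an idle server. -/
noncomputable def stateMeasure (lam : ι → ℝ) (ν : Measure ℝ) [IsProbabilityMeasure ν] :
    Measure ((ι → ℕ → ℝ) × (ℕ → ℝ)) :=
  (gapsMeasure lam).prod (Measure.infinitePi fun _ => ν)

theorem ae_service_nonneg {ν : Measure ℝ} [IsProbabilityMeasure ν] (hν : ∀ᵐ x ∂ν, 0 ≤ x) :
    ∀ᵐ v ∂Measure.infinitePi fun _ : ℕ => ν, ∀ n, 0 ≤ v n := by
  refine ae_all_iff.2 fun n => ?_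
  rw [← Measure.infinitePi_map_eval (fun _ : ℕ => ν) n] at hν
  exact ae_of_ae_map (measurable_pi_apply n).aemeasurable hν

variable {lam : ι → ℝ} (hlam : ∀ c, 0 < lam c) {ν : Measure ℝ} [IsProbabilityMeasure ν]
include hlam

theorem isProbabilityMeasure_stateMeasure : IsProbabilityMeasure (stateMeasure lam ν) := by
  have := isProbabilityMeasure_gapsMeasure hlam
  unfold stateMeasure
  infer_instance

omit hlam in
theorem measurable_obs (c : ι) : Measurable (obs c) := by
  have : Measurable fun e : (ι → ℕ → ℝ) × (ℕ → ℝ) => e.1 c 0 = firstGap e.1 :=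
    measurableSet_setOfPred.1 (measurableSet_eq_fun (by fun_prop) (by fun_prop))
  unfold obs
  fun_prop

omit hlam in
theorem measurable_next : Measurable (next : (ι → ℕ → ℝ) × (ℕ → ℝ) → _) := by
  refine Measurable.prodMk ?_ (by fun_prop)
  exact measurable_shiftAll.comp
    (f := fun e : (ι → ℕ → ℝ) × (ℕ → ℝ) => (firstGap e.1 + e.2 0, e.1)) (by fun_prop)

/-- The law of an observation. -/
theorem lintegral_obs [Nonempty ι] (c : ι) {u : ℝ × Prop × ℝ → ℝ≥0∞} (hu : Measurable u) :
    ∫⁻ e, u (obs c e) ∂stateMeasure lam ν =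
      ENNReal.ofReal (lam c / ∑ c, lam c) *
        (∫⁻ v, ∫⁻ x, u (x, True, v) ∂expMeasure (∑ c, lam c) ∂ν) +
      ENNReal.ofReal ((∑ c, lam c - lam c) / ∑ c, lam c) *
        ∫⁻ v, ∫⁻ x, u (x, False, v) ∂expMeasure (∑ c, lam c) ∂ν := by
  have := isProbabilityMeasure_gapsMeasure hlam
  have hL : 0 < ∑ c, lam c := Finset.sum_pos (fun c _ => hlam c) Finset.univ_nonempty
  have := isProbabilityMeasure_expMeasure hL
  have huo : Measurable fun e : (ι → ℕ → ℝ) × (ℕ → ℝ) => u (obs c e) := hu.comp (measurable_obs c)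
  rw [stateMeasure, lintegral_prod_symm _ huo.aemeasurable]
  have h1 : ∀ v : ℕ → ℝ, ∫⁻ g, u (obs c (g, v)) ∂gapsMeasure lam =
      (fun y => ENNReal.ofReal (lam c / ∑ c, lam c) *
        (∫⁻ x, u (x, True, y) ∂expMeasure (∑ c, lam c)) +
        ENNReal.ofReal ((∑ c, lam c - lam c) / ∑ c, lam c) *
          ∫⁻ x, u (x, False, y) ∂expMeasure (∑ c, lam c)) (v 0) := by
    intro v
    have := lintegral_firstGap hlam c (u := fun p => u (p.1, p.2, v 0)) (by fun_prop)
      (w := fun _ => 1) measurable_const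
    simp only [lintegral_one, measure_univ, mul_one] at this
    exact this
  have hm : ∀ p : Prop, Measurable fun y => ∫⁻ x, u (x, p, y) ∂expMeasure (∑ c, lam c) :=
    fun p => Measurable.lintegral_prod_left' (f := fun q : ℝ × ℝ => u (q.1, p, q.2)) (by fun_prop)
  simp only [h1]
  rw [← lintegral_map (g := fun v : ℕ → ℝ => v 0) (μ := Measure.infinitePi fun _ : ℕ => ν)
    (f := fun y => ENNReal.ofReal (lam c / ∑ c, lam c) *
        (∫⁻ x, u (x, True, y) ∂expMeasure (∑ c, lam c)) +
        ENNReal.ofReal ((∑ c, lam c - lam c) / ∑ c, lam c) *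
          ∫⁻ x, u (x, False, y) ∂expMeasure (∑ c, lam c))
    (((hm _).const_mul _).add ((hm _).const_mul _)) (measurable_pi_apply 0),
    Measure.infinitePi_map_eval (fun _ : ℕ => ν) 0,
    lintegral_add_left ((hm _).const_mul _), lintegral_const_mul _ (hm _),
    lintegral_const_mul _ (hm _)]

/-- Positive gaps with infinite sums and nonnegative service times. -/
def GoodState (e : (ι → ℕ → ℝ) × (ℕ → ℝ)) : Prop :=
  (∀ c, GoodGaps (e.1 c)) ∧ ∀ n, 0 ≤ e.2 n

theorem ae_goodState (hν : ∀ᵐ x ∂ν, 0 ≤ x) : ∀ᵐ e ∂stateMeasure lam ν, GoodState e := by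
  have := isProbabilityMeasure_gapsMeasure hlam
  have h1 := Measure.quasiMeasurePreserving_fst (μ := gapsMeasure lam)
    (ν := Measure.infinitePi fun _ : ℕ => ν) |>.ae (ae_goodGaps_all hlam)
  have h2 := Measure.quasiMeasurePreserving_snd (μ := gapsMeasure lam)
    (ν := Measure.infinitePi fun _ : ℕ => ν) |>.ae (ae_service_nonneg hν)
  filter_upwards [h1, h2] with e h1 h2 using ⟨h1, h2⟩

/-- The ends of services are regeneration points. -/
theorem regenerative_next [Nonempty ι] (hν : ∀ᵐ x ∂ν, 0 ≤ x) (c : ι) :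
    Regenerative (stateMeasure lam ν) (obs c) next := by
  have := isProbabilityMeasure_gapsMeasure hlam
  have := isProbabilityMeasure_stateMeasure hlam (ν := ν)
  refine Regenerative.of_lintegral (measurable_obs c) measurable_next fun u w hu hw => ?_
  have hL : 0 < ∑ c, lam c := Finset.sum_pos (fun c _ => hlam c) Finset.univ_nonempty
  have hobs := measurable_obs c
  have hnext : Measurable (next : (ι → ℕ → ℝ) × (ℕ → ℝ) → _) := measurable_next
  have h1 : ∀ᵐ v ∂Measure.infinitePi fun _ : ℕ => ν,
      ∫⁻ g, u (obs c (g, v)) * w (next (g, v)) ∂gapsMeasure lam =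
        (fun y => ∫⁻ g, u (firstGap g, g c 0 = firstGap g, y) ∂gapsMeasure lam) (v 0) *
        (fun v => ∫⁻ g, w (g, v) ∂gapsMeasure lam) (seqTail v) := by
    filter_upwards [ae_service_nonneg hν] with v hv
    have hsv : Measurable (shiftAll (ι := ι) (v 0)) :=
      measurable_shiftAll.comp (f := fun g : ι → ℕ → ℝ => (v 0, g)) (by fun_prop)
    have hw' : Measurable fun g => w (shiftAll (v 0) g, seqTail v) := by fun_prop
    -- The shift over a whole stage is a shift to the arrival, governed by the race, followed by one
    -- by the fixed time `v 0`, which preserves the Poisson law.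
    have e1 : ∀ᵐ g ∂gapsMeasure lam, u (obs c (g, v)) * w (next (g, v)) =
        u (firstGap g, g c 0 = firstGap g, v 0) *
          w (shiftAll (v 0) (shiftAll (firstGap g) g), seqTail v) := by
      filter_upwards [ae_goodGaps_all hlam] with g hg
      have : shiftAll (v 0) (shiftAll (firstGap g) g) = shiftAll (firstGap g + v 0) g := by
        ext c : 1
        exact (hg c).shift_shift (hv 0)
      rw [this]
      rfl
    have e2 := lintegral_firstGap hlam c (u := fun p => u (p.1, p.2, v 0)) (by fun_prop) hw'
    have e3 := lintegral_firstGap hlam c (u := fun p => u (p.1, p.2, v 0)) (by fun_prop)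
      (w := fun _ => 1) measurable_const
    simp only [lintegral_one, measure_univ, mul_one] at e3
    rw [lintegral_congr_ae e1, e2, ← e3]
    congr 1
    exact (measurePreserving_shiftAll hlam (hv 0)).lintegral_comp
      (f := fun g => w (g, seqTail v)) (by fun_prop)
  have hfg : Measurable fun p : ℝ × (ι → ℕ → ℝ) =>
      u (firstGap p.2, p.2 c 0 = firstGap p.2, p.1) := by
    have : Measurable fun p : ℝ × (ι → ℕ → ℝ) => p.2 c 0 = firstGap p.2 :=
      measurableSet_setOfPred.1 (measurableSet_eq_fun (by fun_prop) (by fun_prop))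
    fun_prop
  have hA : Measurable fun y => ∫⁻ g, u (firstGap g, g c 0 = firstGap g, y) ∂gapsMeasure lam :=
    hfg.lintegral_prod_right'
  rw [stateMeasure, lintegral_prod_symm _ (by fun_prop), lintegral_congr_ae h1,
    (regenerative_seqTail ν).lintegral_mul hA hw.lintegral_prod_left',
    lintegral_prod_symm _ hw.aemeasurable, lintegral_prod_symm _ (by fun_prop)]
  rfl

end Service

/-! ### The cycles of a source -/

section Cycle

variable {ι : Type*}

/-- The next packet to be served is from source `c`. -/
def Wins (c : ι) (e : (ι → ℕ → ℝ) × (ℕ → ℝ)) : Prop := e.1 c 0 = firstGap e.1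

/-- The number of packets of other sources that are served before the next one of source `c`. -/
noncomputable def waits (c : ι) (e : (ι → ℕ → ℝ) × (ℕ → ℝ)) : ℕ := sInf {n | Wins c (next^[n] e)}

/-- The time until the next service of a packet of source `c` ends. -/
noncomputable def cycleLength (c : ι) (e : (ι → ℕ → ℝ) × (ℕ → ℝ)) : ℝ :=
  ∑ k ∈ Finset.range (waits c e + 1), (firstGap (next^[k] e).1 + (next^[k] e).2 0)

/-- The time of the next service of a packet of source `c`. -/
noncomputable def cycleService (c : ι) (e : (ι → ℕ → ℝ) × (ℕ → ℝ)) : ℝ :=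
  (next^[waits c e] e).2 0

/-- The state at the end of the next service of a packet of source `c`. -/
noncomputable def cycle (c : ι) (e : (ι → ℕ → ℝ) × (ℕ → ℝ)) : (ι → ℕ → ℝ) × (ℕ → ℝ) :=
  next^[waits c e + 1] e

theorem wins_waits {c : ι} {e : (ι → ℕ → ℝ) × (ℕ → ℝ)} (h : ∃ n, Wins c (next^[n] e)) :
    Wins c (next^[waits c e] e) :=
  Nat.sInf_mem (s := {n | Wins c (next^[n] e)}) h

theorem not_wins_of_lt {c : ι} {e : (ι → ℕ → ℝ) × (ℕ → ℝ)} {n : ℕ} (h : n < waits c e) :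
    ¬ Wins c (next^[n] e) :=
  fun h' => Nat.notMem_of_lt_sInf h h'

theorem waits_eq_iff {c : ι} {e : (ι → ℕ → ℝ) × (ℕ → ℝ)} (h : ∃ n, Wins c (next^[n] e)) {n : ℕ} :
    waits c e = n ↔ (∀ k < n, ¬ Wins c (next^[k] e)) ∧ Wins c (next^[n] e) := by
  constructor
  · rintro rfl
    exact ⟨fun k hk => not_wins_of_lt hk, wins_waits h⟩
  · rintro ⟨h1, h2⟩
    refine le_antisymm (Nat.sInf_le h2) ?_
    by_contra! h3
    exact h1 _ h3 (wins_waits h)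

theorem indicator_obs_of_wins {c : ι} {e : (ι → ℕ → ℝ) × (ℕ → ℝ)} (h : Wins c e)
    (u : ℝ × Prop × ℝ → ℝ≥0∞) :
    {z : ℝ × Prop × ℝ | z.2.1}.indicator u (obs c e) = u (obs c e) ∧
      {z : ℝ × Prop × ℝ | z.2.1}ᶜ.indicator u (obs c e) = 0 :=
  ⟨Set.indicator_of_mem (s := {z : ℝ × Prop × ℝ | z.2.1}) h u,
    Set.indicator_of_notMem (s := {z : ℝ × Prop × ℝ | z.2.1}ᶜ) (not_not.2 h) u⟩

theorem indicator_obs_of_not_wins {c : ι} {e : (ι → ℕ → ℝ) × (ℕ → ℝ)} (h : ¬ Wins c e)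
    (u : ℝ × Prop × ℝ → ℝ≥0∞) :
    {z : ℝ × Prop × ℝ | z.2.1}.indicator u (obs c e) = 0 ∧
      {z : ℝ × Prop × ℝ | z.2.1}ᶜ.indicator u (obs c e) = u (obs c e) :=
  ⟨Set.indicator_of_notMem (s := {z : ℝ × Prop × ℝ | z.2.1}) h u,
    Set.indicator_of_mem (s := {z : ℝ × Prop × ℝ | z.2.1}ᶜ) h u⟩

variable [Fintype ι]

theorem measurableSet_wins (c : ι) : MeasurableSet {e | Wins c e} :=
  measurableSet_eq_fun (by fun_prop) (by fun_prop)

theorem measurable_waits (c : ι) : Measurable (waits c) := by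
  refine measurable_to_countable' fun n => ?_
  have hs : ∀ n, MeasurableSet {e | Wins c (next^[n] e)} := fun n =>
    (measurable_next.iterate n) (measurableSet_wins c)
  -- The last set is again the default `sInf ∅ = 0`, when `c` never wins.
  have : waits c ⁻¹' {n} = ((⋃ k, {e | Wins c (next^[k] e)}) ∩
      ((⋂ k ∈ Set.Iio n, {e | Wins c (next^[k] e)}ᶜ) ∩ {e | Wins c (next^[n] e)})) ∪
      ((⋂ k, {e | Wins c (next^[k] e)}ᶜ) ∩ {e | n = 0}) := by
    ext e
    simp only [Set.mem_preimage, Set.mem_singleton_iff, Set.mem_union, Set.mem_inter_iff,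
      Set.mem_iInter, Set.mem_compl_iff, Set.mem_ofPred_eq, Set.mem_Iio, Set.mem_iUnion]
    by_cases h : ∃ k, Wins c (next^[k] e)
    · rw [waits_eq_iff h]
      have : ¬ ∀ k, ¬ Wins c (next^[k] e) := not_forall_not.2 h
      tauto
    · have h0 : waits c e = 0 := by
        rw [waits, Nat.sInf_eq_zero]
        right
        ext k
        simpa using not_exists.1 h k
      rw [h0, eq_comm]
      have := not_exists.1 h
      tauto
  rw [this]
  exact ((MeasurableSet.iUnion hs).inter ((MeasurableSet.biInter (Set.to_countable _)
    fun k _ => (hs k).compl).inter (hs n))).union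
    ((MeasurableSet.iInter fun k => (hs k).compl).inter (MeasurableSet.const _))

variable {lam : ι → ℝ} (hlam : ∀ c, 0 < lam c) {ν : Measure ℝ} [IsProbabilityMeasure ν]
  (hν : ∀ᵐ x ∂ν, 0 ≤ x) (c : ι)

theorem measurable_comp_waits {X : Type*} [MeasurableSpace X]
    {f : ℕ → (ι → ℕ → ℝ) × (ℕ → ℝ) → X} (hf : ∀ n, Measurable (f n)) :
    Measurable fun e => f (waits c e) e :=
  (measurable_from_prod_countable_right (f := fun p : ℕ × ((ι → ℕ → ℝ) × (ℕ → ℝ)) => f p.1 p.2)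
    hf).comp ((measurable_waits c).prodMk measurable_id)

theorem measurable_cycleLength : Measurable (cycleLength c) := by
  refine measurable_comp_waits c (f := fun n e =>
    ∑ k ∈ Finset.range (n + 1), (firstGap (next^[k] e).1 + (next^[k] e).2 0))
    fun n => Finset.measurable_fun_sum _ fun k _ => ?_
  have := (measurable_next (ι := ι)).iterate k
  fun_prop

theorem measurable_cycleService : Measurable (cycleService c) := by
  refine measurable_comp_waits c (f := fun n e => (next^[n] e).2 0) fun n => ?_
  have := (measurable_next (ι := ι)).iterate n
  fun_prop

theorem measurableSet_prop : MeasurableSet {z : ℝ × Prop × ℝ | z.2.1} :=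
  measurableSet_setOfPred.2 (by fun_prop)

include hlam hν

/-- The first `n` stages are all lost with probability `q ^ n`, where `q < 1` because `lam c > 0`.
-/
theorem ae_exists_wins : ∀ᵐ e ∂stateMeasure lam ν, ∃ n, Wins c (next^[n] e) := by
  have : Nonempty ι := ⟨c⟩
  have := isProbabilityMeasure_stateMeasure hlam (ν := ν)
  have hL : 0 < ∑ c, lam c := Finset.sum_pos (fun c _ => hlam c) Finset.univ_nonempty
  have := isProbabilityMeasure_expMeasure hL
  have hR := regenerative_next hlam hν c
  let b : ℝ × Prop × ℝ → ℝ≥0∞ := {z | z.2.1}ᶜ.indicator 1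
  have hb : Measurable b := measurable_one.indicator measurableSet_prop.compl
  have h1 : ∫⁻ e, b (obs c e) ∂stateMeasure lam ν =
      ENNReal.ofReal ((∑ c, lam c - lam c) / ∑ c, lam c) := by
    rw [lintegral_obs hlam c hb]
    simp [b]
  have h2 : ENNReal.ofReal ((∑ c, lam c - lam c) / ∑ c, lam c) < 1 := by
    rw [ENNReal.ofReal_lt_one, div_lt_one hL]
    linarith [hlam c]
  have h3 : ∀ n, stateMeasure lam ν {e | ¬ ∃ n, Wins c (next^[n] e)} ≤
      ENNReal.ofReal ((∑ c, lam c - lam c) / ∑ c, lam c) ^ n := fun n => by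
    have h4 := hR.lintegral_prod_mul (a := fun _ => 1) measurable_const hb n
    rw [h1, lintegral_one, measure_univ, mul_one] at h4
    rw [← h4]
    have hs : MeasurableSet {e : (ι → ℕ → ℝ) × (ℕ → ℝ) | ¬ ∃ n, Wins c (next^[n] e)} := by
      have : {e : (ι → ℕ → ℝ) × (ℕ → ℝ) | ¬ ∃ n, Wins c (next^[n] e)} =
          ⋂ k, {e | Wins c (next^[k] e)}ᶜ := by ext; simp
      rw [this]
      exact MeasurableSet.iInter fun k =>
        ((measurable_next.iterate k) (measurableSet_wins c)).compl
    rw [← lintegral_indicator_one hs]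
    refine lintegral_mono fun e => ?_
    by_cases he : e ∈ {e : (ι → ℕ → ℝ) × (ℕ → ℝ) | ¬ ∃ n, Wins c (next^[n] e)}
    · rw [Set.indicator_of_mem he, Finset.prod_eq_one, one_mul, Pi.one_apply]
      intro k _
      exact (indicator_obs_of_not_wins (fun h => he ⟨k, h⟩) 1).2
    · rw [Set.indicator_of_notMem he]; exact zero_le
  exact le_antisymm (ge_of_tendsto' (ENNReal.tendsto_pow_atTop_nhds_zero_of_lt_one h2) h3) zero_le

/-- The ends of the services of packets of source `c` are regeneration points. -/
theorem regenerative_cycle :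
    Regenerative (stateMeasure lam ν) (fun e => (cycleLength c e, cycleService c e)) (cycle c) := by
  have : Nonempty ι := ⟨c⟩
  have := isProbabilityMeasure_stateMeasure hlam (ν := ν)
  -- The first `n` stages are lost and the next one is won, which means that `waits` equals `n`.
  let D : ∀ n, Set (Fin (n + 1) → ℝ × Prop × ℝ) := fun n =>
    (⋂ k : Fin n, {p | (p k.castSucc).2.1}ᶜ) ∩ {p | (p (Fin.last n)).2.1}
  have hp : ∀ (n) (k : Fin n), MeasurableSet {p : Fin n → ℝ × Prop × ℝ | (p k).2.1} := fun n k =>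
    measurableSet_setOfPred.2 (by fun_prop)
  refine (regenerative_next hlam hν c).stopped (D := D)
    (ψ := fun n p => (∑ k, ((p k).1 + (p k).2.2), (p (Fin.last n)).2.2))
    (measurable_waits c) ((measurable_cycleLength c).prodMk (measurable_cycleService c))
    (fun n => (MeasurableSet.iInter fun k => (hp _ _).compl).inter (hp _ _))
    (fun n => by fun_prop) ?_ ?_
  · filter_upwards [ae_exists_wins hlam hν c] with e he n
    rw [waits_eq_iff he]
    simp only [D, Set.mem_inter_iff, Set.mem_iInter, Set.mem_compl_iff, Set.mem_ofPred_eq,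
      Regenerative.path, obs, Fin.val_last, Fin.val_castSucc, Wins]
    exact and_congr_left' ⟨fun h k => h k k.2, fun h k hk => h ⟨k, hk⟩⟩
  · intro e
    simp only [Regenerative.path, obs, Fin.val_last]
    rw [Fin.sum_univ_eq_sum_range
      (fun k => firstGap (next^[k] e).1 + (next^[k] e).2 0) (waits c e + 1)]
    rfl

/-- Cut `u` off to lost stages and `v` to won ones. Of the series over `n` only the term `n = waits
c e` survives, and `lintegral_tsum_prod_mul` sums the series. -/
theorem lintegral_first_win {u v : ℝ × Prop × ℝ → ℝ≥0∞} (hu : Measurable u) (hv : Measurable v) :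
    ∫⁻ e, (∏ k ∈ Finset.range (waits c e), u (obs c (next^[k] e))) *
        v (obs c (next^[waits c e] e)) ∂stateMeasure lam ν =
      (1 - ENNReal.ofReal ((∑ c, lam c - lam c) / ∑ c, lam c) *
        ∫⁻ y, ∫⁻ x, u (x, False, y) ∂expMeasure (∑ c, lam c) ∂ν)⁻¹ *
      (ENNReal.ofReal (lam c / ∑ c, lam c) *
        ∫⁻ y, ∫⁻ x, v (x, True, y) ∂expMeasure (∑ c, lam c) ∂ν) := by
  have : Nonempty ι := ⟨c⟩
  have := isProbabilityMeasure_stateMeasure hlam (ν := ν)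
  let b : ℝ × Prop × ℝ → ℝ≥0∞ := {z | z.2.1}ᶜ.indicator u
  let a : ℝ × Prop × ℝ → ℝ≥0∞ := {z | z.2.1}.indicator v
  have hb : Measurable b := hu.indicator measurableSet_prop.compl
  have ha : Measurable a := hv.indicator measurableSet_prop
  have h1 : ∀ᵐ e ∂stateMeasure lam ν, (∏ k ∈ Finset.range (waits c e), u (obs c (next^[k] e))) *
        v (obs c (next^[waits c e] e)) =
      ∑' n, (∏ k ∈ Finset.range n, b (obs c (next^[k] e))) * a (obs c (next^[n] e)) := by
    filter_upwards [ae_exists_wins hlam hν c] with e he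
    rw [tsum_eq_single (waits c e)]
    · congr 1
      · exact Finset.prod_congr rfl fun k hk =>
          (indicator_obs_of_not_wins (not_wins_of_lt (Finset.mem_range.1 hk)) u).2.symm
      · exact (indicator_obs_of_wins (wins_waits he) v).1.symm
    · intro n hn
      rcases lt_or_gt_of_ne hn with h | h
      · have : a (obs c (next^[n] e)) = 0 := (indicator_obs_of_not_wins (not_wins_of_lt h) v).1
        rw [this, mul_zero]
      · rw [Finset.prod_eq_zero (Finset.mem_range.2 h), zero_mul]
        exact (indicator_obs_of_wins (wins_waits he) u).2
  rw [lintegral_congr_ae h1, (regenerative_next hlam hν c).lintegral_tsum_prod_mul ha hb,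
    lintegral_obs hlam c hb, lintegral_obs hlam c ha]
  simp [a, b]

omit hν in
theorem one_sub_loss : (1 : ℝ≥0∞) - ENNReal.ofReal ((∑ c, lam c - lam c) / ∑ c, lam c) =
    ENNReal.ofReal (lam c / ∑ c, lam c) := by
  have : Nonempty ι := ⟨c⟩
  have hL : 0 < ∑ c, lam c := Finset.sum_pos (fun c _ => hlam c) Finset.univ_nonempty
  have hle : lam c ≤ ∑ c, lam c :=
    Finset.single_le_sum (fun c _ => (hlam c).le) (Finset.mem_univ c)
  rw [← ENNReal.ofReal_one, ← ENNReal.ofReal_sub _ (div_nonneg (by linarith) hL.le)]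
  congr 1
  field_simp
  ring

/-- The source of a packet is independent of its service time, so waiting for a win does not bias
the latter. -/
theorem lintegral_cycleService {u : ℝ → ℝ≥0∞} (hu : Measurable u) :
    ∫⁻ e, u (cycleService c e) ∂stateMeasure lam ν = ∫⁻ x, u x ∂ν := by
  have : Nonempty ι := ⟨c⟩
  have hL : 0 < ∑ c, lam c := Finset.sum_pos (fun c _ => hlam c) Finset.univ_nonempty
  have := isProbabilityMeasure_expMeasure hL
  have h := lintegral_first_win hlam hν c (u := fun _ => 1) measurable_const
    (v := fun z => u z.2.2) (by fun_prop)
  simp only [Finset.prod_const_one, one_mul, lintegral_const, measure_univ, mul_one,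
    one_sub_loss hlam c] at h
  rw [← mul_assoc, ENNReal.inv_mul_cancel, one_mul] at h
  · exact h
  · simpa using div_pos (hlam c) hL
  · exact ENNReal.ofReal_ne_top

/-- The exponential of the cycle length is a product over its stages, each an idle time and an
independent service time. -/
theorem lintegral_exp_cycleLength (s : ℝ) :
    ∫⁻ e, ENNReal.ofReal (Real.exp (s * cycleLength c e)) ∂stateMeasure lam ν =
      (1 - ENNReal.ofReal ((∑ c, lam c - lam c) / ∑ c, lam c) *
        ((∫⁻ x, ENNReal.ofReal (Real.exp (s * x)) ∂expMeasure (∑ c, lam c)) *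
          ∫⁻ x, ENNReal.ofReal (Real.exp (s * x)) ∂ν))⁻¹ *
        (ENNReal.ofReal (lam c / ∑ c, lam c) *
        ((∫⁻ x, ENNReal.ofReal (Real.exp (s * x)) ∂expMeasure (∑ c, lam c)) *
          ∫⁻ x, ENNReal.ofReal (Real.exp (s * x)) ∂ν)) := by
  let u : ℝ × Prop × ℝ → ℝ≥0∞ := fun z =>
    ENNReal.ofReal (Real.exp (s * z.1)) * ENNReal.ofReal (Real.exp (s * z.2.2))
  have hu : Measurable u := by fun_prop
  have h := lintegral_first_win hlam hν c hu hu
  have h1 : ∀ e, (∏ k ∈ Finset.range (waits c e), u (obs c (next^[k] e))) *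
      u (obs c (next^[waits c e] e)) = ENNReal.ofReal (Real.exp (s * cycleLength c e)) := by
    intro e
    have h2 : ∀ k, u (obs c (next^[k] e)) = ENNReal.ofReal
        (Real.exp (s * (firstGap (next^[k] e).1 + (next^[k] e).2 0))) := fun k => by
      rw [mul_add, Real.exp_add, ENNReal.ofReal_mul (Real.exp_pos _).le]
      rfl
    rw [← Finset.prod_range_succ (fun k => u (obs c (next^[k] e)))]
    simp only [h2]
    rw [← ENNReal.ofReal_prod_of_nonneg fun _ _ => (Real.exp_pos _).le, ← Real.exp_sum,
      ← Finset.mul_sum]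
    rfl
  have h3 : ∀ p : Prop, ∫⁻ y, ∫⁻ x, u (x, p, y) ∂expMeasure (∑ c, lam c) ∂ν =
      (∫⁻ x, ENNReal.ofReal (Real.exp (s * x)) ∂expMeasure (∑ c, lam c)) *
          ∫⁻ x, ENNReal.ofReal (Real.exp (s * x)) ∂ν := fun p => by
    rw [← lintegral_const_mul _ (by fun_prop)]
    refine lintegral_congr fun y => ?_
    exact lintegral_mul_const (μ := expMeasure (∑ c, lam c))
      (f := fun x => ENNReal.ofReal (Real.exp (s * x))) (ENNReal.ofReal (Real.exp (s * y)))
      (by fun_prop)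
  simp only [h1, h3] at h
  exact h

theorem ae_goodState_iterate : ∀ᵐ e ∂stateMeasure lam ν, ∀ n, GoodState (next^[n] e) := by
  -- Without sources `regenerative_next` is not available, but then only the service times matter.
  rcases isEmpty_or_nonempty ι with hι | ⟨⟨c⟩⟩
  · filter_upwards [ae_goodState hlam hν] with e he n
    refine ⟨fun c => hι.elim c, fun m => ?_⟩
    have : ∀ (n) (e : (ι → ℕ → ℝ) × (ℕ → ℝ)), (next^[n] e).2 = seqTail^[n] e.2 := fun n => by
      induction n with
      | zero => exact fun e => rfl
      | succ n ih => exact fun e => by rw [Function.iterate_succ_apply, ih]; rfl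
    rw [this, seqTail_iterate]
    exact he.2 _
  · have : Nonempty ι := ⟨c⟩
    exact ae_all_iff.2 fun n => ((regenerative_next hlam hν c).preserving.iterate n
      ).quasiMeasurePreserving.ae (ae_goodState hlam hν)

/-- Wald's identity: stage `n` belongs to the cycle if all earlier ones are lost, which is
independent of its duration. These probabilities sum to `(∑ c, lam c) / lam c`. -/
theorem lintegral_cycleLength :
    ∫⁻ e, ENNReal.ofReal (cycleLength c e) ∂stateMeasure lam ν =
      ENNReal.ofReal ((∑ c, lam c) / lam c) *
        (ENNReal.ofReal (1 / ∑ c, lam c) + ∫⁻ x, ENNReal.ofReal x ∂ν) := by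
  have : Nonempty ι := ⟨c⟩
  have := isProbabilityMeasure_stateMeasure hlam (ν := ν)
  have hL : 0 < ∑ c, lam c := Finset.sum_pos (fun c _ => hlam c) Finset.univ_nonempty
  have := isProbabilityMeasure_expMeasure hL
  let b : ℝ × Prop × ℝ → ℝ≥0∞ := {z | z.2.1}ᶜ.indicator 1
  let a : ℝ × Prop × ℝ → ℝ≥0∞ := fun z => ENNReal.ofReal z.1 + ENNReal.ofReal z.2.2
  have hb : Measurable b := measurable_one.indicator measurableSet_prop.compl
  have ha : Measurable a := by fun_prop
  have h1 : ∀ᵐ e ∂stateMeasure lam ν, ENNReal.ofReal (cycleLength c e) =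
      ∑' n, (∏ k ∈ Finset.range n, b (obs c (next^[k] e))) * a (obs c (next^[n] e)) := by
    filter_upwards [ae_exists_wins hlam hν c, ae_goodState_iterate hlam hν] with e he hg
    have h0 : ∀ k, 0 ≤ firstGap (next^[k] e).1 := fun k => by
      obtain ⟨j, hj⟩ := exists_eq_firstGap (next^[k] e).1
      rw [← hj]
      exact ((hg k).1 j).pos 0 |>.le
    rw [tsum_eq_sum (s := Finset.range (waits c e + 1)), cycleLength,
      ENNReal.ofReal_sum_of_nonneg fun k _ => add_nonneg (h0 k) ((hg k).2 0)]
    · refine Finset.sum_congr rfl fun n hn => ?_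
      rw [Finset.prod_eq_one, one_mul, ENNReal.ofReal_add (h0 n) ((hg n).2 0)]
      · rfl
      · intro k hk
        rw [Finset.mem_range] at hk hn
        exact (indicator_obs_of_not_wins (not_wins_of_lt (by omega)) 1).2
    · intro n hn
      rw [Finset.mem_range, not_lt] at hn
      rw [Finset.prod_eq_zero (Finset.mem_range.2 hn), zero_mul]
      exact (indicator_obs_of_wins (wins_waits he) 1).2
  rw [lintegral_congr_ae h1, (regenerative_next hlam hν c).lintegral_tsum_prod_mul ha hb,
    lintegral_obs hlam c hb, lintegral_obs hlam c ha]
  have h2 : ∫⁻ y, ∫⁻ x, (ENNReal.ofReal x + ENNReal.ofReal y) ∂expMeasure (∑ c, lam c) ∂ν =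
      ENNReal.ofReal (1 / ∑ c, lam c) + ∫⁻ x, ENNReal.ofReal x ∂ν := by
    simp_rw [lintegral_add_right _ measurable_const, lintegral_id_expMeasure hL, lintegral_const,
      measure_univ, mul_one]
    rw [lintegral_add_left measurable_const, lintegral_const, measure_univ, mul_one]
  simp only [a, b]
  rw [h2, ← add_mul, ← ENNReal.ofReal_add, ← add_div, add_sub_cancel, div_self hL.ne',
    ENNReal.ofReal_one, one_mul]
  · congr 1
    simp only [Set.indicator, Set.mem_compl_iff, Set.mem_ofPred_eq, not_true, if_false, not_false_iff,
      if_true, Pi.one_apply, lintegral_zero, mul_zero, zero_add, lintegral_one, measure_univ,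
      mul_one]
    rw [one_sub_loss hlam c, ← ENNReal.ofReal_inv_of_pos (div_pos (hlam c) hL), inv_div]
  · exact (div_pos (hlam c) hL).le
  · exact div_nonneg (sub_nonneg.2 (Finset.single_le_sum (fun c _ => (hlam c).le)
      (Finset.mem_univ c))) hL.le

end Cycle

/-! ### Renewal reward on a single path -/

section TimeAverage

/-- A renewal reward theorem for a single path: if the integral of a nonnegative function up to the
times `t n` and these times themselves grow linearly, then its time average converges. -/
theorem tendsto_timeAverage_of_tendsto {h : ℝ → ℝ} (h0 : ∀ t, 0 ≤ h t)
    (hi : ∀ T, 0 ≤ T → IntervalIntegrable h volume 0 T) {t : ℕ → ℝ} {a r : ℝ} (ha : 0 < a)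
    (ht : Tendsto (fun n : ℕ => t n / n) atTop (𝓝 a))
    (hr : Tendsto (fun n : ℕ => (∫ x in (0 : ℝ)..t n, h x) / n) atTop (𝓝 r)) :
    Tendsto (fun τ : ℝ => (1 / τ) * ∫ x in (0 : ℝ)..τ, h x) atTop (𝓝 (r / a)) := by
  have hmono : ∀ x y, 0 ≤ x → x ≤ y → ∫ u in (0 : ℝ)..x, h u ≤ ∫ u in (0 : ℝ)..y, h u := by
    intro x y hx hxy
    exact intervalIntegral.integral_mono_interval le_rfl hx hxy
      (ae_of_all _ fun u => h0 u) (hi y (hx.trans hxy))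
  have htop : Tendsto t atTop atTop := by
    have := ht.pos_mul_atTop ha tendsto_natCast_atTop_atTop
    refine this.congr' ?_
    filter_upwards [eventually_gt_atTop 0] with n hn
    field_simp
  have hk : Tendsto (fun τ => firstIdx t τ) atTop atTop := by
    refine tendsto_atTop.2 fun N => ?_
    have : ∀ᶠ τ : ℝ in atTop, ∀ m ∈ Finset.range N, t m < τ := by
      rw [eventually_all_finset]
      exact fun m _ => eventually_gt_atTop _
    filter_upwards [this] with τ hτ
    by_contra! hlt
    exact lt_asymm (lt_apply_firstIdx (d := τ) htop) (hτ _ (Finset.mem_range.2 hlt))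
  have hk' : Tendsto (fun τ => firstIdx t τ - 1) atTop atTop :=
    (tendsto_sub_atTop_nat 1).comp hk
  have hsucc : Tendsto (fun n : ℕ => ((n + 1 : ℕ) : ℝ) / n) atTop (𝓝 1) := by
    have h1 : Tendsto (fun n : ℕ => 1 + 1 / (n : ℝ)) atTop (𝓝 (1 + 0)) :=
      tendsto_const_nhds.add tendsto_one_div_atTop_nhds_zero_nat
    rw [add_zero] at h1
    refine h1.congr' ?_
    filter_upwards [eventually_gt_atTop 0] with n hn
    push_cast
    field_simp
  have ht1 := ht.comp (tendsto_add_atTop_nat 1)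
  have hr1 := hr.comp (tendsto_add_atTop_nat 1)
  have hup : Tendsto (fun n : ℕ => (∫ x in (0 : ℝ)..t (n + 1), h x) / t n) atTop (𝓝 (r / a)) := by
    have := (hr1.mul hsucc).div ht ha.ne'
    rw [mul_one] at this
    refine this.congr' ?_
    filter_upwards [eventually_gt_atTop 0] with n hn
    simp only [Pi.div_apply, Function.comp]
    have : (n : ℝ) ≠ 0 := by positivity
    have : ((n + 1 : ℕ) : ℝ) ≠ 0 := by positivity
    field_simp
  have hlow : Tendsto (fun n : ℕ => (∫ x in (0 : ℝ)..t n, h x) / t (n + 1)) atTop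
      (𝓝 (r / a)) := by
    have := hr.div (ht1.mul hsucc) (by simpa using ha.ne')
    rw [mul_one] at this
    refine this.congr' ?_
    filter_upwards [eventually_gt_atTop 0] with n hn
    simp only [Pi.div_apply, Function.comp]
    have : (n : ℝ) ≠ 0 := by positivity
    have : ((n + 1 : ℕ) : ℝ) ≠ 0 := by positivity
    field_simp
  -- The index just before the first passage brackets `τ` between consecutive times, although `t` is
  -- not assumed monotone.
  have hev : ∀ᶠ τ : ℝ in atTop, 0 < t (firstIdx t τ - 1) ∧ t (firstIdx t τ - 1) ≤ τ ∧
      τ < t (firstIdx t τ - 1 + 1) ∧ 0 < τ := by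
    filter_upwards [hk'.eventually (htop.eventually_gt_atTop 0), hk.eventually_gt_atTop 0,
      eventually_gt_atTop (0 : ℝ)] with τ h1 h2 h3
    refine ⟨h1, le_of_lt_firstIdx (by omega), ?_, h3⟩
    rw [Nat.sub_add_cancel h2]
    exact lt_apply_firstIdx htop
  refine tendsto_of_tendsto_of_tendsto_of_le_of_le' (hlow.comp hk') (hup.comp hk') ?_ ?_
  · filter_upwards [hev] with τ ⟨h1, h2, h3, h4⟩
    simp only [Function.comp]
    rw [one_div_mul_eq_div]
    have h5 := hmono _ _ h1.le h2
    have h6 := hmono _ _ le_rfl h1.le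
    rw [intervalIntegral.integral_same] at h6
    exact div_le_div₀ (h6.trans h5) h5 h4 h3.le
  · filter_upwards [hev] with τ ⟨h1, h2, h3, h4⟩
    simp only [Function.comp]
    rw [one_div_mul_eq_div]
    have h5 := hmono _ _ h4.le h3.le
    have h6 := hmono _ _ le_rfl h4.le
    rw [intervalIntegral.integral_same] at h6
    exact div_le_div₀ (h6.trans h5) h5 h1 h2

end TimeAverage

/-! ### Lengths and rewards of cycles, and their laws of large numbers -/

section Rewards

variable {ι : Type*} [Fintype ι]

/-- The integral of `f` over the values that the age of source `c` takes between the ends of the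
next two services of its packets. -/
noncomputable def reward (f : ℝ → ℝ) (c : ι) (e : (ι → ℕ → ℝ) × (ℕ → ℝ)) : ℝ :=
  ∫ x in cycleService c e..cycleService c e + cycleLength c (cycle c e), f x

theorem measurable_integral_add {f : ℝ → ℝ} (hf : Continuous f) :
    Measurable fun p : ℝ × ℝ => ∫ x in p.1..p.1 + p.2, f x := by
  have h1 : ∀ p : ℝ × ℝ, ∫ x in p.1..p.1 + p.2, f x =
      (∫ x in (0 : ℝ)..p.1 + p.2, f x) - ∫ x in (0 : ℝ)..p.1, f x := fun p =>
    (intervalIntegral.integral_interval_sub_left (hf.intervalIntegrable _ _)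
      (hf.intervalIntegrable _ _)).symm
  simp only [h1]
  have h2 : Continuous fun y => ∫ x in (0 : ℝ)..y, f x :=
    intervalIntegral.continuous_primitive (fun a b => hf.intervalIntegrable a b) 0
  fun_prop

theorem measurable_cycle (c : ι) : Measurable (cycle c) :=
  measurable_comp_waits c (f := fun n => next^[n + 1]) fun n => measurable_next.iterate (n + 1)

theorem measurable_reward {f : ℝ → ℝ} (hf : Continuous f) (c : ι) : Measurable (reward f c) :=
  (measurable_integral_add hf).comp ((measurable_cycleService c).prodMk
    ((measurable_cycleLength c).comp (measurable_cycle c)))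

variable {lam : ι → ℝ} (hlam : ∀ c, 0 < lam c) {ν : Measure ℝ} [IsProbabilityMeasure ν]
  (hν : ∀ᵐ x ∂ν, 0 ≤ x) (c : ι)

include hlam hν

/-- The age at the start of a cycle is the service time just completed. It belongs to the past of
`cycle c e`, so it is independent of the length of the cycle that begins there. -/
theorem cycle_lintegral_mul {u w : ℝ → ℝ≥0∞} (hu : Measurable u) (hw : Measurable w) :
    ∫⁻ e, u (cycleService c e) * w (cycleLength c (cycle c e)) ∂stateMeasure lam ν =
      (∫⁻ x, u x ∂ν) * ∫⁻ e, w (cycleLength c e) ∂stateMeasure lam ν := by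
  have h : Regenerative (stateMeasure lam ν) (cycleService c) (cycle c) :=
    (regenerative_cycle hlam hν c).comp (g := fun p => p.2) measurable_snd
  have hY : Measurable fun e => w (cycleLength c e) := hw.comp (measurable_cycleLength c)
  rw [h.lintegral_mul hu hY, lintegral_cycleService hlam hν c hu]

theorem ae_cycleLength_pos : ∀ᵐ e ∂stateMeasure lam ν, 0 < cycleLength c e := by
  have : Nonempty ι := ⟨c⟩
  filter_upwards [ae_goodState_iterate hlam hν] with e hg
  refine Finset.sum_pos (fun k _ => ?_) (by simp)
  obtain ⟨j, hj⟩ := exists_eq_firstGap (next^[k] e).1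
  rw [← hj]
  exact add_pos_of_pos_of_nonneg (((hg k).1 j).pos 0) ((hg k).2 0)

theorem integrable_cycleLength (hint : Integrable (fun x : ℝ => x) ν) :
    Integrable (cycleLength c) (stateMeasure lam ν) ∧
      ∫ e, cycleLength c e ∂stateMeasure lam ν =
        (∑ c, lam c) / lam c * (1 / ∑ c, lam c + ∫ x, x ∂ν) := by
  have : Nonempty ι := ⟨c⟩
  have hL : 0 < ∑ c, lam c := Finset.sum_pos (fun c _ => hlam c) Finset.univ_nonempty
  have h0 : 0 ≤ᵐ[stateMeasure lam ν] cycleLength c :=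
    (ae_cycleLength_pos hlam hν c).mono fun e he => he.le
  have hm : 0 ≤ ∫ x, x ∂ν := integral_nonneg_of_ae hν
  have h := lintegral_cycleLength hlam hν c
  have hp : 0 ≤ 1 / ∑ c, lam c := by positivity
  have hc := hlam c
  rw [← ofReal_integral_eq_lintegral_ofReal hint hν, ← ENNReal.ofReal_add hp hm,
    ← ENNReal.ofReal_mul (by positivity)] at h
  constructor
  · refine ⟨(measurable_cycleLength c).aestronglyMeasurable, ?_⟩
    rw [hasFiniteIntegral_iff_ofReal h0, h]
    exact ENNReal.ofReal_lt_top
  · rw [integral_eq_lintegral_of_nonneg_ae h0 (measurable_cycleLength c).aestronglyMeasurable, h,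
      ENNReal.toReal_ofReal (by positivity)]

theorem integral_cycleLength_pos (hint : Integrable (fun x : ℝ => x) ν) :
    0 < ∫ e, cycleLength c e ∂stateMeasure lam ν := by
  have : Nonempty ι := ⟨c⟩
  have hL : 0 < ∑ c, lam c := Finset.sum_pos (fun c _ => hlam c) Finset.univ_nonempty
  rw [(integrable_cycleLength hlam hν c hint).2]
  have := hlam c
  have := integral_nonneg_of_ae hν
  have : 0 < 1 / ∑ c, lam c := by positivity
  positivity

theorem tendsto_cycleLength (hint : Integrable (fun x : ℝ => x) ν) :
    ∀ᵐ e ∂stateMeasure lam ν, Tendsto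
      (fun n : ℕ => (∑ i ∈ Finset.range n, cycleLength c (((cycle c)^[i]) e)) / n) atTop
      (𝓝 (∫ e, cycleLength c e ∂stateMeasure lam ν)) :=
  have := isProbabilityMeasure_stateMeasure hlam (ν := ν)
  ((regenerative_cycle hlam hν c).comp (g := fun p => p.1) measurable_fst).strong_law
    (integrable_cycleLength hlam hν c hint).1

/-- A reward uses the service time of one cycle and the length of the next, so it is an observation
for `(cycle c)^[2]` and not for `cycle c`. The strong law holds along even and along odd indices
separately; the two averages are added, hence the range `2 * n` and the factor `2`. -/
theorem tendsto_reward {f : ℝ → ℝ} (hf : Continuous f)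
    (hint : Integrable (reward f c) (stateMeasure lam ν)) :
    ∀ᵐ e ∂stateMeasure lam ν, Tendsto
      (fun n : ℕ => (∑ i ∈ Finset.range (2 * n), reward f c (((cycle c)^[i]) e)) / n) atTop
      (𝓝 (2 * ∫ e, reward f c e ∂stateMeasure lam ν)) := by
  have := isProbabilityMeasure_stateMeasure hlam (ν := ν)
  have hR := regenerative_cycle hlam hν c
  have hG := measurable_integral_add hf
  have h2 : Regenerative (stateMeasure lam ν) (reward f c) ((cycle c)^[2]) :=
    (hR.iterate 2).comp
      (g := fun p : Fin 2 → ℝ × ℝ => (fun p : ℝ × ℝ => ∫ x in p.1..p.1 + p.2, f x)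
        ((p 0).2, (p 1).1)) (hG.comp (by fun_prop))
  have h3 := h2.strong_law hint
  filter_upwards [h3, hR.preserving.quasiMeasurePreserving.ae h3] with e h4 h5
  rw [two_mul]
  refine (h4.add h5).congr fun n => ?_
  rw [← add_div]
  congr 1
  induction n with
  | zero => simp
  | succ n ih =>
    rw [Finset.sum_range_succ, Finset.sum_range_succ, mul_add, mul_one, Finset.sum_range_succ,
      Finset.sum_range_succ, ← ih, ← Function.iterate_mul, ← Function.iterate_succ_apply]
    ring

end Rewards

/-! ### Exponential moments of the cycle length -/

section ExponentialMoments

variable {ι : Type*} [Fintype ι]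
variable {lam : ι → ℝ} (hlam : ∀ c, 0 < lam c) {ν : Measure ℝ} [IsProbabilityMeasure ν]
  (hν : ∀ᵐ x ∂ν, 0 ≤ x) (c : ι)

omit [IsProbabilityMeasure ν] in
theorem lintegral_exp_lt_top_iff {s : ℝ} :
    ∫⁻ x, ENNReal.ofReal (Real.exp (s * x)) ∂ν < ⊤ ↔ Integrable (fun x => Real.exp (s * x)) ν := by
  rw [← hasFiniteIntegral_iff_ofReal (ae_of_all _ fun x => (Real.exp_pos _).le)]
  exact ⟨fun h => ⟨by fun_prop, h⟩, fun h => h.2⟩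

theorem lintegral_exp_pos {s : ℝ} : 0 < ∫⁻ x, ENNReal.ofReal (Real.exp (s * x)) ∂ν := by
  rw [lintegral_pos_iff_support (by fun_prop)]
  have : Function.support (fun x => ENNReal.ofReal (Real.exp (s * x))) = Set.univ := by
    ext x; simp [Real.exp_pos]
  rw [this]
  simp

include hlam hν

theorem lintegral_exp_cycleLength_eq {s : ℝ} (hs : Integrable (fun x => Real.exp (s * x)) ν)
    (hD : 0 < ∑ c, lam c - s - (∑ c, lam c - lam c) * ∫ x, Real.exp (s * x) ∂ν) :
    ∫⁻ e, ENNReal.ofReal (Real.exp (s * cycleLength c e)) ∂stateMeasure lam ν =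
      ENNReal.ofReal (lam c * (∫ x, Real.exp (s * x) ∂ν) /
        (∑ c, lam c - s - (∑ c, lam c - lam c) * ∫ x, Real.exp (s * x) ∂ν)) := by
  have : Nonempty ι := ⟨c⟩
  have hL : 0 < ∑ c, lam c := Finset.sum_pos (fun c _ => hlam c) Finset.univ_nonempty
  have hle : lam c ≤ ∑ c, lam c :=
    Finset.single_le_sum (fun c _ => (hlam c).le) (Finset.mem_univ c)
  have hc := hlam c
  have hM : 0 ≤ ∫ x, Real.exp (s * x) ∂ν := integral_nonneg fun x => (Real.exp_pos _).le
  rw [lintegral_exp_cycleLength hlam hν c, lintegral_exp_expMeasure hL,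
    ← ofReal_integral_eq_lintegral_ofReal hs (ae_of_all _ fun x => (Real.exp_pos _).le)]
  generalize ∫ x, Real.exp (s * x) ∂ν = M at *
  generalize ∑ c, lam c = L at *
  have hLc : 0 ≤ L - lam c := by linarith
  -- `hD` forces `s < L`, so the exponential moment of the idle time is finite too.
  have hsL : 0 < L - s := by nlinarith [mul_nonneg hLc hM]
  rw [if_pos (by linarith), ← ENNReal.ofReal_mul (by positivity),
    ← ENNReal.ofReal_mul (by positivity), ← ENNReal.ofReal_mul (by positivity),
    ← ENNReal.ofReal_one, ← ENNReal.ofReal_sub _ (by positivity)]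
  have h1 : 1 - (L - lam c) / L * (L / (L - s) * M) = (L - s - (L - lam c) * M) / (L - s) := by
    field_simp
  rw [h1, ← ENNReal.ofReal_inv_of_pos (div_pos hD hsL),
    ← ENNReal.ofReal_mul (inv_nonneg.2 (div_pos hD hsL).le)]
  congr 1
  field_simp

/-- A factor of a finite product is finite if the other one is nonzero. The inverse is never zero,
so the moments of service and idle time are finite. The inverse is itself finite, so the geometric
ratio is below `1`, which amounts to the positivity of the denominator. -/
theorem of_lintegral_exp_cycleLength_lt_top {s : ℝ}
    (h : ∫⁻ e, ENNReal.ofReal (Real.exp (s * cycleLength c e)) ∂stateMeasure lam ν < ⊤) :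
    Integrable (fun x => Real.exp (s * x)) ν ∧
      0 < ∑ c, lam c - s - (∑ c, lam c - lam c) * ∫ x, Real.exp (s * x) ∂ν := by
  have : Nonempty ι := ⟨c⟩
  have hL : 0 < ∑ c, lam c := Finset.sum_pos (fun c _ => hlam c) Finset.univ_nonempty
  have := isProbabilityMeasure_expMeasure hL
  have hle : lam c ≤ ∑ c, lam c :=
    Finset.single_le_sum (fun c _ => (hlam c).le) (Finset.mem_univ c)
  have hc := hlam c
  rw [lintegral_exp_cycleLength hlam hν c] at h
  have hm0 := (lintegral_exp_pos (ν := ν) (s := s)).ne'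
  have hE0 := (lintegral_exp_pos (ν := expMeasure (∑ c, lam c)) (s := s)).ne'
  have hp0 : ENNReal.ofReal (lam c / ∑ c, lam c) ≠ 0 := by
    simpa using div_pos hc hL
  have hK0 := mul_ne_zero hE0 hm0
  have h1 := ENNReal.lt_top_of_mul_ne_top_right h.ne (by
    rw [ENNReal.inv_ne_zero]
    exact (tsub_le_self.trans_lt ENNReal.one_lt_top).ne)
  have h2 := ENNReal.lt_top_of_mul_ne_top_left h.ne (mul_ne_zero hp0 hK0)
  have h3 := ENNReal.lt_top_of_mul_ne_top_right h1.ne hp0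
  have h4 := ENNReal.lt_top_of_mul_ne_top_right h3.ne hE0
  have h5 := ENNReal.lt_top_of_mul_ne_top_left h3.ne hm0
  have hs := lintegral_exp_lt_top_iff.1 h4
  refine ⟨hs, ?_⟩
  rw [lintegral_exp_expMeasure hL] at h5 h2
  have hsL : s < ∑ c, lam c := by
    by_contra hn
    rw [if_neg hn] at h5
    exact lt_irrefl _ h5
  rw [if_pos hsL, ← ofReal_integral_eq_lintegral_ofReal hs (ae_of_all _ fun x => (Real.exp_pos _).le),
    ENNReal.inv_lt_top, tsub_pos_iff_lt] at h2
  have hM : 0 ≤ ∫ x, Real.exp (s * x) ∂ν := integral_nonneg fun x => (Real.exp_pos _).le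
  generalize ∫ x, Real.exp (s * x) ∂ν = M at *
  generalize ∑ c, lam c = L at *
  have hLs : 0 < L - s := by linarith
  have hLc : 0 ≤ L - lam c := by linarith
  rw [← ENNReal.ofReal_mul (by positivity), ← ENNReal.ofReal_mul (by positivity),
    ENNReal.ofReal_lt_one] at h2
  have h6 : (L - lam c) / L * (L / (L - s) * M) = (L - lam c) * M / (L - s) := by
    field_simp
  rw [h6, div_lt_one hLs] at h2
  linarith

end ExponentialMoments

/-! ### Good states persist along the dynamics -/

section GoodState

variable {ι : Type*}

theorem next_iterate_snd (n : ℕ) (e : (ι → ℕ → ℝ) × (ℕ → ℝ)) :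
    (next^[n] e).2 = seqTail^[n] e.2 := by
  induction n generalizing e with
  | zero => rfl
  | succ n ih => rw [Function.iterate_succ_apply, ih]; rfl

theorem GoodState.next {e : (ι → ℕ → ℝ) × (ℕ → ℝ)} (he : GoodState e) : GoodState (next e) :=
  ⟨fun c => (he.1 c).shift _, fun n => he.2 (n + 1)⟩

theorem GoodState.iterate {e : (ι → ℕ → ℝ) × (ℕ → ℝ)} (he : GoodState e) (n : ℕ) :
    GoodState (_root_.next^[n] e) := by
  induction n with
  | zero => exact he
  | succ n ih => rw [Function.iterate_succ_apply']; exact ih.next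

theorem GoodState.iterate_cycle {e : (ι → ℕ → ℝ) × (ℕ → ℝ)} (he : GoodState e) (c : ι) (n : ℕ) :
    GoodState ((cycle c)^[n] e) := by
  induction n with
  | zero => exact he
  | succ n ih => rw [Function.iterate_succ_apply']; exact ih.iterate _

variable [Fintype ι]

theorem GoodState.firstGap_pos [Nonempty ι] {e : (ι → ℕ → ℝ) × (ℕ → ℝ)} (he : GoodState e) :
    0 < firstGap e.1 := by
  obtain ⟨j, hj⟩ := exists_eq_firstGap e.1
  rw [← hj]
  exact (he.1 j).pos 0

theorem GoodState.cycleLength_pos [Nonempty ι] {e : (ι → ℕ → ℝ) × (ℕ → ℝ)} (he : GoodState e)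
    (c : ι) : 0 < cycleLength c e :=
  Finset.sum_pos (fun k _ => add_pos_of_pos_of_nonneg (he.iterate k).firstGap_pos
    ((he.iterate k).2 0)) (by simp)

end GoodState

/-! ### Pathwise analysis of the queue -/

namespace StatusUpdateSystem

variable {C : ℕ} {Ω : Type*} (Q : StatusUpdateSystem C Ω) (c : Fin C) (ω : Ω)

/-- The time at which the server has completed the service that was going on at time `0`. -/
noncomputable def freeTime : ℝ := max (Q.initEnd ω) 0

/-- The state at that time. -/
noncomputable def freeState : (Fin C → ℕ → ℝ) × (ℕ → ℝ) :=
  (shiftAll (Q.freeTime ω) fun c n => Q.gap c n ω, fun k => Q.service k ω)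

/-- The end of the `n`-th service after time `0`. -/
noncomputable def busyEnd (n : ℕ) : ℝ :=
  Q.freeTime ω + ∑ k ∈ Finset.range n,
    (firstGap (next^[k] (Q.freeState ω)).1 + (next^[k] (Q.freeState ω)).2 0)

/-- The end of the `n`-th service of a packet of source `c` that starts after time `0`. -/
noncomputable def cycleEnd (n : ℕ) : ℝ :=
  Q.freeTime ω + ∑ k ∈ Finset.range n, cycleLength c ((cycle c)^[k] (Q.freeState ω))

/-- The paths that have the almost sure properties on which the analysis relies. -/
structure GoodPath : Prop where
  gaps : ∀ c, GoodGaps fun n => Q.gap c n ω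
  service : ∀ k, 0 ≤ Q.service k ω
  wins : ∀ i, ∃ n, Wins c (next^[n] ((cycle c)^[i] (Q.freeState ω)))
  tendsto : Tendsto (fun n => Q.cycleEnd c ω n) atTop atTop

variable {Q c ω}

theorem arrival_eq_psum (c : Fin C) (n : ℕ) (ω : Ω) :
    Q.arrival c n ω = psum (fun n => Q.gap c n ω) n := rfl

namespace GoodPath

variable (h : Q.GoodPath c ω)
include h

theorem goodState : GoodState (Q.freeState ω) := ⟨fun c => (h.gaps c).shift _, h.service⟩

omit h in
theorem freeTime_nonneg : 0 ≤ Q.freeTime ω := le_max_right _ _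

theorem busyEnd_nonneg (n : ℕ) : 0 ≤ Q.busyEnd ω n := by
  have : Nonempty (Fin C) := ⟨c⟩
  exact add_nonneg (freeTime_nonneg) (Finset.sum_nonneg fun k _ => add_nonneg
    (h.goodState.iterate k).firstGap_pos.le ((h.goodState.iterate k).2 0))

theorem next_iterate_fst (n : ℕ) :
    (next^[n] (Q.freeState ω)).1 = shiftAll (Q.busyEnd ω n) fun c n => Q.gap c n ω := by
  have : Nonempty (Fin C) := ⟨c⟩
  induction n with
  | zero => simp [busyEnd, freeState]
  | succ n ih =>
    have h1 : busyEnd Q ω (n + 1) = busyEnd Q ω n +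
        (firstGap (next^[n] (Q.freeState ω)).1 + (next^[n] (Q.freeState ω)).2 0) := by
      rw [busyEnd, Finset.sum_range_succ, ← add_assoc]; rfl
    rw [Function.iterate_succ_apply', h1]
    have h2 := (h.goodState.iterate n)
    ext c : 1
    simp only [next, shiftAll]
    rw [← (h.gaps c).shift_shift (add_nonneg h2.firstGap_pos.le (h2.2 0)), ih]
    rfl

/-- All arrivals are positive, so those after `d` are those after `max d 0`. This covers an initial
packet that left before time `0`. -/
theorem nextArrival_eq {d d' : ℝ} (hd : d' = max d 0) :
    Q.nextArrival d ω = d' + firstGap (shiftAll d' fun c n => Q.gap c n ω) := by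
  have : Nonempty (Fin C) := ⟨c⟩
  have hlt : ∀ t, (d < t ∧ ∃ c n, Q.arrival c n ω = t) ↔
      ∃ c, ∃ n, psum (shift d' fun n => Q.gap c n ω) n = t - d' := by
    intro t
    simp only [fun c => (h.gaps c).exists_psum_shift (d := d') (t := t)]
    constructor
    · rintro ⟨h1, c, n, rfl⟩
      exact ⟨c, hd ▸ max_lt h1 ((h.gaps c).psum_pos n), n, rfl⟩
    · rintro ⟨c, h1, n, rfl⟩
      exact ⟨(le_max_left d 0).trans_lt (hd ▸ h1), c, n, rfl⟩
  have : IsLeast {t : ℝ | d < t ∧ ∃ c n, Q.arrival c n ω = t}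
      (d' + firstGap (shiftAll d' fun c n => Q.gap c n ω)) := by
    constructor
    · refine (hlt _).2 ?_
      obtain ⟨j, hj⟩ := exists_eq_firstGap (shiftAll d' fun c n => Q.gap c n ω)
      refine ⟨j, 0, ?_⟩
      rw [psum_zero, add_sub_cancel_left]
      exact hj
    · intro t ht
      obtain ⟨c, n, hn⟩ := (hlt t).1 ht
      have h1 := firstGap_le (shiftAll d' fun c n => Q.gap c n ω) c
      have h2 := ((h.gaps c).shift d').strictMono.monotone (Nat.zero_le n)
      rw [psum_zero, hn] at h2
      have h3 := h1.trans h2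
      linarith
  exact this.csInf_eq

/-- Identifies the recursive dynamics of the server with the iterates of `next`. Packet `0` comes
before them, so `next^[n]` governs packet `n + 1`. -/
theorem serviceEnd_eq (n : ℕ) :
    Q.nextArrival (Q.serviceEnd n ω) ω =
        Q.busyEnd ω n + firstGap (next^[n] (Q.freeState ω)).1 ∧
      Q.serviceEnd (n + 1) ω = Q.busyEnd ω (n + 1) := by
  have hs : ∀ n, Q.nextArrival (Q.serviceEnd n ω) ω =
        Q.busyEnd ω n + firstGap (next^[n] (Q.freeState ω)).1 →
      Q.serviceEnd (n + 1) ω = Q.busyEnd ω (n + 1) := by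
    intro n hn
    rw [serviceEnd, hn, busyEnd, busyEnd, Finset.sum_range_succ, next_iterate_snd,
      seqTail_iterate, zero_add]
    simp only [freeState]
    ring
  induction n with
  | zero =>
    have : Q.nextArrival (Q.serviceEnd 0 ω) ω =
        Q.busyEnd ω 0 + firstGap (next^[0] (Q.freeState ω)).1 := by
      rw [h.nextArrival_eq (d' := Q.busyEnd ω 0) (by simp [busyEnd, freeTime, serviceEnd]),
        ← h.next_iterate_fst]
    exact ⟨this, hs 0 this⟩
  | succ n ih =>
    have : Q.nextArrival (Q.serviceEnd (n + 1) ω) ω =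
        Q.busyEnd ω (n + 1) + firstGap (next^[n + 1] (Q.freeState ω)).1 := by
      rw [h.nextArrival_eq (d' := Q.busyEnd ω (n + 1)), ← h.next_iterate_fst]
      rw [ih.2, max_eq_left (h.busyEnd_nonneg _)]
    exact ⟨this, hs _ this⟩

/-- No source has a point between the preceding service end and this service start, so a point of
`c` at the start has to be its first one seen from that end. -/
theorem isFrom_succ_iff (n : ℕ) : Q.IsFrom c (n + 1) ω ↔ Wins c (next^[n] (Q.freeState ω)) := by
  have : Nonempty (Fin C) := ⟨c⟩
  have hg := (h.goodState.iterate n)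
  have h1 : Q.serviceStart (n + 1) ω =
      Q.busyEnd ω n + firstGap (next^[n] (Q.freeState ω)).1 := (h.serviceEnd_eq n).1
  have h2 := (h.gaps c).exists_psum_shift (d := Q.busyEnd ω n) (t := Q.serviceStart (n + 1) ω)
  have h3 := (hg.1 c).exists_psum_eq_iff (firstGap_le _ c)
  have h4 : Q.busyEnd ω n < Q.serviceStart (n + 1) ω := by linarith [hg.firstGap_pos]
  rw [Wins, ← h3, IsFrom]
  simp only [h4, true_and] at h2
  simp only [arrival_eq_psum]
  rw [← h2, h1, add_sub_cancel_left, h.next_iterate_fst]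
  rfl

end GoodPath

variable (Q c ω)

/-- The number of services, after time `0`, until the end of the `n`-th one of source `c`. -/
noncomputable def cycleIndex : ℕ → ℕ
  | 0 => 0
  | n + 1 => cycleIndex n + (waits c ((cycle c)^[n] (Q.freeState ω)) + 1)

/-- The number of packets of source `c` among those that entered service before time `0` and are
numbered. -/
noncomputable def offset : ℕ := if Q.initSource ω = c then 1 else 0

theorem next_iterate_cycleIndex (n : ℕ) :
    next^[Q.cycleIndex c ω n] (Q.freeState ω) = (cycle c)^[n] (Q.freeState ω) := by
  induction n with
  | zero => rfl
  | succ n ih =>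
    rw [cycleIndex, add_comm, Function.iterate_add_apply, ih,
      Function.iterate_succ_apply' (cycle c)]
    rfl

theorem next_iterate_cycleIndex_add (n k : ℕ) :
    next^[Q.cycleIndex c ω n + k] (Q.freeState ω) =
      next^[k] ((cycle c)^[n] (Q.freeState ω)) := by
  rw [add_comm, Function.iterate_add_apply, next_iterate_cycleIndex]

theorem busyEnd_cycleIndex (n : ℕ) : Q.busyEnd ω (Q.cycleIndex c ω n) = Q.cycleEnd c ω n := by
  induction n with
  | zero => simp [busyEnd, cycleEnd, cycleIndex]
  | succ n ih =>
    rw [cycleEnd, Finset.sum_range_succ, ← add_assoc, ← cycleEnd, ← ih, busyEnd, cycleIndex,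
      Finset.sum_range_add, ← add_assoc, ← busyEnd]
    simp only [next_iterate_cycleIndex_add]
    rfl

variable {Q c ω}

namespace GoodPath

variable (h : Q.GoodPath c ω)
include h

-- Each cycle contributes exactly its last packet. The `+ 1` includes packet `0`, whose contribution
-- is `offset`.
open Classical in
theorem count_cycleIndex (n : ℕ) :
    Nat.count (fun k => Q.IsFrom c k ω) (Q.cycleIndex c ω n + 1) = n + Q.offset c ω := by
  induction n with
  | zero =>
    rw [cycleIndex, Nat.count_succ, Nat.count_zero, offset]
    by_cases h0 : Q.initSource ω = c <;> simp [IsFrom, h0]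
  | succ n ih =>
    have hwin : Q.IsFrom c (Q.cycleIndex c ω (n + 1)) ω := by
      rw [cycleIndex, ← add_assoc, h.isFrom_succ_iff, next_iterate_cycleIndex_add]
      exact wins_waits (h.wins n)
    rw [Nat.count_succ, if_pos hwin, cycleIndex, ← add_assoc, add_right_comm, Nat.count_add, ih]
    have : Nat.count (fun k => Q.IsFrom c (Q.cycleIndex c ω n + 1 + k) ω)
        (waits c ((cycle c)^[n] (Q.freeState ω))) = 0 := by
      rw [Nat.count_iff_forall_not]
      intro k hk
      rw [add_right_comm, h.isFrom_succ_iff, next_iterate_cycleIndex_add]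
      exact not_wins_of_lt hk
    rw [this]
    ring

theorem nth_isFrom (n : ℕ) :
    Nat.nth (fun k => Q.IsFrom c k ω) (n + Q.offset c ω) = Q.cycleIndex c ω (n + 1) := by
  classical
  have hwin : Q.IsFrom c (Q.cycleIndex c ω (n + 1)) ω := by
    rw [cycleIndex, ← add_assoc, h.isFrom_succ_iff, next_iterate_cycleIndex_add]
    exact wins_waits (h.wins n)
  have h1 := h.count_cycleIndex (n + 1)
  rw [Nat.count_succ, if_pos hwin] at h1
  have h2 : Nat.count (fun k => Q.IsFrom c k ω) (Q.cycleIndex c ω (n + 1)) =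
      n + Q.offset c ω := by omega
  rw [← h2]
  exact Nat.nth_count hwin

theorem recTime_add_offset (n : ℕ) :
    Q.recTime c (n + Q.offset c ω) ω = Q.cycleEnd c ω (n + 1) := by
  rw [recTime, h.nth_isFrom, ← busyEnd_cycleIndex, cycleIndex, ← add_assoc]
  exact (h.serviceEnd_eq _).2

theorem genTime_add_offset (n : ℕ) :
    Q.genTime c (n + Q.offset c ω) ω =
      Q.cycleEnd c ω (n + 1) - cycleService c ((cycle c)^[n] (Q.freeState ω)) := by
  have h1 := h.recTime_add_offset n
  rw [recTime, h.nth_isFrom, cycleIndex, ← add_assoc] at h1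
  rw [genTime, h.nth_isFrom, cycleIndex, ← add_assoc, ← h1, serviceEnd, serviceStart, cycleService,
    ← next_iterate_cycleIndex_add, next_iterate_snd, seqTail_iterate, zero_add]
  simp [freeState]

omit h in
theorem time_zero (h0 : Q.initSource ω = c) :
    Q.recTime c 0 ω = Q.initEnd ω ∧ Q.genTime c 0 ω = Q.initStart ω := by
  classical
  have : Nat.nth (fun k => Q.IsFrom c k ω) 0 = 0 := by
    have := Nat.nth_count (p := fun k => Q.IsFrom c k ω) (n := 0) h0
    rwa [Nat.count_zero] at this
  rw [recTime, genTime, this]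
  exact ⟨rfl, rfl⟩

omit h in
theorem cycleEnd_succ_sub (n : ℕ) : Q.cycleEnd c ω (n + 1) =
    Q.cycleEnd c ω n + cycleLength c ((cycle c)^[n] (Q.freeState ω)) := by
  rw [cycleEnd, Finset.sum_range_succ, ← add_assoc]; rfl

theorem cycleEnd_strictMono : StrictMono (Q.cycleEnd c ω) := by
  have : Nonempty (Fin C) := ⟨c⟩
  refine strictMono_nat_of_lt_succ fun n => ?_
  rw [cycleEnd_succ_sub]
  linarith [(h.goodState.iterate_cycle c n).cycleLength_pos c]

/-- Packet `n + offset` is the one that ends cycle `n`; its service time is followed by the whole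
next cycle. -/
theorem peakAge_eq (n : ℕ) : Q.peakAge c (n + Q.offset c ω + 1) ω =
    cycleService c ((cycle c)^[n] (Q.freeState ω)) +
      cycleLength c (cycle c ((cycle c)^[n] (Q.freeState ω))) := by
  have h1 : n + Q.offset c ω + 1 = n + 1 + Q.offset c ω := by ring
  rw [peakAge, interdeparture, systemTime, Nat.add_sub_cancel, h1, h.recTime_add_offset,
    h.recTime_add_offset, h.genTime_add_offset, cycleEnd_succ_sub (n + 1),
    Function.iterate_succ_apply']
  ring

theorem recTime_cases : (Q.offset c ω = 0 ∧ ∀ n, Q.recTime c n ω = Q.cycleEnd c ω (n + 1)) ∨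
    (Q.offset c ω = 1 ∧ Q.recTime c 0 ω = Q.initEnd ω ∧
      ∀ n, Q.recTime c (n + 1) ω = Q.cycleEnd c ω (n + 1)) := by
  by_cases h0 : Q.initSource ω = c
  · right
    have ho : Q.offset c ω = 1 := if_pos h0
    refine ⟨ho, (time_zero h0).1, fun n => ?_⟩
    have := h.recTime_add_offset n
    rwa [ho] at this
  · left
    have ho : Q.offset c ω = 0 := if_neg h0
    refine ⟨ho, fun n => ?_⟩
    have := h.recTime_add_offset n
    rwa [ho] at this

theorem recTime_mono : Monotone fun n => Q.recTime c n ω := by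
  rcases h.recTime_cases with ⟨-, h1⟩ | ⟨-, h1, h2⟩
  · simp only [h1]
    exact fun m n hmn => h.cycleEnd_strictMono.monotone (by omega)
  · refine monotone_nat_of_le_succ fun n => ?_
    cases n with
    | zero =>
      rw [h1, h2]
      have := h.cycleEnd_strictMono (Nat.zero_lt_one)
      have h3 : Q.cycleEnd c ω 0 = Q.freeTime ω := by simp [cycleEnd]
      exact (le_max_left _ _).trans (h3 ▸ this.le)
    | succ n =>
      rw [h2, h2]
      exact h.cycleEnd_strictMono.monotone (by omega)

theorem recTime_tendsto : Tendsto (fun n => Q.recTime c n ω) atTop atTop := by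
  rw [← tendsto_add_atTop_iff_nat (Q.offset c ω)]
  simp only [h.recTime_add_offset]
  exact (tendsto_add_atTop_iff_nat 1).2 h.tendsto

end GoodPath

variable (Q c ω)

/-- The time stamps of source `c` in the order in which they are valid. -/
noncomputable def stampSeq : ℕ → ℝ
  | 0 => Q.initStamp c ω
  | n + 1 => Q.genTime c n ω

variable {Q c ω}

namespace GoodPath

variable (h : Q.GoodPath c ω)
include h

/-- Reception times are nondecreasing and unbounded, so the packets received up to `t` form an
initial segment, counted by `firstIdx`. The index of `stampSeq` is shifted by one so that the count
`0` gives the initial stamp. -/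
theorem stamp_eq (t : ℝ) :
    Q.stamp c t ω = Q.stampSeq c ω (firstIdx (fun n => Q.recTime c n ω) t) := by
  have hiff : ∀ n, Q.recTime c n ω ≤ t ↔ n < firstIdx (fun n => Q.recTime c n ω) t := fun n => by
    exact not_lt.symm.trans ((not_congr
      (lt_iff_firstIdx_le h.recTime_tendsto h.recTime_mono)).trans not_le)
  have hset : {i | Q.recTime c i ω ≤ t} =
      {i | i < firstIdx (fun n => Q.recTime c n ω) t} := Set.ext hiff
  rw [stamp, hset]
  rcases Nat.eq_zero_or_eq_succ_pred (firstIdx (fun n => Q.recTime c n ω) t) with hN | hN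
  · rw [if_neg, hN]
    · rfl
    · rintro ⟨i, hi⟩
      have := (hiff i).1 hi
      omega
  · rw [if_pos ⟨0, (hiff 0).2 (by omega)⟩, hN]
    congr 1
    exact IsGreatest.csSup_eq ⟨Nat.lt_succ_self _, fun i hi => Nat.lt_succ_iff.1 hi⟩

theorem age_eq_of_mem {n : ℕ} {t : ℝ} (h1 : Q.recTime c n ω ≤ t) (h2 : t < Q.recTime c (n + 1) ω) :
    Q.age c t ω = t - Q.genTime c n ω := by
  have : firstIdx (fun n => Q.recTime c n ω) t = n + 1 :=
    firstIdx_eq _ (fun m hm => (h.recTime_mono (Nat.lt_succ_iff.1 hm)).trans h1) h2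
  rw [age, h.stamp_eq, this]
  rfl

theorem age_eq_of_lt {t : ℝ} (h1 : t < Q.recTime c 0 ω) : Q.age c t ω = t - Q.initStamp c ω := by
  have : firstIdx (fun n => Q.recTime c n ω) t = 0 :=
    firstIdx_eq _ (fun m hm => absurd hm (Nat.not_lt_zero m)) h1
  rw [age, h.stamp_eq, this]
  rfl

-- The age is known only on `[x, y)`, because it may drop at `y`; one endpoint is a null set.
omit h in
theorem integral_of_age_eq {f : ℝ → ℝ} (hf : Continuous f) {x y u : ℝ} (hxy : x ≤ y)
    (hu : ∀ t, x ≤ t → t < y → Q.age c t ω = t - u) :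
    IntervalIntegrable (fun t => f (Q.age c t ω)) volume x y ∧
      ∫ t in x..y, f (Q.age c t ω) = ∫ t in x - u..y - u, f t := by
  have hae : ∀ᵐ t : ℝ, t ≠ y := by simp [ae_iff]
  have heq : ∀ᵐ t : ℝ, t ∈ Set.uIoc x y → f (t - u) = f (Q.age c t ω) := by
    filter_upwards [hae] with t ht hm
    rw [Set.uIoc_of_le hxy] at hm
    rw [hu t hm.1.le (lt_of_le_of_ne hm.2 ht)]
  have hc : Continuous fun t => f (t - u) := by fun_prop
  refine ⟨(hc.intervalIntegrable x y).congr_ae ?_, ?_⟩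
  · exact (ae_restrict_iff' measurableSet_uIoc).2 heq
  · rw [← intervalIntegral.integral_comp_sub_right]
    exact (intervalIntegral.integral_congr_ae heq).symm

theorem integral_cycle {f : ℝ → ℝ} (hf : Continuous f) (n : ℕ) :
    IntervalIntegrable (fun t => f (Q.age c t ω)) volume (Q.cycleEnd c ω (n + 1))
        (Q.cycleEnd c ω (n + 2)) ∧
      ∫ t in Q.cycleEnd c ω (n + 1)..Q.cycleEnd c ω (n + 2), f (Q.age c t ω) =
        reward f c ((cycle c)^[n] (Q.freeState ω)) := by
  have h1 := integral_of_age_eq (Q := Q) (c := c) (ω := ω) hf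
    (u := Q.genTime c (n + Q.offset c ω) ω)
    (h.cycleEnd_strictMono.monotone (by omega : n + 1 ≤ n + 2)) (fun t ht1 ht2 => by
      refine h.age_eq_of_mem (by rwa [h.recTime_add_offset]) ?_
      have : n + Q.offset c ω + 1 = n + 1 + Q.offset c ω := by ring
      rwa [this, h.recTime_add_offset])
  refine ⟨h1.1, h1.2.trans ?_⟩
  rw [h.genTime_add_offset, reward, cycleEnd_succ_sub (n + 1), Function.iterate_succ_apply']
  congr 1 <;> ring

/-- Up to the first cycle end the stamp is the initial one and, if packet `0` is from `c`, the
generation time of that packet once it is received. Only integrability is needed, as this piece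
vanishes in the time average. -/
theorem intervalIntegrable_init {f : ℝ → ℝ} (hf : Continuous f) :
    IntervalIntegrable (fun t => f (Q.age c t ω)) volume 0 (Q.cycleEnd c ω 1) := by
  have hfree : Q.freeTime ω ≤ Q.cycleEnd c ω 1 := by
    have := h.cycleEnd_strictMono Nat.zero_lt_one
    simpa [cycleEnd] using this.le
  rcases h.recTime_cases with ⟨-, h1⟩ | ⟨-, h1, h2⟩
  · exact (integral_of_age_eq hf (freeTime_nonneg.trans hfree) (u := Q.initStamp c ω)
      fun t _ ht => h.age_eq_of_lt (by rwa [h1])).1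
  · refine IntervalIntegrable.trans (b := Q.freeTime ω) ?_ ?_
    · refine (integral_of_age_eq hf freeTime_nonneg (u := Q.initStamp c ω) fun t ht1 ht2 =>
        h.age_eq_of_lt ?_).1
      rw [h1]
      exact (lt_max_iff.1 ht2).resolve_right (not_lt.2 ht1)
    · refine (integral_of_age_eq hf hfree (u := Q.genTime c 0 ω) fun t ht1 ht2 =>
        h.age_eq_of_mem ?_ (by rwa [h2])).1
      rw [h1]
      exact (le_max_left _ _).trans ht1

theorem integral_cycles {f : ℝ → ℝ} (hf : Continuous f) (n : ℕ) :
    IntervalIntegrable (fun t => f (Q.age c t ω)) volume 0 (Q.cycleEnd c ω (n + 1)) ∧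
      ∫ t in (0 : ℝ)..Q.cycleEnd c ω (n + 1), f (Q.age c t ω) =
        (∫ t in (0 : ℝ)..Q.cycleEnd c ω 1, f (Q.age c t ω)) +
          ∑ k ∈ Finset.range n, reward f c ((cycle c)^[k] (Q.freeState ω)) := by
  induction n with
  | zero => exact ⟨h.intervalIntegrable_init hf, by simp⟩
  | succ n ih =>
    have h1 := h.integral_cycle hf n
    refine ⟨ih.1.trans h1.1, ?_⟩
    rw [← intervalIntegral.integral_add_adjacent_intervals ih.1 h1.1, ih.2, h1.2,
      Finset.sum_range_succ, add_assoc]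

/-- If the rewards and the lengths of the cycles obey the law of large numbers, then the time
average of `f` along the age converges. -/
theorem tendsto_timeAverage {f : ℝ → ℝ} (hf : Continuous f) (hf0 : ∀ x, 0 ≤ f x) {m r : ℝ}
    (hm : 0 < m)
    (h1 : Tendsto (fun n : ℕ => (∑ i ∈ Finset.range n,
      cycleLength c ((cycle c)^[i] (Q.freeState ω))) / n) atTop (𝓝 m))
    (h2 : Tendsto (fun n : ℕ => (∑ i ∈ Finset.range (2 * n),
      reward f c ((cycle c)^[i] (Q.freeState ω))) / n) atTop (𝓝 (2 * r))) :
    Tendsto (fun τ : ℝ => (1 / τ) * ∫ t in (0 : ℝ)..τ, f (Q.age c t ω)) atTop (𝓝 (r / m)) := by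
  -- The law for rewards is given along even counts, so the path is sampled at every second cycle
  -- end and both means double.
  have h3 : r / m = (2 * r) / (2 * m) := by field_simp
  rw [h3]
  have hdiv : ∀ a : ℝ, Tendsto (fun n : ℕ => a / n) atTop (𝓝 0) := fun a =>
    tendsto_const_nhds.div_atTop tendsto_natCast_atTop_atTop
  refine tendsto_timeAverage_of_tendsto (t := fun n => Q.cycleEnd c ω (2 * n + 1))
    (fun t => hf0 _) (fun T hT => ?_) (by positivity) ?_ ?_
  · obtain ⟨n, hn⟩ := (((tendsto_add_atTop_iff_nat 1).2 h.tendsto).eventually_ge_atTop T).exists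
    refine (h.integral_cycles hf n).1.mono_set ?_
    rw [Set.uIcc_of_le hT, Set.uIcc_of_le (hT.trans hn)]
    exact Set.Icc_subset_Icc_right hn
  · have hsub : Tendsto (fun n : ℕ => 2 * n + 1) atTop atTop :=
      tendsto_atTop_mono (fun n => by simp only [id]; omega) tendsto_id
    have h4 := h1.comp hsub
    have h5 : Tendsto (fun n : ℕ => ((2 * n + 1 : ℕ) : ℝ) / n) atTop (𝓝 (2 + 0)) := by
      refine (tendsto_const_nhds.add (hdiv 1)).congr' ?_
      filter_upwards [eventually_gt_atTop 0] with n hn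
      push_cast
      field_simp
    have h6 := (h4.mul h5).add (hdiv (Q.freeTime ω))
    rw [add_zero, add_zero, mul_comm] at h6
    refine h6.congr' ?_
    filter_upwards [eventually_gt_atTop 0] with n hn
    simp only [Function.comp, cycleEnd]
    have : (n : ℝ) ≠ 0 := by positivity
    have : ((2 * n + 1 : ℕ) : ℝ) ≠ 0 := by positivity
    field_simp
    ring
  · have h4 := (hdiv (∫ t in (0 : ℝ)..Q.cycleEnd c ω 1, f (Q.age c t ω))).add h2
    rw [zero_add] at h4
    refine h4.congr fun n => ?_
    rw [(h.integral_cycles hf (2 * n)).2, add_div]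

end GoodPath

end StatusUpdateSystem

/-! ### The law of the inputs and of the state when the initial packet is done -/

namespace StatusUpdateSystem

variable {C : ℕ} {Ω : Type*} {Q : StatusUpdateSystem C Ω}

variable (Q) in
/-- The sources' gaps and the service times. -/
def inputs (ω : Ω) : (Fin C → ℕ → ℝ) × (ℕ → ℝ) :=
  (fun c n => Q.gap c n ω, fun k => Q.service k ω)

variable (Q) in
/-- The state at time `0`. -/
def initData (ω : Ω) : Fin C × ℝ × ℝ × (Fin C → ℝ) :=
  (Q.initSource ω, Q.initStart ω, Q.initEnd ω, fun c => Q.initStamp c ω)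

variable [MeasurableSpace Ω] {P : Measure Ω} [IsProbabilityMeasure P]
  {lam : Fin C → ℝ} (hlam : ∀ c, 0 < lam c) {ν : Measure ℝ} [IsProbabilityMeasure ν]
  (hν : ∀ᵐ x ∂ν, 0 ≤ x) (hint : Integrable (fun x : ℝ => x) ν) (hQ : Q.IsMG11 P lam ν) (c : Fin C)

namespace IsMG11

include hQ

omit [IsProbabilityMeasure P] [IsProbabilityMeasure ν] in
theorem measurable_inputs : Measurable Q.inputs := by
  have h1 := hQ.measurable_gap
  have h2 := hQ.measurable_service
  unfold inputs
  fun_prop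

omit [IsProbabilityMeasure P] [IsProbabilityMeasure ν] in
theorem measurable_initData : Measurable Q.initData := by
  have h1 := hQ.measurable_initSource
  have h2 := hQ.measurable_initStart
  have h3 := hQ.measurable_initEnd
  have h4 := hQ.measurable_initStamp
  unfold initData
  fun_prop

omit [IsProbabilityMeasure P] [IsProbabilityMeasure ν] in
theorem measurable_freeState : Measurable Q.freeState := by
  have h1 := hQ.measurable_gap
  have h2 := hQ.measurable_service
  have h3 := hQ.measurable_initEnd
  refine Measurable.prodMk ?_ (by fun_prop)
  refine measurable_shiftAll.comp (f := fun ω => (Q.freeTime ω, fun c n => Q.gap c n ω)) ?_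
  unfold freeTime
  fun_prop

include hlam

theorem map_inputs : P.map Q.inputs = stateMeasure lam ν := by
  have hg := hQ.measurable_gap
  have hs := hQ.measurable_service
  have := fun c => isProbabilityMeasure_expMeasure (hlam c)
  have := fun c => isProbabilityMeasure_gapMeasure (hlam c)
  have h1 := hQ.indep_gap_service
  rw [indepFun_iff_map_prod_eq_prod_map_map (by fun_prop) (by fun_prop)] at h1
  have h2 : P.map (fun ω c n => Q.gap c n ω) = gapsMeasure lam := by
    have h3 := hQ.indep_gap.map_fun_eq_infinitePi_map (fun p : Fin C × ℕ => hg p.1 p.2)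
    simp only [hQ.gap_law] at h3
    -- Currying turns the independent family over pairs into independent sequences, one for each
    -- source.
    have h4 := Measure.infinitePi_map_curry (fun (c : Fin C) (_ : ℕ) => expMeasure (lam c))
    rw [← h3, Measure.map_map (by fun_prop) (by fun_prop), Measure.infinitePi_eq_pi] at h4
    exact h4
  have h5 : P.map (fun ω k => Q.service k ω) = Measure.infinitePi fun _ => ν := by
    have h3 := hQ.indep_service.map_fun_eq_infinitePi_map hs
    simpa only [hQ.service_law] using h3
  rw [h2, h5] at h1
  exact h1

/-- When the server becomes idle for the first time, the state has the stationary law and is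
independent of the initial data. -/
theorem lintegral_initData_freeState
    {K : (Fin C × ℝ × ℝ × (Fin C → ℝ)) × ((Fin C → ℕ → ℝ) × (ℕ → ℝ)) → ℝ≥0∞} (hK : Measurable K) :
    ∫⁻ ω, K (Q.initData ω, Q.freeState ω) ∂P =
      ∫⁻ ω, ∫⁻ e, K (Q.initData ω, e) ∂stateMeasure lam ν ∂P := by
  have := isProbabilityMeasure_gapsMeasure hlam
  have := isProbabilityMeasure_stateMeasure hlam (ν := ν)
  have hi := hQ.measurable_initData
  have hin := hQ.measurable_inputs
  have h1 : P.map (fun ω => (Q.initData ω, Q.inputs ω)) =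
      (P.map Q.initData).prod (stateMeasure lam ν) := by
    rw [← hQ.map_inputs hlam]
    exact (indepFun_iff_map_prod_eq_prod_map_map hi.aemeasurable hin.aemeasurable).1 hQ.indep_init
  have := Measure.isProbabilityMeasure_map (μ := P) hi.aemeasurable
  -- `freeState` is the input shifted by a time that depends on the initial data alone; with these
  -- data fixed, the shift preserves the law.
  let K' : (Fin C × ℝ × ℝ × (Fin C → ℝ)) × ((Fin C → ℕ → ℝ) × (ℕ → ℝ)) → ℝ≥0∞ :=
    fun p => K (p.1, shiftAll (max p.1.2.2.1 0) p.2.1, p.2.2)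
  have hK' : Measurable K' := by
    refine hK.comp (measurable_fst.prodMk (Measurable.prodMk ?_ (by fun_prop)))
    exact measurable_shiftAll.comp
      (f := fun p : (Fin C × ℝ × ℝ × (Fin C → ℝ)) × ((Fin C → ℕ → ℝ) × (ℕ → ℝ)) =>
        (max p.1.2.2.1 0, p.2.1)) (by fun_prop)
  have h2 : ∫⁻ ω, K (Q.initData ω, Q.freeState ω) ∂P =
      ∫⁻ ω, K' (Q.initData ω, Q.inputs ω) ∂P := rfl
  rw [h2, ← lintegral_map (f := K') (g := fun ω => (Q.initData ω, Q.inputs ω)) hK'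
    (hi.prodMk hin), h1, lintegral_prod _ hK'.aemeasurable,
    lintegral_map hK'.lintegral_prod_right' hi]
  refine lintegral_congr fun ω => ?_
  have h3 : MeasurePreserving (fun e : (Fin C → ℕ → ℝ) × (ℕ → ℝ) =>
      (shiftAll (max (Q.initData ω).2.2.1 0) e.1, e.2)) (stateMeasure lam ν)
      (stateMeasure lam ν) :=
    (measurePreserving_shiftAll hlam (le_max_right _ _)).prod (MeasurePreserving.id _)
  exact h3.lintegral_comp (f := fun e => K (Q.initData ω, e)) (by fun_prop)

theorem measurePreserving_freeState : MeasurePreserving Q.freeState P (stateMeasure lam ν) := by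
  have hm := hQ.measurable_freeState
  refine ⟨hm, ?_⟩
  ext A hA
  have h := hQ.lintegral_initData_freeState hlam (K := fun p => A.indicator 1 p.2)
    ((measurable_one.indicator hA).comp measurable_snd)
  simp only [lintegral_indicator_one hA, lintegral_const, measure_univ, mul_one] at h
  rw [Measure.map_apply hm hA, ← h, ← lintegral_indicator_one (hm hA)]
  rfl

include hν hint

theorem ae_goodPath : ∀ᵐ ω ∂P, Q.GoodPath c ω := by
  have : Nonempty (Fin C) := ⟨c⟩
  have hp := (hQ.measurePreserving_freeState hlam).quasiMeasurePreserving
  have hin : MeasurePreserving Q.inputs P (stateMeasure lam ν) :=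
    ⟨hQ.measurable_inputs, hQ.map_inputs hlam⟩
  have hpos := integral_cycleLength_pos hlam hν c hint
  have hwins : ∀ᵐ e ∂stateMeasure lam ν, ∀ i, ∃ n, Wins c (next^[n] ((cycle c)^[i] e)) :=
    ae_all_iff.2 fun i => ((regenerative_cycle hlam hν c).preserving.iterate i
      ).quasiMeasurePreserving.ae (ae_exists_wins hlam hν c)
  filter_upwards [hin.quasiMeasurePreserving.ae (ae_goodState hlam hν), hp.ae hwins,
    hp.ae (tendsto_cycleLength hlam hν c hint)] with ω h1 h2 h3
  refine ⟨h1.1, h1.2, h2, ?_⟩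
  refine tendsto_atTop_add_const_left _ _ ?_
  refine (h3.pos_mul_atTop hpos tendsto_natCast_atTop_atTop).congr' ?_
  filter_upwards [eventually_gt_atTop 0] with n hn
  field_simp

/-- The law of the peak age of every packet but the first two. -/
theorem lintegral_peakAge {i : ℕ} (hi : 2 ≤ i) {u : ℝ → ℝ≥0∞} (hu : Measurable u) :
    ∫⁻ ω, u (Q.peakAge c i ω) ∂P =
      ∫⁻ e, u (cycleService c e + cycleLength c (cycle c e)) ∂stateMeasure lam ν := by
  let A : ((Fin C → ℕ → ℝ) × (ℕ → ℝ)) → ℝ := fun e =>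
    cycleService c e + cycleLength c (cycle c e)
  have hA : Measurable A := (measurable_cycleService c).add
    ((measurable_cycleLength c).comp (measurable_cycle c))
  -- Packet `i - 1` ends the cycle `i - 2` or `i - 1`, according to whether packet `0` counts for
  -- source `c`. As `i ≥ 2`, it is in both cases served after time `0`.
  let K : (Fin C × ℝ × ℝ × (Fin C → ℝ)) × ((Fin C → ℕ → ℝ) × (ℕ → ℝ)) → ℝ≥0∞ := fun p =>
    if p.1.1 = c then u (A ((cycle c)^[i - 2] p.2)) else u (A ((cycle c)^[i - 1] p.2))
  have hc : ∀ n, Measurable ((cycle c)^[n]) := fun n => (measurable_cycle c).iterate n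
  have hK : Measurable K := by
    refine Measurable.ite ?_ (by fun_prop) (by fun_prop)
    exact (measurable_fst.comp measurable_fst) (measurableSet_singleton c)
  have h1 : ∀ᵐ ω ∂P, u (Q.peakAge c i ω) = K (Q.initData ω, Q.freeState ω) := by
    filter_upwards [hQ.ae_goodPath hlam hν hint c] with ω h
    by_cases h0 : Q.initSource ω = c
    · have h2 := h.peakAge_eq (i - 2)
      have h3 : i - 2 + 1 + 1 = i := by omega
      rw [offset, if_pos h0, h3] at h2
      rw [h2]
      exact (if_pos (c := (Q.initData ω).1 = c) h0).symm
    · have h2 := h.peakAge_eq (i - 1)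
      have h3 : i - 1 + 0 + 1 = i := by omega
      rw [offset, if_neg h0, h3] at h2
      rw [h2]
      exact (if_neg (c := (Q.initData ω).1 = c) h0).symm
  rw [lintegral_congr_ae h1, hQ.lintegral_initData_freeState hlam hK]
  have h4 : ∀ n, ∫⁻ e, u (A ((cycle c)^[n] e)) ∂stateMeasure lam ν =
      ∫⁻ e, u (A e) ∂stateMeasure lam ν := fun n =>
    ((regenerative_cycle hlam hν c).preserving.iterate n).lintegral_comp
      (f := fun e => u (A e)) (by fun_prop)
  have h5 : ∀ ω, ∫⁻ e, K (Q.initData ω, e) ∂stateMeasure lam ν =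
      ∫⁻ e, u (A e) ∂stateMeasure lam ν := fun ω => by
    by_cases h0 : (Q.initData ω).1 = c
    · simp only [K, h0, if_true, h4]
    · simp only [K, h0, if_false, h4]
  simp only [h5, lintegral_const, measure_univ, mul_one]
  rfl

theorem tendsto_timeAverage_age {f : ℝ → ℝ} (hf : Continuous f) (hf0 : ∀ x, 0 ≤ f x)
    (hr : Integrable (reward f c) (stateMeasure lam ν)) :
    ∀ᵐ ω ∂P, Tendsto (fun τ : ℝ => (1 / τ) * ∫ t in (0 : ℝ)..τ, f (Q.age c t ω)) atTop
      (𝓝 ((∫ e, reward f c e ∂stateMeasure lam ν) / ∫ e, cycleLength c e ∂stateMeasure lam ν)) := by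
  have : Nonempty (Fin C) := ⟨c⟩
  have hp := (hQ.measurePreserving_freeState hlam).quasiMeasurePreserving
  have hpos := integral_cycleLength_pos hlam hν c hint
  filter_upwards [hQ.ae_goodPath hlam hν hint c, hp.ae (tendsto_cycleLength hlam hν c hint),
    hp.ae (tendsto_reward hlam hν c hf hr)] with ω h h1 h2
  exact h.tendsto_timeAverage hf hf0 hpos h1 h2

end IsMG11

end StatusUpdateSystem

/-! ### Measurability, and the moment generating function of the peak age -/

namespace StatusUpdateSystem

variable {C : ℕ} {Ω : Type*} {Q : StatusUpdateSystem C Ω}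

variable [MeasurableSpace Ω] {P : Measure Ω} [IsProbabilityMeasure P]
  {lam : Fin C → ℝ} (hlam : ∀ c, 0 < lam c) {ν : Measure ℝ} [IsProbabilityMeasure ν]
  (hν : ∀ᵐ x ∂ν, 0 ≤ x) (hint : Integrable (fun x : ℝ => x) ν) (hQ : Q.IsMG11 P lam ν) (c : Fin C)

namespace IsMG11

include hQ

omit [IsProbabilityMeasure P] [IsProbabilityMeasure ν] in
theorem measurable_cycleEnd (n : ℕ) : Measurable fun ω => Q.cycleEnd c ω n := by
  have h1 := hQ.measurable_initEnd
  have h2 := fun k => ((measurable_cycleLength c).comp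
    ((measurable_cycle c).iterate k)).comp hQ.measurable_freeState
  have h3 : Measurable fun ω => Q.freeTime ω := h1.max measurable_const
  exact h3.add (Finset.measurable_sum _ fun k _ => h2 k)

include hlam hν hint

/-- `Nat.nth` of a random predicate is not visibly measurable; on good paths it is replaced by
explicit cycle ends, with a case distinction on the source of packet `0`. -/
theorem aemeasurable_recTime (n : ℕ) : AEMeasurable (Q.recTime c n) P := by
  have hE := hQ.measurable_cycleEnd c
  have hS : MeasurableSet {ω | Q.initSource ω = c} :=
    hQ.measurable_initSource (measurableSet_singleton c)
  cases n with
  | zero =>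
    refine ⟨fun ω => if Q.initSource ω = c then Q.initEnd ω else Q.cycleEnd c ω 1,
      Measurable.ite hS hQ.measurable_initEnd (hE 1), ?_⟩
    filter_upwards [hQ.ae_goodPath hlam hν hint c] with ω h
    split_ifs with h0
    · exact (GoodPath.time_zero h0).1
    · simpa [offset, h0] using h.recTime_add_offset 0
  | succ n =>
    refine ⟨fun ω => if Q.initSource ω = c then Q.cycleEnd c ω (n + 1) else
      Q.cycleEnd c ω (n + 2), Measurable.ite hS (hE _) (hE _), ?_⟩
    filter_upwards [hQ.ae_goodPath hlam hν hint c] with ω h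
    split_ifs with h0
    · simpa [offset, h0] using h.recTime_add_offset n
    · simpa [offset, h0] using h.recTime_add_offset (n + 1)

theorem aemeasurable_genTime (n : ℕ) : AEMeasurable (Q.genTime c n) P := by
  have hE : ∀ n, Measurable fun ω => Q.cycleEnd c ω (n + 1) -
      cycleService c ((cycle c)^[n] (Q.freeState ω)) := fun n =>
    (hQ.measurable_cycleEnd c (n + 1)).sub (((measurable_cycleService c).comp
      ((measurable_cycle c).iterate n)).comp hQ.measurable_freeState)
  have hS : MeasurableSet {ω | Q.initSource ω = c} :=
    hQ.measurable_initSource (measurableSet_singleton c)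
  cases n with
  | zero =>
    refine ⟨fun ω => if Q.initSource ω = c then Q.initStart ω else _,
      Measurable.ite hS hQ.measurable_initStart (hE 0), ?_⟩
    filter_upwards [hQ.ae_goodPath hlam hν hint c] with ω h
    split_ifs with h0
    · exact (GoodPath.time_zero h0).2
    · simpa [offset, h0] using h.genTime_add_offset 0
  | succ n =>
    refine ⟨fun ω => if Q.initSource ω = c then _ else _, Measurable.ite hS (hE n) (hE (n + 1)), ?_⟩
    filter_upwards [hQ.ae_goodPath hlam hν hint c] with ω h
    split_ifs with h0
    · simpa [offset, h0] using h.genTime_add_offset n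
    · simpa [offset, h0] using h.genTime_add_offset (n + 1)

theorem aemeasurable_peakAge (i : ℕ) : AEMeasurable (Q.peakAge c i) P := by
  have h1 := hQ.aemeasurable_recTime hlam hν hint c
  have h2 := hQ.aemeasurable_genTime hlam hν hint c
  exact ((h1 _).sub (h1 _)).add ((h1 _).sub (h2 _))

/-- Up to a null set, the age is jointly measurable in time and chance. -/
theorem exists_measurable_age : ∃ A : ℝ → Ω → ℝ, Measurable (Function.uncurry A) ∧
    ∀ᵐ ω ∂P, ∀ t, Q.age c t ω = A t ω := by
  have h1 := hQ.aemeasurable_recTime hlam hν hint c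
  have h2 : ∀ n, AEMeasurable (fun ω => Q.stampSeq c ω n) P := fun n => by
    cases n with
    | zero => exact (hQ.measurable_initStamp c).aemeasurable
    | succ n => exact hQ.aemeasurable_genTime hlam hν hint c n
  refine ⟨fun t ω => t - (h2 (firstIdx (fun n => (h1 n).mk _ ω) t)).mk _ ω, ?_, ?_⟩
  · refine measurable_fst.sub ?_
    have hb : Measurable fun p : ℝ × Ω => ((fun n => (h1 n).mk _ p.2 : ℕ → ℝ), p.1) :=
      (measurable_pi_lambda _ fun n => (h1 n).measurable_mk.comp measurable_snd).prodMk
        measurable_fst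
    have hu : Measurable fun p : ℝ × Ω => (fun n => (h2 n).mk _ p.2 : ℕ → ℝ) :=
      measurable_pi_lambda _ fun n => (h2 n).measurable_mk.comp measurable_snd
    exact measurable_eval_index.comp ((measurable_firstIdx.comp hb).prodMk hu)
  · filter_upwards [hQ.ae_goodPath hlam hν hint c, ae_all_iff.2 fun n => (h1 n).ae_eq_mk,
      ae_all_iff.2 fun n => (h2 n).ae_eq_mk] with ω h h3 h4 t
    have h5 : (fun n => (h1 n).mk _ ω) = fun n => Q.recTime c n ω := funext fun n => (h3 n).symm
    rw [age, h.stamp_eq, h5, h4]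

/-- The moment generating function of the peak age in terms of that of a cycle. -/
theorem lintegral_exp_peakAge {i : ℕ} (hi : 2 ≤ i) (s : ℝ) :
    ∫⁻ ω, ENNReal.ofReal (Real.exp (s * Q.peakAge c i ω)) ∂P =
      (∫⁻ x, ENNReal.ofReal (Real.exp (s * x)) ∂ν) *
        ∫⁻ e, ENNReal.ofReal (Real.exp (s * cycleLength c e)) ∂stateMeasure lam ν := by
  have hm : Measurable fun x : ℝ => ENNReal.ofReal (Real.exp (s * x)) := by fun_prop
  rw [hQ.lintegral_peakAge hlam hν hint c hi hm, ← cycle_lintegral_mul hlam hν c hm hm]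
  refine lintegral_congr fun e => ?_
  rw [mul_add, Real.exp_add, ENNReal.ofReal_mul (Real.exp_nonneg _)]

theorem peakAge_mgf {i : ℕ} (hi : 2 ≤ i) (s : ℝ) :
    (Integrable (fun ω => Real.exp (s * Q.peakAge c i ω)) P ↔
      Integrable (fun x => Real.exp (s * x)) ν ∧
        0 < (∑ c, lam c) - s - ((∑ c, lam c) - lam c) * ∫ x, Real.exp (s * x) ∂ν) ∧
    (Integrable (fun x => Real.exp (s * x)) ν →
      0 < (∑ c, lam c) - s - ((∑ c, lam c) - lam c) * ∫ x, Real.exp (s * x) ∂ν →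
      ∫ ω, Real.exp (s * Q.peakAge c i ω) ∂P = lam c * (∫ x, Real.exp (s * x) ∂ν) ^ 2 /
        ((∑ c, lam c) - s - ((∑ c, lam c) - lam c) * ∫ x, Real.exp (s * x) ∂ν)) := by
  have hms : AEStronglyMeasurable (fun ω => Real.exp (s * Q.peakAge c i ω)) P :=
    (Real.measurable_exp.comp_aemeasurable
      ((hQ.aemeasurable_peakAge hlam hν hint c i).const_mul s)).aestronglyMeasurable
  have hnn : 0 ≤ᵐ[P] fun ω => Real.exp (s * Q.peakAge c i ω) :=
    ae_of_all _ fun _ => Real.exp_nonneg _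
  have hI : Integrable (fun ω => Real.exp (s * Q.peakAge c i ω)) P ↔
      ∫⁻ ω, ENNReal.ofReal (Real.exp (s * Q.peakAge c i ω)) ∂P < ⊤ :=
    (and_iff_right hms).trans (hasFiniteIntegral_iff_ofReal hnn)
  have hE := hQ.lintegral_exp_peakAge hlam hν hint c hi s
  have hval : Integrable (fun x => Real.exp (s * x)) ν →
      0 < (∑ c, lam c) - s - ((∑ c, lam c) - lam c) * ∫ x, Real.exp (s * x) ∂ν →
      ∫⁻ ω, ENNReal.ofReal (Real.exp (s * Q.peakAge c i ω)) ∂P =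
        ENNReal.ofReal (lam c * (∫ x, Real.exp (s * x) ∂ν) ^ 2 /
        ((∑ c, lam c) - s - ((∑ c, lam c) - lam c) * ∫ x, Real.exp (s * x) ∂ν)) := by
    intro hs hD
    rw [hE, lintegral_exp_cycleLength_eq hlam hν c hs hD,
      ← ofReal_integral_eq_lintegral_ofReal hs (ae_of_all _ fun _ => Real.exp_nonneg _),
      ← ENNReal.ofReal_mul (integral_nonneg fun _ => Real.exp_nonneg _)]
    congr 1
    ring
  refine ⟨⟨fun h => ?_, fun h => ?_⟩, fun hs hD => ?_⟩
  · rw [hI, hE] at h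
    refine of_lintegral_exp_cycleLength_lt_top hlam hν c ?_
    exact (ENNReal.lt_top_of_mul_ne_top_right h.ne lintegral_exp_pos.ne')
  · rw [hI, hval h.1 h.2]
    exact ENNReal.ofReal_lt_top
  · rw [integral_eq_lintegral_of_nonneg_ae hnn hms, hval hs hD, ENNReal.toReal_ofReal]
    have := (hlam c).le
    positivity

end IsMG11

end StatusUpdateSystem

/-! ### Rewards of the exponential function -/

section Reward

variable {ι : Type*} [Fintype ι]

omit [Fintype ι] in
theorem reward_exp {s : ℝ} (hs : s ≠ 0) (c : ι) (e : (ι → ℕ → ℝ) × (ℕ → ℝ)) :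
    reward (fun x => Real.exp (s * x)) c e =
      Real.exp (s * cycleService c e) * ((Real.exp (s * cycleLength c (cycle c e)) - 1) / s) := by
  rw [reward, intervalIntegral.integral_comp_mul_left (fun x => Real.exp x) hs, integral_exp,
    mul_add, Real.exp_add, smul_eq_mul]
  field_simp

omit [Fintype ι] in
theorem reward_mono {f g : ℝ → ℝ} (hf : Continuous f) (hg : Continuous g) (hfg : ∀ x, f x ≤ g x)
    {c : ι} {e : (ι → ℕ → ℝ) × (ℕ → ℝ)} (he : 0 ≤ cycleLength c (cycle c e)) :
    reward f c e ≤ reward g c e :=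
  intervalIntegral.integral_mono (by linarith) (hf.intervalIntegrable _ _)
    (hg.intervalIntegrable _ _) hfg

omit [Fintype ι] in
theorem reward_nonneg {f : ℝ → ℝ} (hf : ∀ x, 0 ≤ f x)
    {c : ι} {e : (ι → ℕ → ℝ) × (ℕ → ℝ)} (he : 0 ≤ cycleLength c (cycle c e)) :
    0 ≤ reward f c e :=
  intervalIntegral.integral_nonneg (by linarith) fun x _ => hf x

omit [Fintype ι] in
theorem reward_le {f : ℝ → ℝ} (hf : Continuous f) {N : ℝ} (hN : ∀ x, f x ≤ N)
    {c : ι} {e : (ι → ℕ → ℝ) × (ℕ → ℝ)} (he : 0 ≤ cycleLength c (cycle c e)) :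
    reward f c e ≤ N * cycleLength c (cycle c e) := by
  refine (reward_mono hf continuous_const hN he).trans_eq ?_
  simp [reward, mul_comm]

omit [Fintype ι] in
/-- Cutting a continuous function off at a high level does not change the reward of a cycle. -/
theorem eventually_reward_min_eq {f : ℝ → ℝ} (hf : Continuous f) (c : ι)
    (e : (ι → ℕ → ℝ) × (ℕ → ℝ)) :
    ∀ᶠ N : ℕ in atTop, reward (fun x => min (f x) N) c e = reward f c e := by
  obtain ⟨B, hB⟩ := (isCompact_uIcc (a := cycleService c e)
    (b := cycleService c e + cycleLength c (cycle c e))).bddAbove_image hf.continuousOn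
  filter_upwards [tendsto_natCast_atTop_atTop.eventually_ge_atTop B] with N hN
  exact intervalIntegral.integral_congr fun x hx =>
    min_eq_left ((hB (Set.mem_image_of_mem _ hx)).trans hN)

variable {lam : ι → ℝ} (hlam : ∀ c, 0 < lam c) {ν : Measure ℝ} [IsProbabilityMeasure ν]
  (hν : ∀ᵐ x ∂ν, 0 ≤ x) (c : ι)

include hlam hν

theorem ae_cycleLength_cycle_pos : ∀ᵐ e ∂stateMeasure lam ν, 0 < cycleLength c (cycle c e) :=
  (regenerative_cycle hlam hν c).preserving.quasiMeasurePreserving.ae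
    (ae_cycleLength_pos hlam hν c)

theorem integrable_reward_of_bounded (hint : Integrable (fun x : ℝ => x) ν) {f : ℝ → ℝ}
    (hf : Continuous f) (hf0 : ∀ x, 0 ≤ f x) {N : ℝ} (hN : ∀ x, f x ≤ N) :
    Integrable (reward f c) (stateMeasure lam ν) := by
  have h1 : Integrable (fun e => N * cycleLength c (cycle c e)) (stateMeasure lam ν) :=
    ((regenerative_cycle hlam hν c).preserving.integrable_comp_of_integrable
      (integrable_cycleLength hlam hν c hint).1).const_mul N
  refine h1.mono' (measurable_reward hf c).aestronglyMeasurable ?_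
  filter_upwards [ae_cycleLength_cycle_pos hlam hν c] with e he
  rw [Real.norm_of_nonneg (reward_nonneg hf0 he.le)]
  exact reward_le hf hN he.le

theorem lintegral_reward_exp {s : ℝ} (hs : s ≠ 0) :
    ∫⁻ e, ENNReal.ofReal (reward (fun x => Real.exp (s * x)) c e) ∂stateMeasure lam ν =
      (∫⁻ x, ENNReal.ofReal (Real.exp (s * x)) ∂ν) *
        ∫⁻ e, ENNReal.ofReal ((Real.exp (s * cycleLength c e) - 1) / s) ∂stateMeasure lam ν := by
  rw [← cycle_lintegral_mul hlam hν c (w := fun y => ENNReal.ofReal ((Real.exp (s * y) - 1) / s))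
    (by fun_prop) (by fun_prop)]
  refine lintegral_congr fun e => ?_
  rw [reward_exp hs, ENNReal.ofReal_mul (Real.exp_nonneg _)]

omit hlam hν in
theorem exp_sub_one_div_pos {s x : ℝ} (hs : s ≠ 0) (hx : 0 < x) :
    0 < (Real.exp (s * x) - 1) / s := by
  rcases hs.lt_or_gt with h | h
  · exact div_pos_of_neg_of_neg (by
      rw [sub_neg, Real.exp_lt_one_iff]; exact mul_neg_of_neg_of_pos h hx) h
  · exact div_pos (by rw [sub_pos, Real.one_lt_exp_iff]; positivity) h

/-- For either sign of `s`, `exp (s * Y) ≤ 1 + |s| * ((exp (s * Y) - 1) / s)`, so a finite mean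
reward makes the exponential moment of the cycle length finite. -/
theorem of_lintegral_reward_exp_lt_top {s : ℝ} (hs : s ≠ 0)
    (h : ∫⁻ e, ENNReal.ofReal (reward (fun x => Real.exp (s * x)) c e) ∂stateMeasure lam ν < ⊤) :
    Integrable (fun x => Real.exp (s * x)) ν ∧
      0 < ∑ c, lam c - s - (∑ c, lam c - lam c) * ∫ x, Real.exp (s * x) ∂ν := by
  have := isProbabilityMeasure_stateMeasure hlam (ν := ν)
  have hpos := ae_cycleLength_pos hlam hν c
  have hY := measurable_cycleLength c
  refine of_lintegral_exp_cycleLength_lt_top hlam hν c ?_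
  rw [lintegral_reward_exp hlam hν c hs] at h
  have h1 := ENNReal.lt_top_of_mul_ne_top_right h.ne lintegral_exp_pos.ne'
  have h2 : ∫⁻ e, ENNReal.ofReal (Real.exp (s * cycleLength c e)) ∂stateMeasure lam ν ≤
      ∫⁻ e, (1 + ENNReal.ofReal |s| * ENNReal.ofReal ((Real.exp (s * cycleLength c e) - 1) / s))
        ∂stateMeasure lam ν := by
    refine lintegral_mono_ae ?_
    filter_upwards [hpos] with e he
    have h3 := (exp_sub_one_div_pos hs he).le
    rw [← ENNReal.ofReal_one, ← ENNReal.ofReal_mul (abs_nonneg s),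
      ← ENNReal.ofReal_add zero_le_one (mul_nonneg (abs_nonneg s) h3)]
    refine ENNReal.ofReal_le_ofReal ?_
    have h4 : Real.exp (s * cycleLength c e) - 1 =
        s * ((Real.exp (s * cycleLength c e) - 1) / s) := by field_simp
    have h5 := mul_le_mul_of_nonneg_right (le_abs_self s) h3
    linarith
  refine h2.trans_lt ?_
  rw [lintegral_add_left measurable_const, lintegral_const_mul _ (by fun_prop), lintegral_one,
    measure_univ]
  exact ENNReal.add_lt_top.2 ⟨ENNReal.one_lt_top, ENNReal.mul_lt_top ENNReal.ofReal_lt_top h1⟩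

theorem reward_exp_nonneg {s : ℝ} :
    0 ≤ᵐ[stateMeasure lam ν] reward (fun x => Real.exp (s * x)) c := by
  filter_upwards [ae_cycleLength_cycle_pos hlam hν c] with e he
  exact reward_nonneg (fun x => Real.exp_nonneg _) he.le

theorem lintegral_reward_exp_eq {s : ℝ} (hs : s ≠ 0)
    (hm : Integrable (fun x => Real.exp (s * x)) ν)
    (hD : 0 < ∑ c, lam c - s - (∑ c, lam c - lam c) * ∫ x, Real.exp (s * x) ∂ν) :
    ∫⁻ e, ENNReal.ofReal (reward (fun x => Real.exp (s * x)) c e) ∂stateMeasure lam ν =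
      ENNReal.ofReal ((∫ x, Real.exp (s * x) ∂ν) *
        ((lam c * (∫ x, Real.exp (s * x) ∂ν) /
        (∑ c, lam c - s - (∑ c, lam c - lam c) * ∫ x, Real.exp (s * x) ∂ν) - 1) / s)) := by
  have := isProbabilityMeasure_stateMeasure hlam (ν := ν)
  have hY := measurable_cycleLength c
  have hE := lintegral_exp_cycleLength_eq hlam hν c hm hD
  have hnn : 0 ≤ᵐ[stateMeasure lam ν] fun e => Real.exp (s * cycleLength c e) :=
    ae_of_all _ fun e => Real.exp_nonneg _
  have hI : Integrable (fun e => Real.exp (s * cycleLength c e)) (stateMeasure lam ν) :=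
    ⟨by fun_prop, (hasFiniteIntegral_iff_ofReal hnn).2 (hE ▸ ENNReal.ofReal_lt_top)⟩
  have hM : 0 ≤ ∫ x, Real.exp (s * x) ∂ν := integral_nonneg fun x => Real.exp_nonneg _
  have hV : ∫ e, Real.exp (s * cycleLength c e) ∂stateMeasure lam ν =
      lam c * (∫ x, Real.exp (s * x) ∂ν) /
        (∑ c, lam c - s - (∑ c, lam c - lam c) * ∫ x, Real.exp (s * x) ∂ν) := by
    rw [integral_eq_lintegral_of_nonneg_ae hnn hI.1, hE, ENNReal.toReal_ofReal]
    have := (hlam c).le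
    positivity
  rw [lintegral_reward_exp hlam hν c hs,
    ← ofReal_integral_eq_lintegral_ofReal hm (ae_of_all _ fun x => Real.exp_nonneg _),
    ← ofReal_integral_eq_lintegral_ofReal (f := fun e => (Real.exp (s * cycleLength c e) - 1) / s)
      ((hI.sub (integrable_const 1)).div_const s) ?_, ← ENNReal.ofReal_mul hM]
  · rw [integral_div, integral_sub hI (integrable_const 1), hV]
    simp
  · filter_upwards [ae_cycleLength_pos hlam hν c] with e he
    exact (exp_sub_one_div_pos hs he).le

theorem integrable_reward_exp {s : ℝ} (hs : s ≠ 0)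
    (hm : Integrable (fun x => Real.exp (s * x)) ν)
    (hD : 0 < ∑ c, lam c - s - (∑ c, lam c - lam c) * ∫ x, Real.exp (s * x) ∂ν) :
    Integrable (reward (fun x => Real.exp (s * x)) c) (stateMeasure lam ν) := by
  refine ⟨(measurable_reward (by fun_prop) c).aestronglyMeasurable,
    (hasFiniteIntegral_iff_ofReal (reward_exp_nonneg hlam hν c)).2 ?_⟩
  rw [lintegral_reward_exp_eq hlam hν c hs hm hD]
  exact ENNReal.ofReal_lt_top

/-- The ratio of the mean reward and the mean length of a cycle. -/
theorem integral_reward_exp_div {s : ℝ} (hs : s ≠ 0) (hint : Integrable (fun x : ℝ => x) ν)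
    (hm : Integrable (fun x => Real.exp (s * x)) ν)
    (hD : 0 < ∑ c, lam c - s - (∑ c, lam c - lam c) * ∫ x, Real.exp (s * x) ∂ν) :
    (∫ e, reward (fun x => Real.exp (s * x)) c e ∂stateMeasure lam ν) /
        ∫ e, cycleLength c e ∂stateMeasure lam ν =
      lam c * (∫ x, Real.exp (s * x) ∂ν) * (s + (∑ c, lam c) * ((∫ x, Real.exp (s * x) ∂ν) - 1)) /
        (s * ((∑ c, lam c) * (∫ x, x ∂ν) + 1) *
          (∑ c, lam c - s - (∑ c, lam c - lam c) * ∫ x, Real.exp (s * x) ∂ν)) := by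
  have : Nonempty ι := ⟨c⟩
  have hL : 0 < ∑ c, lam c := Finset.sum_pos (fun c _ => hlam c) Finset.univ_nonempty
  have hM0 : 0 < ∫ x, Real.exp (s * x) ∂ν := integral_exp_pos hm
  have hx : 0 ≤ ∫ x, x ∂ν := integral_nonneg_of_ae hν
  have hc := hlam c
  have h0 : 0 ≤ ∫ e, reward (fun x => Real.exp (s * x)) c e ∂stateMeasure lam ν :=
    integral_nonneg_of_ae (reward_exp_nonneg hlam hν c)
  have h1 := lintegral_reward_exp_eq hlam hν c hs hm hD
  have hI := integrable_reward_exp hlam hν c hs hm hD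
  rw [← ofReal_integral_eq_lintegral_ofReal hI (reward_exp_nonneg hlam hν c)] at h1
  -- Equality under `ENNReal.ofReal` determines the closed form only if that is nonnegative; a
  -- positive mean reward excludes a negative one.
  have h2 : 0 < ∫ e, reward (fun x => Real.exp (s * x)) c e ∂stateMeasure lam ν := by
    rw [integral_pos_iff_support_of_nonneg_ae (reward_exp_nonneg hlam hν c) hI]
    have := isProbabilityMeasure_stateMeasure hlam (ν := ν)
    have h3 : ∀ᵐ e ∂stateMeasure lam ν,
        e ∈ Function.support (reward (fun x => Real.exp (s * x)) c) := by
      filter_upwards [ae_cycleLength_cycle_pos hlam hν c] with e he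
      rw [Function.mem_support, reward_exp hs]
      exact (mul_pos (Real.exp_pos _) (exp_sub_one_div_pos hs he)).ne'
    have h4 := (measure_congr (eventuallyEq_univ.2 h3)).trans measure_univ
    exact zero_lt_one.trans_eq h4.symm
  rw [(ENNReal.ofReal_eq_ofReal_iff h0 (by
      by_contra hn
      rw [ENNReal.ofReal_of_nonpos (not_le.1 hn).le] at h1
      exact (ENNReal.ofReal_pos.2 h2).ne' h1)).1 h1, (integrable_cycleLength hlam hν c hint).2]
  generalize ∫ x, Real.exp (s * x) ∂ν = M at *
  generalize ∫ x, x ∂ν = m at *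
  generalize ∑ c, lam c = L at *
  have hp : 0 < L * m + 1 := by positivity
  have hp' : 0 < 1 + L * m := by positivity
  generalize hD' : L - s - (L - lam c) * M = D at *
  field_simp
  rw [← hD']
  ring

end Reward

/-! ### The age in a stationary system -/

namespace StatusUpdateSystem

variable {C : ℕ} {Ω : Type*} {Q : StatusUpdateSystem C Ω}

variable [MeasurableSpace Ω] {P : Measure Ω} [IsProbabilityMeasure P]
  {lam : Fin C → ℝ} (hlam : ∀ c, 0 < lam c) {ν : Measure ℝ} [IsProbabilityMeasure ν]
  (hν : ∀ᵐ x ∂ν, 0 ≤ x) (hint : Integrable (fun x : ℝ => x) ν) (hQ : Q.IsMG11 P lam ν) (c : Fin C)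
  (hst : ∀ t, 0 ≤ t → IdentDistrib (Q.age c t) (Q.age c 0) P P)

namespace IsMG11

include hlam hν hint hQ hst

/-- In a stationary system, the mean of a bounded function of the age is its mean over a cycle. -/
theorem integral_age_eq_of_bounded {f : ℝ → ℝ} (hf : Continuous f) (hf0 : ∀ x, 0 ≤ f x) {N : ℝ}
    (hN : ∀ x, f x ≤ N) {t : ℝ} (ht : 0 ≤ t) :
    ∫ ω, f (Q.age c t ω) ∂P =
      (∫ e, reward f c e ∂stateMeasure lam ν) / ∫ e, cycleLength c e ∂stateMeasure lam ν := by
  obtain ⟨A, hA, hAe⟩ := hQ.exists_measurable_age hlam hν hint c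
  have hlim := hQ.tendsto_timeAverage_age hlam hν hint c hf hf0
    (integrable_reward_of_bounded hlam hν c hint hf hf0 hN)
  have hconst : ∀ t, 0 ≤ t → ∫ ω, f (A t ω) ∂P = ∫ ω, f (Q.age c 0 ω) ∂P := fun t ht => by
    refine Eq.trans (integral_congr_ae ?_) ((hst t ht).comp hf.measurable).integral_eq
    filter_upwards [hAe] with ω h
    simp only [Function.comp, h t]
  have hfA : Measurable (Function.uncurry fun ω t => f (A t ω)) :=
    hf.measurable.comp (hA.comp measurable_swap)
  have hbd : ∀ x, ‖f x‖ ≤ N := fun x => by rw [Real.norm_of_nonneg (hf0 x)]; exact hN x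
  -- By Fubini and stationarity, the expected time average over any horizon is the expectation at
  -- time `0`.
  have hmean : ∀ n : ℕ, 0 < n →
      ∫ ω, ((1 / (n : ℝ)) * ∫ t in (0 : ℝ)..n, f (A t ω)) ∂P = ∫ ω, f (Q.age c 0 ω) ∂P := by
    intro n hn
    have h1 : Integrable (Function.uncurry fun ω t => f (A t ω))
        (P.prod (volume.restrict (Set.uIoc (0 : ℝ) n))) := by
      have : IsFiniteMeasure (volume.restrict (Set.uIoc (0 : ℝ) n)) :=
        Real.isFiniteMeasure_restrict_Ioc _ _
      exact Integrable.of_bound hfA.aestronglyMeasurable N (ae_of_all _ fun p => hbd _)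
    have h2 : (0 : ℝ) ≤ n := n.cast_nonneg
    rw [integral_const_mul]
    simp only [intervalIntegral.integral_of_le h2, ← Set.uIoc_of_le h2]
    rw [integral_integral_swap h1, setIntegral_congr_fun measurableSet_uIoc
      (g := fun _ => ∫ ω, f (Q.age c 0 ω) ∂P) fun t ht => hconst t ?_]
    · have : (n : ℝ) ≠ 0 := by positivity
      simp [h2, this]
    · rw [Set.uIoc_of_le h2] at ht
      exact ht.1.le
  -- The time averages are bounded by `N` and converge almost surely to a constant, so their
  -- expectations converge to it.
  have h3 : Tendsto (fun n : ℕ => ∫ ω, ((1 / (n : ℝ)) * ∫ t in (0 : ℝ)..n, f (A t ω)) ∂P) atTop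
      (𝓝 (∫ _, ((∫ e, reward f c e ∂stateMeasure lam ν) /
        ∫ e, cycleLength c e ∂stateMeasure lam ν) ∂P)) := by
    refine tendsto_integral_of_dominated_convergence (fun _ => N) (fun n => ?_)
      (integrable_const _) (fun n => ae_of_all _ fun ω => ?_) ?_
    · simp only [intervalIntegral.integral_of_le (Nat.cast_nonneg (α := ℝ) n)]
      exact (hfA.stronglyMeasurable.integral_prod_right.const_mul _).aestronglyMeasurable
    · have h4 := intervalIntegral.norm_integral_le_of_norm_le_const (a := 0) (b := (n : ℝ))
        (f := fun t => f (A t ω)) fun t _ => hbd (A t ω)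
      have h5 : 0 ≤ N := (hf0 0).trans (hN 0)
      rw [sub_zero, Nat.abs_cast] at h4
      rw [norm_mul, Real.norm_of_nonneg (by positivity)]
      rcases Nat.eq_zero_or_pos n with rfl | hn
      · simpa using h5
      · have : (0 : ℝ) < n := by positivity
        rw [one_div, inv_mul_le_iff₀ this, mul_comm]
        exact h4
    · filter_upwards [hlim, hAe] with ω h1 h2
      simp only [h2] at h1
      exact h1.comp tendsto_natCast_atTop_atTop
  rw [integral_const, probReal_univ, one_smul] at h3
  have h4 : Tendsto (fun n : ℕ => ∫ ω, ((1 / (n : ℝ)) * ∫ t in (0 : ℝ)..n, f (A t ω)) ∂P) atTop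
      (𝓝 (∫ ω, f (Q.age c 0 ω) ∂P)) := by
    refine tendsto_const_nhds.congr' ?_
    filter_upwards [eventually_gt_atTop 0] with n hn
    exact (hmean n hn).symm
  rw [← tendsto_nhds_unique h4 h3]
  exact ((hst t ht).comp hf.measurable).integral_eq

/-- The exponential is cut off at the level `N`, and both sides converge monotonically. The
resulting identity in `ℝ≥0∞` needs no moment assumption, so it transfers finiteness in both
directions. -/
theorem lintegral_exp_age (s : ℝ) {t : ℝ} (ht : 0 ≤ t) :
    ∫⁻ ω, ENNReal.ofReal (Real.exp (s * Q.age c t ω)) ∂P =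
      (∫⁻ e, ENNReal.ofReal (reward (fun x => Real.exp (s * x)) c e) ∂stateMeasure lam ν) /
        ENNReal.ofReal (∫ e, cycleLength c e ∂stateMeasure lam ν) := by
  have hm := integral_cycleLength_pos hlam hν c hint
  have hage : AEMeasurable (Q.age c t) P := (hst t ht).aemeasurable_fst
  have hexp : Continuous fun x => Real.exp (s * x) := by fun_prop
  have hfc : ∀ N : ℕ, Continuous fun x => min (Real.exp (s * x)) N := fun N =>
    hexp.min continuous_const
  have hf0 : ∀ (N : ℕ) x, 0 ≤ min (Real.exp (s * x)) N := fun N x =>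
    le_min (Real.exp_nonneg _) N.cast_nonneg
  have hmono : ∀ a : ℝ, Monotone fun N : ℕ => min a N := fun a m n h =>
    min_le_min_left _ (Nat.cast_le.2 h)
  have hev : ∀ a : ℝ, ∀ᶠ N : ℕ in atTop, min a N = a := fun a => by
    filter_upwards [tendsto_natCast_atTop_atTop.eventually_ge_atTop a] with N hN
    exact min_eq_left hN
  have hrpos := ae_cycleLength_cycle_pos hlam hν c
  have h1 : Tendsto (fun N : ℕ => ∫⁻ ω, ENNReal.ofReal (min (Real.exp (s * Q.age c t ω)) N) ∂P)
      atTop (𝓝 (∫⁻ ω, ENNReal.ofReal (Real.exp (s * Q.age c t ω)) ∂P)) := by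
    refine lintegral_tendsto_of_tendsto_of_monotone
      (fun N => ((hfc N).measurable.comp_aemeasurable hage).ennreal_ofReal)
      (ae_of_all _ fun ω m n h => ENNReal.ofReal_le_ofReal (hmono _ h))
      (ae_of_all _ fun ω => tendsto_const_nhds.congr' ?_)
    filter_upwards [hev (Real.exp (s * Q.age c t ω))] with N hN
    rw [hN]
  have h2 : Tendsto (fun N : ℕ => ∫⁻ e, ENNReal.ofReal
        (reward (fun x => min (Real.exp (s * x)) N) c e) ∂stateMeasure lam ν) atTop
      (𝓝 (∫⁻ e, ENNReal.ofReal (reward (fun x => Real.exp (s * x)) c e) ∂stateMeasure lam ν)) := by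
    refine lintegral_tendsto_of_tendsto_of_monotone
      (fun N => (measurable_reward (hfc N) c).ennreal_ofReal.aemeasurable) ?_
      (ae_of_all _ fun e => tendsto_const_nhds.congr' ?_)
    · filter_upwards [hrpos] with e he m n h
      exact ENNReal.ofReal_le_ofReal (reward_mono (hfc m) (hfc n) (fun x => hmono _ h) he.le)
    · filter_upwards [eventually_reward_min_eq hexp c e] with N hN
      rw [hN]
  have h3 : ∀ N : ℕ, ∫⁻ ω, ENNReal.ofReal (min (Real.exp (s * Q.age c t ω)) N) ∂P =
      (∫⁻ e, ENNReal.ofReal (reward (fun x => min (Real.exp (s * x)) N) c e) ∂stateMeasure lam ν) /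
        ENNReal.ofReal (∫ e, cycleLength c e ∂stateMeasure lam ν) := by
    intro N
    have hle : ∀ x, min (Real.exp (s * x)) N ≤ N := fun x => min_le_right _ _
    have h4 := hQ.integral_age_eq_of_bounded hlam hν hint c hst (hfc N) (hf0 N) hle ht
    have h5 := integrable_reward_of_bounded hlam hν c hint (hfc N) (hf0 N) hle
    have h6 : Integrable (fun ω => min (Real.exp (s * Q.age c t ω)) N) P :=
      Integrable.of_bound ((hfc N).measurable.comp_aemeasurable hage).aestronglyMeasurable N
        (ae_of_all _ fun ω => by rw [Real.norm_of_nonneg (hf0 N _)]; exact hle _)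
    rw [← ofReal_integral_eq_lintegral_ofReal h6 (ae_of_all _ fun ω => hf0 N _), h4,
      ENNReal.ofReal_div_of_pos hm, ofReal_integral_eq_lintegral_ofReal h5]
    filter_upwards [hrpos] with e he
    exact reward_nonneg (hf0 N) he.le
  simp only [h3] at h1
  refine tendsto_nhds_unique h1 (ENNReal.Tendsto.div_const h2 (Or.inr ?_))
  exact (ENNReal.ofReal_pos.2 hm).ne'

theorem age_mgf {s : ℝ} (hs : s ≠ 0) {t : ℝ} (ht : 0 ≤ t) :
    (Integrable (fun ω => Real.exp (s * Q.age c t ω)) P ↔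
      Integrable (fun x => Real.exp (s * x)) ν ∧
        0 < (∑ c, lam c) - s - ((∑ c, lam c) - lam c) * ∫ x, Real.exp (s * x) ∂ν) ∧
    (Integrable (fun x => Real.exp (s * x)) ν →
      0 < (∑ c, lam c) - s - ((∑ c, lam c) - lam c) * ∫ x, Real.exp (s * x) ∂ν →
      ∫ ω, Real.exp (s * Q.age c t ω) ∂P =
        (∫ e, reward (fun x => Real.exp (s * x)) c e ∂stateMeasure lam ν) /
          ∫ e, cycleLength c e ∂stateMeasure lam ν) := by
  have hm := integral_cycleLength_pos hlam hν c hint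
  have hm' := (ENNReal.ofReal_pos.2 hm).ne'
  have hms : AEStronglyMeasurable (fun ω => Real.exp (s * Q.age c t ω)) P :=
    (Real.measurable_exp.comp_aemeasurable
      ((hst t ht).aemeasurable_fst.const_mul s)).aestronglyMeasurable
  have hnn : 0 ≤ᵐ[P] fun ω => Real.exp (s * Q.age c t ω) := ae_of_all _ fun _ => Real.exp_nonneg _
  have hI : Integrable (fun ω => Real.exp (s * Q.age c t ω)) P ↔
      ∫⁻ e, ENNReal.ofReal (reward (fun x => Real.exp (s * x)) c e) ∂stateMeasure lam ν < ⊤ := by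
    refine (and_iff_right hms).trans ((hasFiniteIntegral_iff_ofReal hnn).trans ?_)
    rw [hQ.lintegral_exp_age hlam hν hint c hst s ht]
    refine ⟨fun h => ?_, fun h => ENNReal.div_lt_top h.ne hm'⟩
    rw [div_eq_mul_inv] at h
    exact ENNReal.lt_top_of_mul_ne_top_left h.ne (ENNReal.inv_ne_zero.2 ENNReal.ofReal_ne_top)
  refine ⟨⟨fun h => of_lintegral_reward_exp_lt_top hlam hν c hs (hI.1 h), fun h => hI.2 ?_⟩,
    fun h hD => ?_⟩
  · rw [lintegral_reward_exp_eq hlam hν c hs h.1 h.2]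
    exact ENNReal.ofReal_lt_top
  · rw [integral_eq_lintegral_of_nonneg_ae hnn hms, hQ.lintegral_exp_age hlam hν hint c hst s ht,
      ENNReal.toReal_div, ENNReal.toReal_ofReal hm.le, ← integral_eq_lintegral_of_nonneg_ae
        (reward_exp_nonneg hlam hν c) (integrable_reward_exp hlam hν c hs h hD).1]

end IsMG11

end StatusUpdateSystem

/-! ### The three claims assembled -/

theorem theorem3 {Ω : Type*} [MeasurableSpace Ω] (P : Measure Ω) [IsProbabilityMeasure P]
    {C : ℕ} (lam : Fin C → ℝ) (hlam : ∀ c, 0 < lam c)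
    (L : ℝ) (hL : L = ∑ c, lam c)
    (ν : Measure ℝ) [IsProbabilityMeasure ν] (hν : ∀ᵐ x ∂ν, 0 ≤ x)
    (μ : ℝ) (hμ : 0 < μ) (hint : Integrable (fun x : ℝ => x) ν) (hmean : ∫ x, x ∂ν = 1 / μ)
    (M : ℝ → ℝ) (hM : ∀ s, M s = ∫ x, Real.exp (s * x) ∂ν)
    (Q : StatusUpdateSystem C Ω) (hQ : Q.IsMG11 P lam ν) (c : Fin C) :
    -- the peak age
    (∀ i, 2 ≤ i → ∀ s : ℝ,
      (Integrable (fun ω => Real.exp (s * Q.peakAge c i ω)) P ↔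
        Integrable (fun x => Real.exp (s * x)) ν ∧ 0 < L - s - (L - lam c) * M s) ∧
      (Integrable (fun x => Real.exp (s * x)) ν → 0 < L - s - (L - lam c) * M s →
        ∫ ω, Real.exp (s * Q.peakAge c i ω) ∂P =
          lam c * M s ^ 2 / (L - s - (L - lam c) * M s))) ∧
    -- the age, when its distribution does not change with time
    ((∀ t, 0 ≤ t → IdentDistrib (Q.age c t) (Q.age c 0) P P) →
      ∀ t, 0 ≤ t → ∀ s : ℝ, s ≠ 0 →
        (Integrable (fun ω => Real.exp (s * Q.age c t ω)) P ↔
          Integrable (fun x => Real.exp (s * x)) ν ∧ 0 < L - s - (L - lam c) * M s) ∧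
        (Integrable (fun x => Real.exp (s * x)) ν → 0 < L - s - (L - lam c) * M s →
          ∫ ω, Real.exp (s * Q.age c t ω) ∂P =
            lam c * M s * (s + L * (M s - 1)) /
              (s * (L / μ + 1) * (L - s - (L - lam c) * M s)))) ∧
    -- the age, as a time average, from an arbitrary initial state
    (∀ s : ℝ, s ≠ 0 → Integrable (fun x => Real.exp (s * x)) ν →
      0 < L - s - (L - lam c) * M s →
      ∀ᵐ ω ∂P, Tendsto (fun τ : ℝ => (1 / τ) * ∫ t in (0 : ℝ)..τ, Real.exp (s * Q.age c t ω))
        atTop (𝓝 (lam c * M s * (s + L * (M s - 1)) /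
          (s * (L / μ + 1) * (L - s - (L - lam c) * M s))))) := by
  subst hL
  have hval : ∀ s : ℝ, s ≠ 0 → Integrable (fun x => Real.exp (s * x)) ν →
      0 < (∑ c, lam c) - s - ((∑ c, lam c) - lam c) * M s →
      (∫ e, reward (fun x => Real.exp (s * x)) c e ∂stateMeasure lam ν) /
          ∫ e, cycleLength c e ∂stateMeasure lam ν =
        lam c * M s * (s + (∑ c, lam c) * (M s - 1)) /
          (s * ((∑ c, lam c) / μ + 1) * ((∑ c, lam c) - s - ((∑ c, lam c) - lam c) * M s)) := by
    intro s hs h hD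
    rw [hM] at hD ⊢
    rw [integral_reward_exp_div hlam hν c hs hint h hD, hmean, mul_one_div]
  refine ⟨fun i hi s => ?_, fun hst t ht s hs => ?_, fun s hs h hD => ?_⟩
  · rw [hM]
    exact hQ.peakAge_mgf hlam hν hint c hi s
  · have h1 := hQ.age_mgf hlam hν hint c hst hs ht
    rw [← hM] at h1
    exact ⟨h1.1, fun h hD => (h1.2 h hD).trans (hval s hs h hD)⟩
  · rw [← hval s hs h hD]
    rw [hM] at hD
    exact hQ.tendsto_timeAverage_age hlam hν hint c (by fun_prop) (fun x => Real.exp_nonneg _)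
      (integrable_reward_exp hlam hν c hs h hD)
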